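/- Let $Q_0\neq Q_1$ be mutually absolutely continuous probability measures on $\mathbb R$ whose symmetrized Kullback–Leibler divergence $$\widetilde D=\int\log\frac{dQ_1}{dQ_0}\,dQ_1+\int\log\frac{dQ_0}{dQ_1}\,dQ_0$$ is finite (both integrands being integrable). Let $G$ be the infinite line graph, with vertex set $\mathbb Z$ and graph distance $d$, and let $\mathcal N_v(t)=\{u: d(u,v)\le t\}$. For a source $v\in\mathbb Z$ let $\mathbb P_v$ (with expectation $\mathbb E_v$) be the law of independent public states $y_u(t)$, $u\in\mathbb Z$, $t=0,1,2,\dots$, with $y_u(t)\sim Q_1$ if $u\in\mathcal N_v(t)$ and $y_u(t)\sim Q_0$ otherwise; write $y(t)=(y_u(t))_{u}$. Fix $v_0\in\mathbb Z$ and, for every $n\ge1$, a neighborhood $V_n$ of $v_0$ with $|V_n|=n$ (that is, $\mathcal N_{v_0}(r)\subseteq V_n\subseteq\mathcal N_{v_0}(r+1)$ for some $r\ge 0$), and let $R_n\ge 1$ be integers. For $\alpha\in(0,1)$, a sequential estimator is a pair $(D,T)$ of a stopping time $T$ of the observation filtration and estimates $D(t)\in V_n$ depending only on $y(0),\dots,y(t)$.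 Let $\Delta(V_n,R_n,\alpha)$ be the set of those with $\mathbb P_v(D(T)=u)\le\alpha/n$ for all $u,v\in V_n$ with $d(u,v)>R_n$, and put $$T^*(V_n,R_n,\alpha)=\inf_{(D,T)\in\Delta(V_n,R_n,\alpha)}\ \max_{v\in V_n}\mathbb E_v[T].$$ Let $Z_{vu}(t)=\sum_{s=0}^t\log\frac{d\mathbb P_v}{d\mathbb P_u}(y(s))$. The MSPRT $(D_n,T_n)$ is given by $T_n=\min_{v\in V_n}T_v$, where $$T_v=\min\Big\{t\ge 0:\min_{u\in V_n\setminus\mathcal N_v(R_n)}Z_{vu}(t)\ge\log\tfrac n\alpha\Big\},$$ and $D_n(t)\in\arg\max_{v\in V_n}\min_{u\in V_n\setminus\mathcal N_v(R_n)}Z_{vu}(t)$, with ties broken in any way that makes $D_n(t)$ a function of $y(0),\dots,y(t)$ (a minimum over the empty set is $+\infty$). For independent $X\sim Q_1$, $Y\sim Q_0$ let $$I(x)=\sup_{\lambda\ge0}\Big\{-\lambda x-\log\mathbb E\Big[\Big(\tfrac{dQ_0}{dQ_1}(X)\Big)^{\lambda}\Big(\tfrac{dQ_1}{dQ_0}(Y)\Big)^{\lambda}\Big]\Big\}$$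 and, for $\varepsilon\in(0,\widetilde D)$, let $C=C_\varepsilon(Q_0,Q_1)=\min\{\widetilde D-\varepsilon,\ I(\widetilde D-\varepsilon)\}$. Write $g\gtrsim_{n,\alpha}h$ if $\liminf_{\alpha\to0}\liminf_{n\to\infty}g(n,\alpha)/h(n,\alpha)\ge1$, and $g\lesssim_{n,\alpha}h$ if $\limsup_{\alpha\to0}\limsup_{n\to\infty}g(n,\alpha)/h(n,\alpha)\le1$; $a_n\ll b_n$ means $a_n=o(b_n)$. Then: 1. There is a constant $K>0$, depending only on $Q_0,Q_1$, such that whenever $R_n\ll n$, an MSPRT exists, every MSPRT $(D_n,T_n)$ belongs to $\Delta(V_n,R_n,\alpha)$ and has $\max_{v\in V_n}\mathbb E_v[T_n]<\infty$ for all $n\ge 1$ and $\alpha\in(0,1)$, and $$\max_{v\in V_n}\mathbb E_v[T_n]\ \lesssim_{n,\alpha}\ K\,T^*(V_n,R_n,\alpha).$$ 2. For every $\varepsilon\in(0,\widetilde D)$ one has $0<C<\widetilde D$, and: - if $R_n\ll\sqrt{\log n}$, then $$\frac{\log n}{2R_n\widetilde D}\lesssim_{n,\alpha}T^*(V_n,R_n,\alpha)\lesssim_{n,\alpha}\frac{\log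 n}{R_nC};$$ - if $R_n\gg\sqrt{\log n}$ and $\log R_n\ll\log n$, then $$\sqrt{\frac{\log n}{\widetilde D}}\lesssim_{n,\alpha}T^*(V_n,R_n,\alpha)\lesssim_{n,\alpha}\sqrt{\frac{\log n}{C}}.$$ -/

import Mathlib

open MeasureTheory ProbabilityTheory Filter Asymptotics Topology
open scoped ENNReal

namespace Cascade

noncomputable section

/-- The infinite line graph: vertex set `ℤ`, consecutive integers adjacent. -/
def line : SimpleGraph ℤ := SimpleGraph.hasse ℤ

section Model

variable {V : Type*}

/-- The set of all vertices within graph distance `t` from `v`. -/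
def nbhd (G : SimpleGraph V) (v : V) (t : ℕ) : Set V := {u | G.edist v u ≤ t}

open scoped Classical in
/-- Law of the public state of the vertex `u` at time `t` when the source is `v`. -/
def stateLaw (G : SimpleGraph V) (Q₀ Q₁ : Measure ℝ) (v : V) (t : ℕ) (u : V) : Measure ℝ :=
  if u ∈ nbhd G v t then Q₁ else Q₀

/-- Law of the collection `y(t)` of all public states at time `t` when the source is `v`
(independent over the vertices). -/
def timeLaw (G : SimpleGraph V) (Q₀ Q₁ : Measure ℝ) (v : V) (t : ℕ) : Measure (V → ℝ) :=
  Measure.infinitePi (fun u : V => stateLaw G Q₀ Q₁ v t u)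

/-- The space of all trajectories of public states; `y t u` is the state of `u` at time `t`. -/
abbrev Path (V : Type*) : Type _ := ℕ → V → ℝ

/-- The law `ℙ_v` of the whole trajectory when the source is `v` (independent over time). -/
def pathLaw (G : SimpleGraph V) (Q₀ Q₁ : Measure ℝ) (v : V) : Measure (Path V) :=
  Measure.infinitePi (fun t : ℕ => timeLaw G Q₀ Q₁ v t)

/-- The filtration of the observations: at time `t`, everything determined by
`y(0), …, y(t)`. -/
def obsFiltration (V : Type*) :
    Filtration ℕ (MeasurableSpace.pi : MeasurableSpace (Path V)) :=
  Filtration.piLE (X := fun _ : ℕ => V → ℝ)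

/-- A sequential estimator `(D, T)` of the source with values in the finite set `W`:
a stopping time `T` (possibly infinite) and estimates `D(t) ∈ W`
depending only on `y(0), …, y(t)`. -/
structure SeqEstimator (W : Finset V) where
  /-- the stopping time -/
  T : Path V → ℕ∞
  /-- the estimates -/
  D : ℕ → Path V → V
  isStoppingTime : IsStoppingTime (obsFiltration V) T
  mem : ∀ t y, D t y ∈ W
  adapted : ∀ t v, MeasurableSet[obsFiltration V t] {y | D t y = v}

/-- The event that the procedure stops and outputs `u`, i.e. `D(T) = u`. -/
def SeqEstimator.outputs {W : Finset V} (S : SeqEstimator W) (u : V) : Set (Path V) :=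
  {y | ∃ t : ℕ, S.T y = t ∧ S.D t y = u}

/-- The class `Δ_G(W, R, α)`: for all `u, v ∈ W` with `d(u,v) > R`,
`ℙ_v(D(T) = u) ≤ α / |W|`. -/
def admissible (G : SimpleGraph V) (Q₀ Q₁ : Measure ℝ) (W : Finset V) (R : ℕ) (α : ℝ) :
    Set (SeqEstimator W) :=
  {S | ∀ u ∈ W, ∀ v ∈ W, (R : ℕ∞) < G.edist u v →
    pathLaw G Q₀ Q₁ v (S.outputs u) ≤ ENNReal.ofReal (α / W.card)}

/-- Worst-case expected value `max_{v ∈ W} 𝔼_v[T]` of a random time. -/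
def worstRuntime (G : SimpleGraph V) (Q₀ Q₁ : Measure ℝ) (W : Finset V)
    (T : Path V → ℕ∞) : ℝ≥0∞ :=
  ⨆ v ∈ W, ∫⁻ y, ((T y : ℕ∞) : ℝ≥0∞) ∂(pathLaw G Q₀ Q₁ v)

/-- The optimal worst-case expected runtime `T*(W, R, α)`. -/
def optRuntime (G : SimpleGraph V) (Q₀ Q₁ : Measure ℝ) (W : Finset V) (R : ℕ) (α : ℝ) :
    ℝ≥0∞ :=
  ⨅ S ∈ admissible G Q₀ Q₁ W R α, worstRuntime G Q₀ Q₁ W S.T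

/-- The cumulative log-likelihood ratio
`Z_{vu}(t) = ∑_{s ≤ t} log (dℙ_v / dℙ_u) (y(s))`. -/
def Z (G : SimpleGraph V) (Q₀ Q₁ : Measure ℝ) (v u : V) (t : ℕ) (y : Path V) : ℝ :=
  ∑ s ∈ Finset.range (t + 1), llr (timeLaw G Q₀ Q₁ v s) (timeLaw G Q₀ Q₁ u s) (y s)

/-- The MSPRT statistic `min_{u ∈ W, d(u,v) > R} Z_{vu}(t)` (a minimum over the empty set
is `+∞`). -/
def msprtStat (G : SimpleGraph V) (Q₀ Q₁ : Measure ℝ) (W : Finset V) (R : ℕ)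
    (v : V) (t : ℕ) (y : Path V) : EReal :=
  ⨅ u ∈ (W : Set V) \ nbhd G v R, (Z G Q₀ Q₁ v u t y : EReal)

/-- The stopping time `T_v`: first time at which the MSPRT statistic of `v` reaches
`log (|W| / α)`. -/
def hitTime (G : SimpleGraph V) (Q₀ Q₁ : Measure ℝ) (W : Finset V) (R : ℕ) (α : ℝ)
    (v : V) (y : Path V) : ℕ∞ :=
  ⨅ (t : ℕ) (_ : (Real.log (W.card / α) : EReal) ≤ msprtStat G Q₀ Q₁ W R v t y), (t : ℕ∞)

/-- The stopping time `min_{v ∈ W} T_v` of the MSPRT. -/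
def msprtTime (G : SimpleGraph V) (Q₀ Q₁ : Measure ℝ) (W : Finset V) (R : ℕ) (α : ℝ)
    (y : Path V) : ℕ∞ :=
  ⨅ v ∈ W, hitTime G Q₀ Q₁ W R α v y

/-- `S` is an MSPRT: it stops at `min_{v ∈ W} T_v`, and its estimate at time `t` is a maximizer
over `v ∈ W` of the MSPRT statistic (ties broken in any way). -/
def IsMSPRT (G : SimpleGraph V) (Q₀ Q₁ : Measure ℝ) (W : Finset V) (R : ℕ) (α : ℝ)
    (S : SeqEstimator W) : Prop :=
  S.T = msprtTime G Q₀ Q₁ W R α ∧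
    ∀ t y, ∀ v ∈ W, msprtStat G Q₀ Q₁ W R v t y ≤ msprtStat G Q₀ Q₁ W R (S.D t y) t y

/-- `W n` is, for every `n ≥ 1`, a neighborhood of `v₀` consisting of `n` vertices: it lies
between two successive balls around `v₀`. -/
def IsNbhdSeq (G : SimpleGraph V) (v₀ : V) (W : ℕ → Finset V) : Prop :=
  ∀ n, 1 ≤ n → (W n).card = n ∧
    ∃ r : ℕ, nbhd G v₀ r ⊆ (W n : Set V) ∧ (W n : Set V) ⊆ nbhd G v₀ (r + 1)

end Model

/-- The symmetrized Kullback-Leibler divergence. -/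
def symmKL (Q₀ Q₁ : Measure ℝ) : ℝ := ∫ x, llr Q₁ Q₀ x ∂Q₁ + ∫ x, llr Q₀ Q₁ x ∂Q₀

/-- The moment integrand `(dQ₀/dQ₁ (X))^l (dQ₁/dQ₀ (Y))^l`, as a function of `(X, Y)`. -/
def lrPow (Q₀ Q₁ : Measure ℝ) (l : ℝ) (p : ℝ × ℝ) : ℝ :=
  (Q₀.rnDeriv Q₁ p.1).toReal ^ l * (Q₁.rnDeriv Q₀ p.2).toReal ^ l

/-- The Chernoff exponent
`I(x) = sup_{l ≥ 0} { - l x - log 𝔼 [(dQ₀/dQ₁ (X))^l (dQ₁/dQ₀ (Y))^l] }` for independent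
`X ∼ Q₁`, `Y ∼ Q₀`; values of `l` whose moment is infinite would contribute `-∞`
and are left out. -/
def chernoffExp (Q₀ Q₁ : Measure ℝ) (x : ℝ) : ℝ :=
  sSup {z : ℝ | ∃ l : ℝ, 0 ≤ l ∧ Integrable (lrPow Q₀ Q₁ l) (Q₁.prod Q₀) ∧
    z = -(l * x) - Real.log (∫ p, lrPow Q₀ Q₁ l p ∂(Q₁.prod Q₀))}

/-- The constant `C(Q₀, Q₁) = min {D - ε, I(D - ε)}`, `D` the symmetrized divergence. -/
def constC (Q₀ Q₁ : Measure ℝ) (ε : ℝ) : ℝ :=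
  min (symmKL Q₀ Q₁ - ε) (chernoffExp Q₀ Q₁ (symmKL Q₀ Q₁ - ε))

/-- `g ≳_{n,α} h`: `liminf_{α → 0} liminf_{n → ∞} g(n,α) / h(n,α) ≥ 1`. -/
def AsympGE (g h : ℕ → ℝ → ℝ≥0∞) : Prop :=
  1 ≤ liminf (fun α : ℝ => liminf (fun n : ℕ => g n α / h n α) atTop) (𝓝[>] 0)

/-- `g ≲_{n,α} h`: `limsup_{α → 0} limsup_{n → ∞} g(n,α) / h(n,α) ≤ 1`. -/
def AsympLE (g h : ℕ → ℝ → ℝ≥0∞) : Prop :=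
  limsup (fun α : ℝ => limsup (fun n : ℕ => g n α / h n α) atTop) (𝓝[>] 0) ≤ 1

end

end Cascade

/-! On the line, the balls of radius `s` around two vertices at distance `k` differ in `min k (2 * s
+ 1)` points on each side. Up to time `t` the log-likelihood ratio of two sources is therefore,
almost surely, a sum of `diffCount k t` independent pairs `llr Q₁ Q₀ X + llr Q₀ Q₁ Y`, each with
mean `symmKL Q₀ Q₁` under the first source. This count is at most both `k * (t + 1)` and `(t + 1) ^
2`, and the runtime is governed by the time at which `diffCount (R + 1) t` reaches the order of `log
n`: about `log n / R` for small `R`, about `√(log n)` for large `R`.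

Upper bound. The MSPRT is admissible by a change of measure on each event `{T = t, D = u}`
(`isMSPRT_admissible`), so its runtime dominates `optRuntime`. A union bound over wrong sources and
a Chernoff bound give tails of the form `n * exp (l * log (n / α)) * ρ ^ diffCount (R + 1) t`,
summable since the count grows at every step (`worstRuntime_msprt_le`). Taking `l` nearly optimal in
`chernoffExp` makes this at most one once `C * diffCount` slightly exceeds `log n`
(`exists_worstRuntime_msprt_le`): one part of the exponent pays for the union bound, the other for
the threshold.

Sharp lower bound. A procedure that stops early at a true source `v` either errs by more than `R`,
or answers on one side of `v`. That answer would be wrong for a source at distance `R + 1` on the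
other side, where it has probability at most `(R + 1) * α / n` (`measure_stop_le`). Transferring the
event back to `v` costs a factor `exp ((symmKL + δ) * diffCount)`, by a weak law needing only first
moments (`logLR_upper_tail`). If `log R ≪ log n`, the product is negligible while `symmKL *
diffCount ≤ s * log n` with `s < 1`.

Lower bound for all `R ≪ n`. The factor `(R + 1) / n` may decay slower than every power of `n`, so a
different argument is needed. Two clusters of about `√n` sources are placed at opposite ends of the
neighborhood, with light cones disjoint up to time `t` inside each cluster. When `t` is a small
multiple of `√(log n)`, a truncated second moment shows that both mixtures are close to the law
without a source, hence nearly indistinguishable, although they demand incompatible answers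
(`exists_measure_stop_le`). Comparing the upper bound with whichever lower bound applies gives the
constant-factor optimality (`exists_asympLE_msprt`). -/

namespace Cascade

/-! ### Densities of infinite products that differ in finitely many factors -/

section InfiniteProducts

variable {ι : Type*} {X : ι → Type*} [∀ i, MeasurableSpace (X i)]

lemma lintegral_infinitePi_prod (μ : ∀ i, Measure (X i)) [∀ i, IsProbabilityMeasure (μ i)]
    (F : Finset ι) (g : ∀ i, X i → ℝ≥0∞) (hg : ∀ i, Measurable (g i)) :
    ∫⁻ y, ∏ i ∈ F, g i (y i) ∂(Measure.infinitePi μ) = ∏ i ∈ F, ∫⁻ x, g i x ∂(μ i) := by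
  refine (lintegral_prod_eq_prod_lintegral_of_indepFun (μ := Measure.infinitePi μ) F
    (fun i (y : ∀ i, X i) => g i (y i)) (iIndepFun_infinitePi hg)
    (fun i => (hg i).comp (measurable_pi_apply i))).trans ?_
  refine Finset.prod_congr rfl fun i _ => ?_
  exact (measurePreserving_eval_infinitePi μ i).lintegral_comp (hg i)

lemma lintegral_infinitePi_eval (μ : ∀ i, Measure (X i)) [∀ i, IsProbabilityMeasure (μ i)]
    (i : ι) (g : X i → ℝ≥0∞) (hg : Measurable g) :
    ∫⁻ y, g (y i) ∂(Measure.infinitePi μ) = ∫⁻ x, g x ∂(μ i) :=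
  (measurePreserving_eval_infinitePi μ i).lintegral_comp hg

lemma ae_infinitePi_eval (μ : ∀ i, Measure (X i)) [∀ i, IsProbabilityMeasure (μ i)]
    (i : ι) {p : X i → Prop} (h : ∀ᵐ x ∂(μ i), p x) :
    ∀ᵐ y ∂(Measure.infinitePi μ), p (y i) :=
  (measurePreserving_eval_infinitePi μ i).quasiMeasurePreserving.ae h

/-- An infinite product is determined by its values on finite boxes. The integral of the density
over a box based on `s` factors over `s ∪ F`; a coordinate of `F` outside `s` contributes the total
mass of `μ i`, which is one. -/
lemma infinitePi_withDensity (μ ν : ∀ i, Measure (X i)) [∀ i, IsProbabilityMeasure (μ i)]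
    [∀ i, IsProbabilityMeasure (ν i)] (F : Finset ι) (g : ∀ i, X i → ℝ≥0∞)
    (hg : ∀ i, Measurable (g i)) (hF : ∀ i ∈ F, (ν i).withDensity (g i) = μ i)
    (hF' : ∀ i ∉ F, μ i = ν i) :
    (Measure.infinitePi ν).withDensity (fun y => ∏ i ∈ F, g i (y i)) = Measure.infinitePi μ := by
  classical
  refine Measure.eq_infinitePi μ fun s t ht => ?_
  have hbox : MeasurableSet (Set.pi (s : Set ι) t) :=
    MeasurableSet.pi s.countable_toSet fun i _ => ht i
  rw [withDensity_apply _ hbox, ← lintegral_indicator hbox]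
  have hpt : ∀ y : ∀ i, X i, (Set.pi (s : Set ι) t).indicator (fun y => ∏ i ∈ F, g i (y i)) y =
      ∏ i ∈ s ∪ F, ((if i ∈ s then (t i).indicator 1 (y i) else 1) *
        (if i ∈ F then g i (y i) else 1)) := by
    intro y
    rw [Finset.prod_mul_distrib, Finset.prod_ite_mem, Finset.prod_ite_mem,
      Finset.union_inter_cancel_left, Finset.union_inter_cancel_right]
    by_cases hy : y ∈ Set.pi (s : Set ι) t
    · have h1 : ∏ i ∈ s, (t i).indicator (1 : X i → ℝ≥0∞) (y i) = 1 :=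
        Finset.prod_eq_one fun i hi => by rw [Set.indicator_of_mem (hy i hi)]; rfl
      rw [Set.indicator_of_mem hy, h1, one_mul]
    · rw [Set.indicator_of_notMem hy]
      simp only [Set.mem_pi, not_forall] at hy
      obtain ⟨i, hi, hyi⟩ := hy
      rw [Finset.prod_eq_zero hi, zero_mul]
      exact Set.indicator_of_notMem hyi _
  simp_rw [hpt]
  rw [lintegral_infinitePi_prod ν (s ∪ F)
    (fun i x => (if i ∈ s then (t i).indicator 1 x else 1) * (if i ∈ F then g i x else 1))]
  · have hs : ∏ i ∈ s, μ i (t i) = ∏ i ∈ s ∪ F, if i ∈ s then μ i (t i) else 1 := by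
      rw [Finset.prod_ite_mem, Finset.union_inter_cancel_left]
    rw [hs]
    refine Finset.prod_congr rfl fun i _ => ?_
    by_cases h1 : i ∈ s <;> by_cases h2 : i ∈ F <;> simp only [h1, h2, if_true, if_false,
      one_mul, mul_one]
    · rw [← hF i h2, withDensity_apply _ (ht i), ← lintegral_indicator (ht i)]
      refine lintegral_congr fun x => ?_
      by_cases hx : x ∈ t i <;> simp [hx]
    · rw [lintegral_indicator_one (ht i), hF' i h2]
    · rw [← setLIntegral_univ, ← withDensity_apply _ MeasurableSet.univ, hF i h2, measure_univ]
    · simp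
  · intro i
    refine Measurable.mul ?_ ?_
    · split_ifs
      · exact measurable_one.indicator (ht i)
      · exact measurable_const
    · split_ifs
      · exact hg i
      · exact measurable_const

lemma withDensity_exp_llr {α : Type*} [MeasurableSpace α] (μ ν : Measure α) [SigmaFinite μ]
    [SigmaFinite ν] (h1 : μ ≪ ν) (h2 : ν ≪ μ) :
    ν.withDensity (fun x => ENNReal.ofReal (Real.exp (llr μ ν x))) = μ := by
  rw [← Measure.withDensity_rnDeriv_eq μ ν h1]
  refine withDensity_congr_ae ?_
  rw [Measure.withDensity_rnDeriv_eq μ ν h1]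
  filter_upwards [exp_llr_of_ac' μ ν h2, Measure.rnDeriv_lt_top μ ν] with x hx hx'
  rw [hx, ENNReal.ofReal_toReal hx'.ne]

variable (μ ν : ∀ i, Measure (X i)) [∀ i, IsProbabilityMeasure (μ i)]
    [∀ i, IsProbabilityMeasure (ν i)]

lemma withDensity_infinitePi_exp_llr (hμν : ∀ i, μ i ≪ ν i) (hνμ : ∀ i, ν i ≪ μ i)
    (F : Finset ι) (hF : ∀ i ∉ F, μ i = ν i) :
    (Measure.infinitePi ν).withDensity
      (fun y => ENNReal.ofReal (Real.exp (∑ i ∈ F, llr (μ i) (ν i) (y i)))) =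
      Measure.infinitePi μ := by
  rw [← infinitePi_withDensity μ ν F
    (fun i x => ENNReal.ofReal (Real.exp (llr (μ i) (ν i) x)))
    (fun i => ((measurable_llr _ _).exp).ennreal_ofReal)
    (fun i _ => withDensity_exp_llr _ _ (hμν i) (hνμ i)) hF]
  congr 1
  ext y
  rw [Real.exp_sum, ENNReal.ofReal_prod_of_nonneg fun i _ => (Real.exp_pos _).le]

lemma infinitePi_absolutelyContinuous (hμν : ∀ i, μ i ≪ ν i) (hνμ : ∀ i, ν i ≪ μ i)
    (F : Finset ι) (hF : ∀ i ∉ F, μ i = ν i) :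
    Measure.infinitePi μ ≪ Measure.infinitePi ν := by
  rw [← withDensity_infinitePi_exp_llr μ ν hμν hνμ F hF]
  exact withDensity_absolutelyContinuous _ _

lemma llr_infinitePi (hμν : ∀ i, μ i ≪ ν i) (hνμ : ∀ i, ν i ≪ μ i)
    (F : Finset ι) (hF : ∀ i ∉ F, μ i = ν i) :
    llr (Measure.infinitePi μ) (Measure.infinitePi ν) =ᵐ[Measure.infinitePi ν]
      fun y => ∑ i ∈ F, llr (μ i) (ν i) (y i) := by
  have h := Measure.rnDeriv_withDensity (Measure.infinitePi ν)
    (f := fun y => ENNReal.ofReal (Real.exp (∑ i ∈ F, llr (μ i) (ν i) (y i))))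
    (Finset.measurable_sum F fun i _ =>
      (measurable_llr _ _).comp (measurable_pi_apply i)).exp.ennreal_ofReal
  rw [withDensity_infinitePi_exp_llr μ ν hμν hνμ F hF] at h
  filter_upwards [h] with y hy
  rw [llr, hy, ENNReal.toReal_ofReal (Real.exp_pos _).le, Real.log_exp]

end InfiniteProducts

/-! ### Change of measure on the observations up to a finite time -/

section ChangeOfMeasure

variable {E : ℕ → Type*} [∀ s, MeasurableSpace (E s)] (μ ν : ∀ s, Measure (E s))
  [∀ s, IsProbabilityMeasure (μ s)] [∀ s, IsProbabilityMeasure (ν s)]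

lemma infinitePi_congr_piLE {t : ℕ} (h : ∀ s ≤ t, μ s = ν s) {A : Set (∀ s, E s)}
    (hA : MeasurableSet[Filtration.piLE (X := E) t] A) :
    Measure.infinitePi μ A = Measure.infinitePi ν A := by
  obtain ⟨B, hB, rfl⟩ := hA
  have h1 := Measure.infinitePi_map_restrict' μ (I := Set.Iic t)
  have h2 := Measure.infinitePi_map_restrict' ν (I := Set.Iic t)
  have h3 : (fun i : Set.Iic t => μ i) = fun i : Set.Iic t => ν i := funext fun i => h i i.2
  have hm : Measurable (Set.domRestrict (π := E) (Set.Iic t)) := by fun_prop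
  have key : (Measure.infinitePi μ).map (Set.domRestrict (Set.Iic t)) =
      (Measure.infinitePi ν).map (Set.domRestrict (Set.Iic t)) := by
    rw [h1, h2]; simp only [h3]
  have := congrArg (fun m => m B) key
  simp only [Measure.map_apply hm hB] at this
  exact this

lemma infinitePi_change_of_measure (hμν : ∀ s, μ s ≪ ν s) (hνμ : ∀ s, ν s ≪ μ s) {t : ℕ}
    {A : Set (∀ s, E s)} (hA : MeasurableSet[Filtration.piLE (X := E) t] A) :
    Measure.infinitePi μ A = ∫⁻ y in A, ENNReal.ofReal
      (Real.exp (∑ s ∈ Finset.range (t + 1), llr (μ s) (ν s) (y s))) ∂(Measure.infinitePi ν) := by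
  classical
  -- The full trajectory laws need not be absolutely continuous. The hybrid `κ` agrees with `μ` up
  -- to time `t`, so it has the same value on `A`, and differs from `ν` in finitely many factors
  -- only.
  let κ : ∀ s, Measure (E s) := fun s => if s ≤ t then μ s else ν s
  have : ∀ s, IsProbabilityMeasure (κ s) := fun s => by
    simp only [κ]; split_ifs <;> infer_instance
  have h1 : Measure.infinitePi μ A = Measure.infinitePi κ A :=
    infinitePi_congr_piLE μ κ (fun s hs => by simp [κ, hs]) hA
  rw [h1, ← withDensity_infinitePi_exp_llr κ ν _ _ (Finset.range (t + 1)),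
    withDensity_apply _ (Filtration.piLE (X := E) |>.le t A hA)]
  · refine lintegral_congr fun y => ?_
    congr 2
    refine Finset.sum_congr rfl fun s hs => ?_
    have : s ≤ t := Nat.lt_succ_iff.1 (Finset.mem_range.1 hs)
    simp [κ, this]
  · intro s hs
    have : ¬ s ≤ t := fun h => hs (Finset.mem_range.2 (Nat.lt_succ_of_le h))
    simp [κ, this]
  · intro s; simp only [κ]; split_ifs
    · exact hμν s
    · exact .rfl
  · intro s; simp only [κ]; split_ifs
    · exact hνμ s
    · exact .rfl

end ChangeOfMeasure

/-! ### Balls in the line and the number of discriminating observations -/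

section LineGeometry

/-- Unit steps give a path of the required length; conversely each edge of a walk changes the
coordinate by exactly one. -/
lemma edist_line (v u : ℤ) : line.edist v u = ((u - v).natAbs : ℕ∞) := by
  have hadj : ∀ a : ℤ, line.Adj a (a + 1) := fun a =>
    SimpleGraph.hasse_adj.2 (Or.inl (Order.covBy_add_one a))
  have hup : ∀ (k : ℕ) (a : ℤ), line.edist a (a + k) ≤ k := by
    intro k
    induction k with
    | zero => intro a; simp
    | succ k ih =>
      intro a
      have h1 : line.edist (a + k) (a + (k + 1 : ℕ)) = 1 := by
        rw [SimpleGraph.edist_eq_one_iff_adj]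
        have := hadj (a + k)
        rwa [add_assoc] at this
      calc line.edist a (a + (k + 1 : ℕ)) ≤ line.edist a (a + k) +
            line.edist (a + k) (a + (k + 1 : ℕ)) := SimpleGraph.edist_triangle
        _ ≤ k + 1 := by rw [h1]; exact add_le_add_left (ih a) 1
        _ = ((k + 1 : ℕ) : ℕ∞) := by push_cast; rfl
  have hwalk : ∀ {a b : ℤ} (p : line.Walk a b), (b - a).natAbs ≤ p.length := by
    intro a b p
    induction p with
    | nil => simp
    | @cons a c b h p ih =>
      have h' := SimpleGraph.hasse_adj.1 h
      rw [Order.covBy_iff_add_one_eq, Order.covBy_iff_add_one_eq] at h'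
      rw [SimpleGraph.Walk.length_cons]
      omega
  refine le_antisymm ?_ ?_
  · rcases le_total v u with h | h
    · have := hup (u - v).natAbs v
      rwa [show v + ((u - v).natAbs : ℤ) = u by omega] at this
    · have := hup (u - v).natAbs u
      rw [show u + ((u - v).natAbs : ℤ) = v by omega] at this
      rwa [SimpleGraph.edist_comm]
  · rw [SimpleGraph.edist]
    exact le_iInf fun p => by exact_mod_cast hwalk p

lemma mem_nbhd_line {v u : ℤ} {t : ℕ} : u ∈ nbhd line v t ↔ (u - v).natAbs ≤ t := by
  rw [nbhd, Set.mem_ofPred_eq, edist_line]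
  exact_mod_cast Iff.rfl

/-- The ball of radius `t` around `v` in the line. -/
noncomputable def ball (v : ℤ) (t : ℕ) : Finset ℤ := Finset.Icc (v - t) (v + t)

lemma mem_ball {v u : ℤ} {t : ℕ} : u ∈ ball v t ↔ (u - v).natAbs ≤ t := by
  rw [ball, Finset.mem_Icc]; omega

lemma card_ball (v : ℤ) (t : ℕ) : (ball v t).card = 2 * t + 1 := by
  rw [ball, Int.card_Icc]; omega

lemma card_ball_sdiff (v u : ℤ) (s : ℕ) :
    (ball v s \ ball u s).card = min (u - v).natAbs (2 * s + 1) := by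
  have h := Finset.card_sdiff_add_card_inter (ball v s) (ball u s)
  rw [card_ball] at h
  have h2 : (ball v s ∩ ball u s).card = (min v u + s + 1 - (max v u - s)).toNat := by
    rw [← Int.card_Icc]
    congr 1
    ext w
    simp only [ball, Finset.mem_inter, Finset.mem_Icc]
    omega
  omega

/-- Number of space-time points at distance at most their time coordinate `s ≤ t` from one, but
not from the other, of two vertices of the line at distance `k`. -/
def diffCount (k t : ℕ) : ℕ := ∑ s ∈ Finset.range (t + 1), min k (2 * s + 1)

lemma diffCount_mono_left {k k' : ℕ} (h : k ≤ k') (t : ℕ) : diffCount k t ≤ diffCount k' t :=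
  Finset.sum_le_sum fun _ _ => min_le_min_right _ h

lemma diffCount_le_mul (k t : ℕ) : diffCount k t ≤ k * (t + 1) := by
  calc diffCount k t ≤ ∑ _s ∈ Finset.range (t + 1), k :=
        Finset.sum_le_sum fun _ _ => min_le_left _ _
    _ = k * (t + 1) := by rw [Finset.sum_const, Finset.card_range, smul_eq_mul, mul_comm]

lemma sum_range_two_mul_add_one (t : ℕ) :
    ∑ s ∈ Finset.range (t + 1), (2 * s + 1) = (t + 1) ^ 2 := by
  induction t with
  | zero => simp
  | succ t ih => rw [Finset.sum_range_succ, ih]; ring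

lemma diffCount_le_sq (k t : ℕ) : diffCount k t ≤ (t + 1) ^ 2 := by
  rw [← sum_range_two_mul_add_one]
  exact Finset.sum_le_sum fun _ _ => min_le_right _ _

lemma diffCount_eq_sq {k t : ℕ} (h : 2 * t + 1 ≤ k) : diffCount k t = (t + 1) ^ 2 := by
  rw [← sum_range_two_mul_add_one]
  refine Finset.sum_congr rfl fun s hs => min_eq_right ?_
  have := Finset.mem_range.1 hs
  omega

/-- Every time step contributes at least one new discrepancy. This weak growth is all that is needed
to sum the tail of the stopping time as a geometric series. -/
lemma diffCount_add_le {k : ℕ} (hk : 1 ≤ k) (t j : ℕ) :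
    diffCount k t + j ≤ diffCount k (t + j) := by
  induction j with
  | zero => simp
  | succ j ih =>
    have : diffCount k (t + (j + 1)) = diffCount k (t + j) + min k (2 * (t + j + 1) + 1) := by
      rw [diffCount, show t + (j + 1) + 1 = (t + j + 1) + 1 by ring, Finset.sum_range_succ]; rfl
    omega

lemma le_diffCount {k : ℕ} (hk : 1 ≤ k) (t : ℕ) : t + 1 ≤ diffCount k t := by
  have := diffCount_add_le hk 0 t
  have h0 : diffCount k 0 = min k 1 := by simp [diffCount]
  rw [zero_add] at this
  omega

/-- From time `k` on the balls are longer than the shift, so each later step contributes the full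
`k`; the first `k` steps are discarded. -/
lemma mul_le_diffCount (k t : ℕ) : k * t ≤ diffCount k (t + k) := by
  induction t with
  | zero => simp
  | succ t ih =>
    have : diffCount k (t + 1 + k) = diffCount k (t + k) + min k (2 * (t + k + 1) + 1) := by
      rw [diffCount, show t + 1 + k + 1 = (t + k + 1) + 1 by ring, Finset.sum_range_succ]; rfl
    rw [this, min_eq_left (by omega), mul_add, mul_one]
    omega

end LineGeometry

/-! ### Product laws given by space-time patterns, and their likelihood ratios -/

section Patterns

variable (Q₀ Q₁ : Measure ℝ)

/-- The product law on `ℤ → ℝ` whose factors are `Q₁` on `A` and `Q₀` off `A`. -/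
noncomputable def blockLaw (A : Finset ℤ) : Measure (ℤ → ℝ) :=
  Measure.infinitePi fun w => if w ∈ A then Q₁ else Q₀

/-- The law of independent states which are `Q₁` on the vertices of `B t` at time `t`, and `Q₀`
elsewhere. -/
noncomputable def patternLaw (B : ℕ → Finset ℤ) : Measure (Path ℤ) :=
  Measure.infinitePi fun t => blockLaw Q₀ Q₁ (B t)

lemma timeLaw_line (v : ℤ) (t : ℕ) : timeLaw line Q₀ Q₁ v t = blockLaw Q₀ Q₁ (ball v t) := by
  unfold timeLaw blockLaw stateLaw
  congr 1
  ext1 u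
  simp only [mem_nbhd_line, mem_ball]

lemma pathLaw_line (v : ℤ) : pathLaw line Q₀ Q₁ v = patternLaw Q₀ Q₁ (ball v) := by
  unfold pathLaw patternLaw
  simp only [timeLaw_line]

/-- Sum of `p` over the points of `A \ A'` and of `q` over the points of `A' \ A`. -/
def blockSum (p q : ℝ → ℝ) (A A' : Finset ℤ) (y : ℤ → ℝ) : ℝ :=
  ∑ w ∈ A \ A', p (y w) + ∑ w ∈ A' \ A, q (y w)

/-- Sum of the block sums up to time `t`. -/
def pathSum (p q : ℝ → ℝ) (B B' : ℕ → Finset ℤ) (t : ℕ) (y : Path ℤ) : ℝ :=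
  ∑ s ∈ Finset.range (t + 1), blockSum p q (B s) (B' s) (y s)

/-- The log-likelihood ratio of two pattern laws on the observations up to time `t`. -/
noncomputable def logLR (B B' : ℕ → Finset ℤ) (t : ℕ) (y : Path ℤ) : ℝ :=
  ∑ s ∈ Finset.range (t + 1), llr (blockLaw Q₀ Q₁ (B s)) (blockLaw Q₀ Q₁ (B' s)) (y s)

lemma Z_line (v u : ℤ) (t : ℕ) (y : Path ℤ) :
    Z line Q₀ Q₁ v u t y = logLR Q₀ Q₁ (ball v) (ball u) t y := by
  simp only [Z, logLR, timeLaw_line]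

lemma measurable_logLR (B B' : ℕ → Finset ℤ) (t : ℕ) : Measurable (logLR Q₀ Q₁ B B' t) :=
  Finset.measurable_sum _ fun s _ => (measurable_llr _ _).comp (measurable_pi_apply s)

lemma measurable_blockSum {p q : ℝ → ℝ} (hp : Measurable p) (hq : Measurable q)
    (A A' : Finset ℤ) : Measurable (blockSum p q A A') :=
  (Finset.measurable_sum _ fun w _ => hp.comp (measurable_pi_apply w)).add
    (Finset.measurable_sum _ fun w _ => hq.comp (measurable_pi_apply w))

lemma measurable_pathSum {p q : ℝ → ℝ} (hp : Measurable p) (hq : Measurable q)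
    (B B' : ℕ → Finset ℤ) (t : ℕ) : Measurable (pathSum p q B B' t) :=
  Finset.measurable_sum _ fun s _ =>
    (measurable_blockSum hp hq _ _).comp (measurable_pi_apply s)

variable [IsProbabilityMeasure Q₀] [IsProbabilityMeasure Q₁]

instance isProbabilityMeasure_ite (c : Prop) [Decidable c] :
    IsProbabilityMeasure (if c then Q₁ else Q₀) := by
  split_ifs <;> infer_instance

instance (A : Finset ℤ) : IsProbabilityMeasure (blockLaw Q₀ Q₁ A) := by
  unfold blockLaw; infer_instance

instance (B : ℕ → Finset ℤ) : IsProbabilityMeasure (patternLaw Q₀ Q₁ B) := by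
  unfold patternLaw; infer_instance

variable {Q₀ Q₁}

lemma blockLaw_absolutelyContinuous (h01 : Q₀ ≪ Q₁) (h10 : Q₁ ≪ Q₀) (A A' : Finset ℤ) :
    blockLaw Q₀ Q₁ A ≪ blockLaw Q₀ Q₁ A' := by
  refine infinitePi_absolutelyContinuous _ _ ?_ ?_ (A ∪ A') ?_
  · intro w; split_ifs <;> first | exact .rfl | assumption
  · intro w; split_ifs <;> first | exact .rfl | assumption
  · intro w hw
    simp only [Finset.mem_union, not_or] at hw
    simp [hw.1, hw.2]

lemma llr_blockLaw (h01 : Q₀ ≪ Q₁) (h10 : Q₁ ≪ Q₀) (A A' A'' : Finset ℤ) :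
    llr (blockLaw Q₀ Q₁ A) (blockLaw Q₀ Q₁ A') =ᵐ[blockLaw Q₀ Q₁ A'']
      blockSum (llr Q₁ Q₀) (llr Q₀ Q₁) A A' := by
  refine (blockLaw_absolutelyContinuous h01 h10 A'' A').ae_le ?_
  have h := llr_infinitePi (fun w : ℤ => if w ∈ A then Q₁ else Q₀)
    (fun w : ℤ => if w ∈ A' then Q₁ else Q₀) ?_ ?_ ((A \ A') ∪ (A' \ A)) ?_
  · filter_upwards [h] with y hy
    refine hy.trans ?_
    rw [Finset.sum_union, blockSum]
    · congr 1
      · refine Finset.sum_congr rfl fun w hw => ?_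
        rw [Finset.mem_sdiff] at hw
        simp [hw.1, hw.2]
      · refine Finset.sum_congr rfl fun w hw => ?_
        rw [Finset.mem_sdiff] at hw
        simp [hw.1, hw.2]
    · exact disjoint_sdiff_sdiff
  · intro w; split_ifs <;> first | exact .rfl | assumption
  · intro w; split_ifs <;> first | exact .rfl | assumption
  · intro w hw
    simp only [Finset.mem_union, Finset.mem_sdiff] at hw
    by_cases h1 : w ∈ A <;> by_cases h2 : w ∈ A' <;> simp_all

/-- Radon–Nikodym derivatives are only determined up to null sets. Each one-time identity involves
finitely many sites, and one-time laws of different patterns are mutually absolutely continuous, so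
the explicit sum is valid under any third pattern `B''`. -/
lemma logLR_ae_eq (h01 : Q₀ ≪ Q₁) (h10 : Q₁ ≪ Q₀) (B B' B'' : ℕ → Finset ℤ) (t : ℕ) :
    logLR Q₀ Q₁ B B' t =ᵐ[patternLaw Q₀ Q₁ B'']
      pathSum (llr Q₁ Q₀) (llr Q₀ Q₁) B B' t := by
  have h : ∀ s : ℕ, ∀ᵐ y ∂(patternLaw Q₀ Q₁ B''),
      llr (blockLaw Q₀ Q₁ (B s)) (blockLaw Q₀ Q₁ (B' s)) (y s) =
        blockSum (llr Q₁ Q₀) (llr Q₀ Q₁) (B s) (B' s) (y s) := fun s =>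
    ae_infinitePi_eval (fun s => blockLaw Q₀ Q₁ (B'' s)) s
      (llr_blockLaw h01 h10 (B s) (B' s) (B'' s))
  filter_upwards [ae_all_iff.2 h] with y hy
  exact Finset.sum_congr rfl fun s _ => hy s

lemma patternLaw_change_of_measure (h01 : Q₀ ≪ Q₁) (h10 : Q₁ ≪ Q₀) (B B' : ℕ → Finset ℤ)
    {t : ℕ} {A : Set (Path ℤ)} (hA : MeasurableSet[obsFiltration ℤ t] A) :
    patternLaw Q₀ Q₁ B A =
      ∫⁻ y in A, ENNReal.ofReal (Real.exp (logLR Q₀ Q₁ B B' t y)) ∂(patternLaw Q₀ Q₁ B') :=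
  infinitePi_change_of_measure (fun s => blockLaw Q₀ Q₁ (B s)) (fun s => blockLaw Q₀ Q₁ (B' s))
    (fun _ => blockLaw_absolutelyContinuous h01 h10 _ _)
    (fun _ => blockLaw_absolutelyContinuous h01 h10 _ _) hA

/-- Under the law of `A` the summands on `A \ A'` are distributed as `Q₁` and those on `A' \ A` as
`Q₀`, all independent. -/
lemma lintegral_exp_blockSum {p q : ℝ → ℝ} (hp : Measurable p) (hq : Measurable q)
    (A A' : Finset ℤ) :
    ∫⁻ y, ENNReal.ofReal (Real.exp (blockSum p q A A' y)) ∂(blockLaw Q₀ Q₁ A) =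
      (∫⁻ x, ENNReal.ofReal (Real.exp (p x)) ∂Q₁) ^ (A \ A').card *
        (∫⁻ x, ENNReal.ofReal (Real.exp (q x)) ∂Q₀) ^ (A' \ A).card := by
  have hdisj : Disjoint (A \ A') (A' \ A) := disjoint_sdiff_sdiff
  have h := lintegral_infinitePi_prod (fun w : ℤ => if w ∈ A then Q₁ else Q₀)
    ((A \ A') ∪ (A' \ A))
    (fun w x => ENNReal.ofReal (Real.exp (if w ∈ A then p x else q x)))
    (fun w => by
      by_cases hw : w ∈ A <;> simp only [hw, if_true, if_false]
      · exact hp.exp.ennreal_ofReal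
      · exact hq.exp.ennreal_ofReal)
  rw [Finset.prod_union hdisj] at h
  have h1 : ∀ w ∈ A \ A', (∫⁻ x, ENNReal.ofReal (Real.exp (if w ∈ A then p x else q x))
      ∂(if w ∈ A then Q₁ else Q₀)) = ∫⁻ x, ENNReal.ofReal (Real.exp (p x)) ∂Q₁ := by
    intro w hw
    simp [(Finset.mem_sdiff.1 hw).1]
  have h2 : ∀ w ∈ A' \ A, (∫⁻ x, ENNReal.ofReal (Real.exp (if w ∈ A then p x else q x))
      ∂(if w ∈ A then Q₁ else Q₀)) = ∫⁻ x, ENNReal.ofReal (Real.exp (q x)) ∂Q₀ := by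
    intro w hw
    simp [(Finset.mem_sdiff.1 hw).2]
  rw [Finset.prod_congr rfl h1, Finset.prod_congr rfl h2, Finset.prod_const,
    Finset.prod_const] at h
  rw [← h]
  refine lintegral_congr fun y => ?_
  rw [← ENNReal.ofReal_prod_of_nonneg fun i _ => (Real.exp_pos _).le, ← Real.exp_sum,
    Finset.sum_union hdisj, blockSum]
  congr 3
  · exact Finset.sum_congr rfl fun w hw => by simp [(Finset.mem_sdiff.1 hw).1]
  · exact Finset.sum_congr rfl fun w hw => by simp [(Finset.mem_sdiff.1 hw).2]

lemma lintegral_exp_pathSum {p q : ℝ → ℝ} (hp : Measurable p) (hq : Measurable q)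
    (B B' : ℕ → Finset ℤ) (t : ℕ) :
    ∫⁻ y, ENNReal.ofReal (Real.exp (pathSum p q B B' t y)) ∂(patternLaw Q₀ Q₁ B) =
      (∫⁻ x, ENNReal.ofReal (Real.exp (p x)) ∂Q₁) ^
          (∑ s ∈ Finset.range (t + 1), (B s \ B' s).card) *
        (∫⁻ x, ENNReal.ofReal (Real.exp (q x)) ∂Q₀) ^
          (∑ s ∈ Finset.range (t + 1), (B' s \ B s).card) := by
  have h := lintegral_infinitePi_prod (fun s => blockLaw Q₀ Q₁ (B s)) (Finset.range (t + 1))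
    (fun s y => ENNReal.ofReal (Real.exp (blockSum p q (B s) (B' s) y)))
    (fun s => (measurable_blockSum hp hq _ _).exp.ennreal_ofReal)
  simp_rw [lintegral_exp_blockSum hp hq] at h
  rw [Finset.prod_mul_distrib, Finset.prod_pow_eq_pow_sum, Finset.prod_pow_eq_pow_sum] at h
  rw [← h]
  refine lintegral_congr fun y => ?_
  rw [← ENNReal.ofReal_prod_of_nonneg fun i _ => (Real.exp_pos _).le, ← Real.exp_sum, pathSum]

lemma lintegral_pathSum_le {p q : ℝ → ℝ} (hp : Measurable p) (hq : Measurable q)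
    (B B' : ℕ → Finset ℤ) (t : ℕ) :
    ∫⁻ y, ENNReal.ofReal (pathSum p q B B' t y) ∂(patternLaw Q₀ Q₁ B) ≤
      (∑ s ∈ Finset.range (t + 1), (B s \ B' s).card : ℕ) *
          (∫⁻ x, ENNReal.ofReal (p x) ∂Q₁) +
        (∑ s ∈ Finset.range (t + 1), (B' s \ B s).card : ℕ) *
          (∫⁻ x, ENNReal.ofReal (q x) ∂Q₀) := by
  have hofsum : ∀ {ι : Type} (F : Finset ι) (f : ι → ℝ),
      ENNReal.ofReal (∑ i ∈ F, f i) ≤ ∑ i ∈ F, ENNReal.ofReal (f i) := by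
    intro ι F f
    exact Finset.le_sum_of_subadditive ENNReal.ofReal ENNReal.ofReal_zero.le
      (fun _ _ => ENNReal.ofReal_add_le) F f
  have hpt : ∀ y : Path ℤ, ENNReal.ofReal (pathSum p q B B' t y) ≤
      ∑ s ∈ Finset.range (t + 1), (∑ w ∈ B s \ B' s, ENNReal.ofReal (p (y s w)) +
        ∑ w ∈ B' s \ B s, ENNReal.ofReal (q (y s w))) := by
    intro y
    refine (hofsum _ _).trans (Finset.sum_le_sum fun s _ => ?_)
    exact ENNReal.ofReal_add_le.trans (add_le_add (hofsum _ _) (hofsum _ _))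
  have heval : ∀ (s : ℕ) (w : ℤ) {f : ℝ → ℝ}, Measurable f →
      ∫⁻ y, ENNReal.ofReal (f (y s w)) ∂(patternLaw Q₀ Q₁ B) =
        ∫⁻ x, ENNReal.ofReal (f x) ∂(if w ∈ B s then Q₁ else Q₀) := by
    intro s w f hf
    have h1 := lintegral_infinitePi_eval (fun s => blockLaw Q₀ Q₁ (B s)) s
      (fun y => ENNReal.ofReal (f (y w))) (hf.comp (measurable_pi_apply w)).ennreal_ofReal
    exact h1.trans (lintegral_infinitePi_eval (fun w : ℤ => if w ∈ B s then Q₁ else Q₀) w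
      (fun x => ENNReal.ofReal (f x)) hf.ennreal_ofReal)
  have hmeas : ∀ (s : ℕ) (w : ℤ) {f : ℝ → ℝ}, Measurable f →
      Measurable fun y : Path ℤ => ENNReal.ofReal (f (y s w)) := fun s w f hf =>
    (hf.comp ((measurable_pi_apply w).comp (measurable_pi_apply s))).ennreal_ofReal
  refine (lintegral_mono hpt).trans (le_of_eq ?_)
  rw [lintegral_finsetSum _ fun s _ => Measurable.fun_add
    (Finset.measurable_fun_sum _ fun w _ => hmeas s w hp)
    (Finset.measurable_fun_sum _ fun w _ => hmeas s w hq)]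
  rw [Nat.cast_sum, Nat.cast_sum, Finset.sum_mul, Finset.sum_mul, ← Finset.sum_add_distrib]
  refine Finset.sum_congr rfl fun s _ => ?_
  rw [lintegral_add_left (Finset.measurable_fun_sum _ fun w _ => hmeas s w hp),
    lintegral_finsetSum _ fun w _ => hmeas s w hp, lintegral_finsetSum _ fun w _ => hmeas s w hq,
    ← nsmul_eq_mul, ← nsmul_eq_mul, ← Finset.sum_const, ← Finset.sum_const]
  congr 1
  · exact Finset.sum_congr rfl fun w hw => by
      rw [heval s w hp, if_pos (Finset.mem_sdiff.1 hw).1]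
  · exact Finset.sum_congr rfl fun w hw => by
      rw [heval s w hq, if_neg (Finset.mem_sdiff.1 hw).2]

lemma sum_card_ball_sdiff (v u : ℤ) (t : ℕ) :
    ∑ s ∈ Finset.range (t + 1), (ball v s \ ball u s).card = diffCount (u - v).natAbs t :=
  Finset.sum_congr rfl fun s _ => card_ball_sdiff v u s

lemma sum_card_ball_sdiff' (v u : ℤ) (t : ℕ) :
    ∑ s ∈ Finset.range (t + 1), (ball u s \ ball v s).card = diffCount (u - v).natAbs t := by
  rw [sum_card_ball_sdiff, ← Int.natAbs_neg, neg_sub]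

end Patterns

/-! ### The MSPRT: measurability, existence, admissibility and tail of the runtime -/

section

section Measurability

variable {V : Type*} (G : SimpleGraph V) (Q₀ Q₁ : Measure ℝ)

lemma measurable_obsFiltration_eval {s t : ℕ} (hst : s ≤ t) :
    Measurable[obsFiltration V t] (fun y : Path V => y s) :=
  (measurable_pi_apply (X := fun _ : Set.Iic t => V → ℝ) ⟨s, hst⟩).comp
    (comap_measurable (Preorder.restrictLe (π := fun _ : ℕ => V → ℝ) t))

lemma measurable_Z (v u : V) (t : ℕ) : Measurable[obsFiltration V t] (Z G Q₀ Q₁ v u t) :=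
  Finset.measurable_fun_sum _ fun _ hs => (measurable_llr _ _).comp
    (measurable_obsFiltration_eval (Nat.lt_succ_iff.1 (Finset.mem_range.1 hs)))

lemma measurable_msprtStat (W : Finset V) (R : ℕ) (v : V) (t : ℕ) :
    Measurable[obsFiltration V t] (msprtStat G Q₀ Q₁ W R v t) :=
  Measurable.biInf _ (W.finite_toSet.subset Set.sdiff_subset).countable fun u _ =>
    measurable_coe_real_ereal.comp (measurable_Z G Q₀ Q₁ v u t)

variable {G Q₀ Q₁} {W : Finset V} {R : ℕ} {α : ℝ}

lemma hitTime_le_iff {v : V} {y : Path V} {t : ℕ} :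
    hitTime G Q₀ Q₁ W R α v y ≤ t ↔
      ∃ s ≤ t, (Real.log (W.card / α) : EReal) ≤ msprtStat G Q₀ Q₁ W R v s y := by
  constructor
  · intro h
    -- A strict bound on an infimum yields a witness, so the inequality is first rewritten as `< t +
    -- 1`.
    have h' : hitTime G Q₀ Q₁ W R α v y < ((t + 1 : ℕ) : ℕ∞) :=
      h.trans_lt (by exact_mod_cast Nat.lt_succ_self t)
    simp only [hitTime, iInf_lt_iff] at h'
    obtain ⟨s, hs, hst⟩ := h'
    exact ⟨s, Nat.lt_succ_iff.1 (by exact_mod_cast hst), hs⟩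
  · rintro ⟨s, hst, hs⟩
    exact (iInf₂_le s hs).trans (by exact_mod_cast hst)

lemma msprtTime_le_iff {y : Path V} {t : ℕ} :
    msprtTime G Q₀ Q₁ W R α y ≤ t ↔ ∃ v ∈ W, ∃ s ≤ t,
      (Real.log (W.card / α) : EReal) ≤ msprtStat G Q₀ Q₁ W R v s y := by
  constructor
  · intro h
    have h' : msprtTime G Q₀ Q₁ W R α y < ((t + 1 : ℕ) : ℕ∞) :=
      h.trans_lt (by exact_mod_cast Nat.lt_succ_self t)
    simp only [msprtTime, iInf_lt_iff] at h'
    obtain ⟨v, hv, hvt⟩ := h'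
    refine ⟨v, hv, hitTime_le_iff.1 (Order.le_of_lt_add_one (by exact_mod_cast hvt))⟩
  · rintro ⟨v, hv, h⟩
    exact (iInf₂_le v hv).trans (hitTime_le_iff.2 h)

lemma isStoppingTime_msprtTime :
    IsStoppingTime (obsFiltration V) (msprtTime G Q₀ Q₁ W R α) := by
  intro t
  have : {y : Path V | msprtTime G Q₀ Q₁ W R α y ≤ (t : ℕ∞)} =
      ⋃ v ∈ W, ⋃ s ∈ Finset.range (t + 1),
        {y | (Real.log (W.card / α) : EReal) ≤ msprtStat G Q₀ Q₁ W R v s y} := by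
    ext y
    simp only [Set.mem_ofPred_eq, msprtTime_le_iff, Set.mem_iUnion, Finset.mem_range,
      Nat.lt_succ_iff, exists_prop]
  change MeasurableSet[obsFiltration V t] {y : Path V | msprtTime G Q₀ Q₁ W R α y ≤ (t : ℕ∞)}
  rw [this]
  refine Finset.measurableSet_biUnion _ fun v _ => Finset.measurableSet_biUnion _ fun s hs => ?_
  exact (obsFiltration V).mono (Nat.lt_succ_iff.1 (Finset.mem_range.1 hs)) _
    (measurableSet_le measurable_const (measurable_msprtStat G Q₀ Q₁ W R v s))

end Measurability

/-- Choosing the smallest maximizer makes the estimate measurable: its level sets are finite Boolean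
combinations of comparisons between statistics observed by time `t`. -/
lemma exists_isMSPRT {V : Type*} [LinearOrder V] (G : SimpleGraph V) (Q₀ Q₁ : Measure ℝ)
    {W : Finset V} (hW : W.Nonempty) (R : ℕ) (α : ℝ) :
    ∃ S : SeqEstimator W, IsMSPRT G Q₀ Q₁ W R α S := by
  classical
  let f : ℕ → Path V → V → EReal := fun t y v => msprtStat G Q₀ Q₁ W R v t y
  let M : ℕ → Path V → Finset V := fun t y => W.filter fun v => ∀ w ∈ W, f t y w ≤ f t y v
  have hM : ∀ t y, (M t y).Nonempty := fun t y => by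
    obtain ⟨v, hv, h⟩ := W.exists_max_image (f t y) hW
    exact ⟨v, Finset.mem_filter.2 ⟨hv, h⟩⟩
  have hD : ∀ t y v, (M t y).min' (hM t y) = v ↔ v ∈ M t y ∧ ∀ w ∈ W, w < v → w ∉ M t y := by
    intro t y v
    constructor
    · rintro rfl
      exact ⟨Finset.min'_mem _ _, fun w _ hw hw' => absurd (Finset.min'_le _ w hw') (not_le.2 hw)⟩
    · rintro ⟨hv, h⟩
      refine le_antisymm (Finset.min'_le _ _ hv) (not_lt.1 fun hlt => ?_)
      exact h _ (Finset.mem_filter.1 (Finset.min'_mem _ (hM t y))).1 hlt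
        (Finset.min'_mem _ (hM t y))
  have hmeas : ∀ t v, MeasurableSet[obsFiltration V t] {y | v ∈ M t y} := by
    intro t v
    by_cases hv : v ∈ W
    · have : {y | v ∈ M t y} = ⋂ w ∈ W, {y | f t y w ≤ f t y v} := by
        ext y; simp [M, hv]
      rw [this]
      exact Finset.measurableSet_biInter _ fun w _ => measurableSet_le
        (measurable_msprtStat G Q₀ Q₁ W R w t) (measurable_msprtStat G Q₀ Q₁ W R v t)
    · have : {y | v ∈ M t y} = ∅ := by ext y; simp [M, hv]
      rw [this]
      exact @MeasurableSet.empty _ (obsFiltration V t)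
  refine ⟨⟨msprtTime G Q₀ Q₁ W R α, fun t y => (M t y).min' (hM t y), isStoppingTime_msprtTime,
    fun t y => (Finset.mem_filter.1 (Finset.min'_mem _ (hM t y))).1, ?_⟩, rfl, ?_⟩
  · intro t v
    have : {y | (M t y).min' (hM t y) = v} =
        {y | v ∈ M t y} ∩ ⋂ w ∈ W.filter (· < v), {y | w ∈ M t y}ᶜ := by
      ext y
      rw [Set.mem_ofPred_eq, hD]
      simp only [Set.mem_inter_iff, Set.mem_ofPred_eq, Set.mem_iInter, Finset.mem_filter,
        Set.mem_compl_iff, and_imp]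
    rw [this]
    exact (hmeas t v).inter (Finset.measurableSet_biInter _ fun w _ => (hmeas t w).compl)
  · intro t y v hv
    exact (Finset.mem_filter.1 (Finset.min'_mem _ (hM t y))).2 v hv

variable {Q₀ Q₁ : Measure ℝ} [IsProbabilityMeasure Q₀] [IsProbabilityMeasure Q₁]

/-- On `{T = t, D = u}` the likelihood ratio of `u` against any far `v` is at least `|W| / α`. Hence
this event is at most `α / |W|` times as likely under `v` as under `u`, and summing over `t` leaves
a total probability at most one under `u`. -/
lemma isMSPRT_admissible (h01 : Q₀ ≪ Q₁) (h10 : Q₁ ≪ Q₀) {W : Finset ℤ} {R : ℕ} {α : ℝ}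
    (hα : 0 < α) {S : SeqEstimator W} (hS : IsMSPRT line Q₀ Q₁ W R α S) :
    S ∈ admissible line Q₀ Q₁ W R α := by
  intro u hu v hv huv
  rw [pathLaw_line]
  have hn : (0 : ℝ) < W.card := by exact_mod_cast Finset.card_pos.2 ⟨u, hu⟩
  have hnα : 0 < (W.card : ℝ) / α := div_pos hn hα
  set A : ℕ → Set (Path ℤ) := fun t => {y | S.T y = (t : ℕ∞)} ∩ {y | S.D t y = u} with hA
  have hAm : ∀ t, MeasurableSet[obsFiltration ℤ t] (A t) := fun t =>
    (S.isStoppingTime.measurableSet_eq t).inter (S.adapted t u)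
  have hAm' : ∀ t, MeasurableSet (A t) := fun t => (obsFiltration ℤ).le t _ (hAm t)
  have hdisj : Pairwise (Function.onFun Disjoint A) := by
    intro i j hij
    refine Set.disjoint_left.2 fun y hi hj => hij ?_
    have : ((i : ℕ) : ℕ∞) = j := hi.1.symm.trans hj.1
    exact_mod_cast this
  have hout : S.outputs u = ⋃ t, A t := by
    ext y
    simp only [SeqEstimator.outputs, Set.mem_ofPred_eq, Set.mem_iUnion, A, Set.mem_inter_iff]
  have hZ : ∀ t, ∀ y ∈ A t, Real.log (W.card / α) ≤ logLR Q₀ Q₁ (ball u) (ball v) t y := by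
    rintro t y ⟨hT, hDu⟩
    rw [Set.mem_ofPred_eq, hS.1] at hT
    -- Stopping exactly at `t` means that some `w` crosses the threshold at time `t` itself, and
    -- then the maximizer chosen by `D` crosses it as well.
    obtain ⟨w, hw, s, hst, hs⟩ := msprtTime_le_iff.1 hT.le
    have hts : t ≤ s := by
      have := msprtTime_le_iff.2 ⟨w, hw, s, le_rfl, hs⟩
      rw [hT] at this
      exact_mod_cast this
    obtain rfl := le_antisymm hst hts
    have h1 := hs.trans (hS.2 s y w hw)
    rw [show S.D s y = u from hDu] at h1
    have h2 : msprtStat line Q₀ Q₁ W R u s y ≤ (Z line Q₀ Q₁ u v s y : EReal) :=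
      iInf₂_le v ⟨hv, fun h => absurd huv (not_lt.2 h)⟩
    rw [← Z_line]
    exact_mod_cast h1.trans h2
  have hstep : ∀ t, patternLaw Q₀ Q₁ (ball v) (A t) ≤
      ENNReal.ofReal (α / W.card) * patternLaw Q₀ Q₁ (ball u) (A t) := by
    intro t
    rw [patternLaw_change_of_measure h01 h10 (ball u) (ball v) (hAm t)]
    have h1 : ENNReal.ofReal (W.card / α) * patternLaw Q₀ Q₁ (ball v) (A t) ≤
        ∫⁻ y in A t, ENNReal.ofReal (Real.exp (logLR Q₀ Q₁ (ball u) (ball v) t y))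
          ∂(patternLaw Q₀ Q₁ (ball v)) := by
      rw [← setLIntegral_const]
      refine setLIntegral_mono' (hAm' t) fun y hy => ENNReal.ofReal_le_ofReal ?_
      rw [← Real.log_le_iff_le_exp hnα]
      exact hZ t y hy
    calc patternLaw Q₀ Q₁ (ball v) (A t)
        = ENNReal.ofReal (α / W.card) *
          (ENNReal.ofReal (W.card / α) * patternLaw Q₀ Q₁ (ball v) (A t)) := by
          rw [← mul_assoc, ← ENNReal.ofReal_mul (by positivity)]
          rw [show α / (W.card : ℝ) * (W.card / α) = 1 by field_simp, ENNReal.ofReal_one, one_mul]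
      _ ≤ _ := by gcongr
  rw [hout, measure_iUnion hdisj hAm']
  calc ∑' t, patternLaw Q₀ Q₁ (ball v) (A t)
      ≤ ∑' t, ENNReal.ofReal (α / W.card) * patternLaw Q₀ Q₁ (ball u) (A t) :=
        ENNReal.tsum_le_tsum hstep
    _ = ENNReal.ofReal (α / W.card) * patternLaw Q₀ Q₁ (ball u) (⋃ t, A t) := by
        rw [ENNReal.tsum_mul_left, measure_iUnion hdisj hAm']
    _ ≤ ENNReal.ofReal (α / W.card) * 1 := by gcongr; exact prob_le_one
    _ = _ := mul_one _

variable (Q₀ Q₁) in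
/-- The moment `𝔼 [exp (-l log (dQ₁/dQ₀) (X)) exp (-l log (dQ₀/dQ₁) (Y))]` for independent
`X ∼ Q₁`, `Y ∼ Q₀`. -/
noncomputable def llrMoment (l : ℝ) : ℝ≥0∞ :=
  (∫⁻ x, ENNReal.ofReal (Real.exp (-l * llr Q₁ Q₀ x)) ∂Q₁) *
    ∫⁻ x, ENNReal.ofReal (Real.exp (-l * llr Q₀ Q₁ x)) ∂Q₀

/-- Chernoff's bound. Both one-sided differences of the balls have the same total count, so the
moments of `X` and `Y` combine into a single power of `llrMoment`. -/
lemma logLR_lower_tail (h01 : Q₀ ≪ Q₁) (h10 : Q₁ ≪ Q₀) (v u : ℤ) (t : ℕ) {l : ℝ} (hl : 0 ≤ l)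
    (x : ℝ) :
    patternLaw Q₀ Q₁ (ball v) {y | logLR Q₀ Q₁ (ball v) (ball u) t y < x} ≤
      ENNReal.ofReal (Real.exp (l * x)) * llrMoment Q₀ Q₁ l ^ diffCount (u - v).natAbs t := by
  have hp : Measurable fun z => -l * llr Q₁ Q₀ z := (measurable_llr _ _).const_mul _
  have hq : Measurable fun z => -l * llr Q₀ Q₁ z := (measurable_llr _ _).const_mul _
  have hmom := lintegral_exp_pathSum (Q₀ := Q₀) (Q₁ := Q₁) hp hq (ball v) (ball u) t
  rw [sum_card_ball_sdiff, sum_card_ball_sdiff', ← mul_pow] at hmom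
  rw [llrMoment, ← hmom, ← lintegral_const_mul _
    (measurable_pathSum hp hq _ _ _).exp.ennreal_ofReal]
  have hms : MeasurableSet {y | logLR Q₀ Q₁ (ball v) (ball u) t y < x} :=
    measurableSet_lt (measurable_logLR _ _ _ _ _) measurable_const
  rw [← lintegral_indicator_one hms]
  refine lintegral_mono_ae ?_
  filter_upwards [logLR_ae_eq h01 h10 (ball v) (ball u) (ball v) t] with y hy
  by_cases hyx : logLR Q₀ Q₁ (ball v) (ball u) t y < x
  · rw [Set.indicator_of_mem (by exact hyx), ← ENNReal.ofReal_mul (Real.exp_pos _).le,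
      ← Real.exp_add, Pi.one_apply, ENNReal.one_le_ofReal, Real.one_le_exp_iff]
    have hlin : pathSum (fun z => -l * llr Q₁ Q₀ z) (fun z => -l * llr Q₀ Q₁ z)
        (ball v) (ball u) t y = -l * pathSum (llr Q₁ Q₀) (llr Q₀ Q₁) (ball v) (ball u) t y := by
      simp only [pathSum, blockSum, Finset.mul_sum, mul_add]
    rw [hlin, ← hy]
    nlinarith
  · rw [Set.indicator_of_notMem (by exact hyx)]
    exact zero_le

/-- The tail-sum formula started at `m`, in a form that also covers `T = ⊤`. -/
lemma enat_le_add_tsum (T : ℕ∞) (m : ℕ) :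
    (T : ℝ≥0∞) ≤ m + ∑' k : ℕ, if ((m + k : ℕ) : ℕ∞) < T then (1 : ℝ≥0∞) else 0 := by
  induction T using ENat.recTopCoe with
  | top =>
    have : ∀ k : ℕ, ((m + k : ℕ) : ℕ∞) < ⊤ := fun k => ENat.natCast_lt_top _
    simp only [this, if_true]
    rw [ENNReal.tsum_const_eq_top_of_ne_zero one_ne_zero]
    simp
  | coe j =>
    have h1 : ((j : ℕ∞) : ℝ≥0∞) = (j : ℝ≥0∞) := by simp
    rw [h1]
    calc (j : ℝ≥0∞) ≤ ((m + (j - m) : ℕ) : ℝ≥0∞) := by exact_mod_cast le_add_tsub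
      _ = m + ∑ k ∈ Finset.range (j - m), if ((m + k : ℕ) : ℕ∞) < j then (1 : ℝ≥0∞) else 0 := by
          rw [Nat.cast_add]
          congr 1
          rw [Finset.sum_congr rfl (g := fun _ => (1 : ℝ≥0∞))]
          · simp
          · intro k hk
            have := Finset.mem_range.1 hk
            rw [if_pos]
            exact_mod_cast (by omega : m + k < j)
      _ ≤ _ := by gcongr; exact ENNReal.sum_le_tsum _

/-- If the procedure has not stopped by `t`, the true source itself has not crossed the threshold,
so some `u` at distance at least `R + 1` has too small a likelihood ratio. A union bound and
Chernoff's bound control this, and past `t₀` the tail decays geometrically with ratio `llrMoment`.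
-/
lemma worstRuntime_msprt_le (h01 : Q₀ ≪ Q₁) (h10 : Q₁ ≪ Q₀) (W : Finset ℤ) (R : ℕ) (α : ℝ)
    {l : ℝ} (hl : 0 ≤ l) (hρ : llrMoment Q₀ Q₁ l ≤ 1) (t₀ : ℕ) :
    worstRuntime line Q₀ Q₁ W (msprtTime line Q₀ Q₁ W R α) ≤
      t₀ + W.card * ENNReal.ofReal (Real.exp (l * Real.log (W.card / α))) *
        llrMoment Q₀ Q₁ l ^ diffCount (R + 1) t₀ * (1 - llrMoment Q₀ Q₁ l)⁻¹ := by
  refine iSup₂_le fun v hv => ?_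
  rw [pathLaw_line]
  set P := patternLaw Q₀ Q₁ (ball v)
  set ρ := llrMoment Q₀ Q₁ l
  set x := Real.log (W.card / α)
  have hms : ∀ k : ℕ, MeasurableSet
      {y | ((t₀ + k : ℕ) : ℕ∞) < msprtTime line Q₀ Q₁ W R α y} := by
    intro k
    have h := (obsFiltration ℤ).le _ _
      ((isStoppingTime_msprtTime (G := line) (Q₀ := Q₀) (Q₁ := Q₁) (W := W) (R := R) (α := α)
        (t₀ + k)).compl)
    convert h using 1
    ext y
    simp only [Set.mem_ofPred_eq, Set.mem_compl_iff]
    exact not_le.symm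
  have htail : ∀ t : ℕ, P {y | (t : ℕ∞) < msprtTime line Q₀ Q₁ W R α y} ≤
      W.card * (ENNReal.ofReal (Real.exp (l * x)) * ρ ^ diffCount (R + 1) t) := by
    intro t
    have hsub : {y | (t : ℕ∞) < msprtTime line Q₀ Q₁ W R α y} ⊆
        ⋃ u ∈ W.filter (fun u => R < (u - v).natAbs),
          {y | logLR Q₀ Q₁ (ball v) (ball u) t y < x} := by
      intro y hy
      have h1 : ¬ (x : EReal) ≤ msprtStat line Q₀ Q₁ W R v t y := fun h =>
        absurd (msprtTime_le_iff.2 ⟨v, hv, t, le_rfl, h⟩) (not_le.2 hy)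
      rw [not_le, msprtStat, iInf_lt_iff] at h1
      obtain ⟨u, h2⟩ := h1
      rw [iInf_lt_iff] at h2
      obtain ⟨⟨huW, huv⟩, h3⟩ := h2
      rw [mem_nbhd_line, not_le] at huv
      rw [Z_line] at h3
      simp only [Set.mem_iUnion, Finset.mem_filter]
      exact ⟨u, ⟨huW, huv⟩, by exact_mod_cast h3⟩
    refine (measure_mono hsub).trans ((measure_biUnion_finset_le _ _).trans ?_)
    calc ∑ u ∈ W.filter (fun u => R < (u - v).natAbs),
          P {y | logLR Q₀ Q₁ (ball v) (ball u) t y < x}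
        ≤ ∑ u ∈ W.filter (fun u => R < (u - v).natAbs),
          ENNReal.ofReal (Real.exp (l * x)) * ρ ^ diffCount (R + 1) t := by
          refine Finset.sum_le_sum fun u hu => ?_
          refine (logLR_lower_tail h01 h10 v u t hl x).trans ?_
          exact mul_le_mul' le_rfl (pow_le_pow_right_of_le_one' hρ
            (diffCount_mono_left (Finset.mem_filter.1 hu).2 t))
      _ ≤ _ := by
          rw [Finset.sum_const, nsmul_eq_mul]
          gcongr
          exact Finset.filter_subset _ _
  calc ∫⁻ y, ((msprtTime line Q₀ Q₁ W R α y : ℕ∞) : ℝ≥0∞) ∂P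
      ≤ ∫⁻ y, (t₀ + ∑' k : ℕ, {y | ((t₀ + k : ℕ) : ℕ∞) <
          msprtTime line Q₀ Q₁ W R α y}.indicator (1 : Path ℤ → ℝ≥0∞) y) ∂P := by
        refine lintegral_mono fun y => (enat_le_add_tsum _ t₀).trans (le_of_eq ?_)
        congr 1
        refine tsum_congr fun k => ?_
        simp only [Set.indicator_apply, Set.mem_ofPred_eq, Pi.one_apply]
    _ = t₀ + ∑' k : ℕ, P {y | ((t₀ + k : ℕ) : ℕ∞) < msprtTime line Q₀ Q₁ W R α y} := by
        rw [lintegral_add_left measurable_const, lintegral_const, measure_univ, mul_one,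
          lintegral_tsum fun k => (measurable_one.indicator (hms k)).aemeasurable]
        congr 1
        exact tsum_congr fun k => lintegral_indicator_one (hms k)
    _ ≤ t₀ + ∑' k : ℕ, W.card * ENNReal.ofReal (Real.exp (l * x)) *
          ρ ^ diffCount (R + 1) t₀ * ρ ^ k := by
        gcongr with k
        refine (htail (t₀ + k)).trans ?_
        rw [← mul_assoc, mul_assoc _ (ρ ^ _) (ρ ^ k), ← pow_add]
        exact mul_le_mul' le_rfl
          (pow_le_pow_right_of_le_one' hρ (diffCount_add_le (Nat.le_add_left 1 R) t₀ k))
    _ = _ := by rw [ENNReal.tsum_mul_left, ENNReal.tsum_geometric]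

end

/-! ### First-order behavior of exponential moments at zero -/

section ExponentialMoments

variable {Ω : Type*} [MeasurableSpace Ω] {μ : Measure Ω} [IsProbabilityMeasure μ]

lemma exp_mul_le_of_le_one (x : ℝ) {θ : ℝ} (h0 : 0 ≤ θ) (h1 : θ ≤ 1) :
    Real.exp (θ * x) ≤ 1 + θ * (Real.exp x - 1) := by
  have h := convexOn_exp.2 (Set.mem_univ x) (Set.mem_univ (0 : ℝ)) h0 (sub_nonneg.2 h1)
    (by ring)
  simp only [smul_eq_mul, mul_zero, add_zero, Real.exp_zero, mul_one] at h
  linarith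

/-- The right derivative at zero of the moment generating function is the mean. Differentiation
under the integral is dominated by `|g| + exp g`, by convexity in `θ` on `[0, 1]`; only the
one-sided moment at `θ = 1` is required. -/
lemma eventually_integral_exp_le {g : Ω → ℝ} (hg : Integrable g μ)
    (hexp : Integrable (fun x => Real.exp (g x)) μ) {δ : ℝ} (hδ : 0 < δ) :
    ∀ᶠ θ in 𝓝[>] (0 : ℝ), ∫⁻ x, ENNReal.ofReal (Real.exp (θ * g x)) ∂μ ≤
      ENNReal.ofReal (Real.exp (θ * (∫ x, g x ∂μ + δ))) := by
  have hIoc : ∀ᶠ θ in 𝓝[>] (0 : ℝ), θ ∈ Set.Ioc (0 : ℝ) 1 :=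
    Ioc_mem_nhdsGT one_pos
  have hmeas : ∀ θ : ℝ, AEStronglyMeasurable (fun x => Real.exp (θ * g x)) μ := fun θ =>
    Real.continuous_exp.comp_aestronglyMeasurable (hg.1.const_mul θ)
  have hint : ∀ θ ∈ Set.Ioc (0 : ℝ) 1, Integrable (fun x => Real.exp (θ * g x)) μ := by
    intro θ hθ
    refine Integrable.mono' ((integrable_const (1 : ℝ)).add hexp) (hmeas θ) (ae_of_all _ fun x => ?_)
    rw [Real.norm_of_nonneg (Real.exp_pos _).le]
    have := exp_mul_le_of_le_one (g x) hθ.1.le hθ.2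
    have h2 := Real.exp_pos (g x)
    simp only [Pi.add_apply]
    nlinarith [hθ.1, hθ.2]
  have hlim : Tendsto (fun θ : ℝ => ∫ x, (Real.exp (θ * g x) - 1) / θ ∂μ) (𝓝[>] 0)
      (𝓝 (∫ x, g x ∂μ)) := by
    refine tendsto_integral_filter_of_dominated_convergence (fun x => |g x| + Real.exp (g x))
      (Eventually.of_forall fun θ => ?_) ?_ (hg.abs.add hexp) (ae_of_all _ fun x => ?_)
    · simp only [div_eq_mul_inv]
      exact ((hmeas θ).sub aestronglyMeasurable_const).mul_const _
    · filter_upwards [hIoc] with θ hθ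
      refine ae_of_all _ fun x => ?_
      have h1 := exp_mul_le_of_le_one (g x) hθ.1.le hθ.2
      have h2 := Real.add_one_le_exp (θ * g x)
      have h3 := Real.exp_pos (g x)
      rw [Real.norm_eq_abs, abs_le]
      constructor
      · rw [le_div_iff₀ hθ.1]
        nlinarith [neg_abs_le (g x), hθ.1, mul_pos hθ.1 h3]
      · rw [div_le_iff₀ hθ.1]
        nlinarith [abs_nonneg (g x), hθ.1, mul_nonneg hθ.1.le (abs_nonneg (g x))]
    · have hd : HasDerivAt (fun θ : ℝ => Real.exp (θ * g x)) (g x) 0 := by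
        have := ((hasDerivAt_id (0 : ℝ)).mul_const (g x)).exp
        simpa using this
      have := (hasDerivAt_iff_tendsto_slope_zero.1 hd).mono_left
        (nhdsWithin_mono _ fun θ (hθ : 0 < θ) => hθ.ne')
      refine this.congr fun θ => ?_
      simp [div_eq_inv_mul]
  have hlt := hlim.eventually_lt_const (lt_add_of_pos_right (∫ x, g x ∂μ) hδ)
  filter_upwards [hIoc, hlt] with θ hθ h
  rw [← ofReal_integral_eq_lintegral_ofReal (hint θ hθ) (ae_of_all _ fun x => (Real.exp_pos _).le)]
  refine ENNReal.ofReal_le_ofReal ?_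
  rw [integral_div, integral_sub (hint θ hθ) (integrable_const _), integral_const,
    div_lt_iff₀ hθ.1] at h
  simp only [probReal_univ, smul_eq_mul, mul_one] at h
  have := Real.add_one_le_exp (θ * (∫ x, g x ∂μ + δ))
  linarith

end ExponentialMoments

/-! ### The Chernoff exponent and the constant `C` -/

section Chernoff

variable {Q₀ Q₁ : Measure ℝ}

lemma measurable_lrPow (l : ℝ) : Measurable (lrPow Q₀ Q₁ l) :=
  (((Measure.measurable_rnDeriv _ _).comp measurable_fst).ennreal_toReal.pow_const l).mul
    (((Measure.measurable_rnDeriv _ _).comp measurable_snd).ennreal_toReal.pow_const l)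

lemma lrPow_nonneg (l : ℝ) (p : ℝ × ℝ) : 0 ≤ lrPow Q₀ Q₁ l p := by
  unfold lrPow; positivity

variable [IsProbabilityMeasure Q₀] [IsProbabilityMeasure Q₁]

/-- The exponential is a version of `dν/dμ`. This is why lower tails of log-likelihood ratios need
no moment assumption. -/
lemma integrable_exp_neg_llr {μ ν : Measure ℝ} [IsProbabilityMeasure μ] [IsProbabilityMeasure ν]
    (h : μ ≪ ν) : Integrable (fun x => Real.exp (-llr μ ν x)) μ :=
  Measure.integrable_toReal_rnDeriv.congr (exp_neg_llr h).symm

lemma eventually_llrMoment_le (h01 : Q₀ ≪ Q₁) (h10 : Q₁ ≪ Q₀)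
    (hint1 : Integrable (llr Q₁ Q₀) Q₁) (hint0 : Integrable (llr Q₀ Q₁) Q₀)
    {δ : ℝ} (hδ : 0 < δ) :
    ∀ᶠ l in 𝓝[>] (0 : ℝ), llrMoment Q₀ Q₁ l ≤
      ENNReal.ofReal (Real.exp (-l * (symmKL Q₀ Q₁ - δ))) := by
  have h1 := eventually_integral_exp_le hint1.neg (integrable_exp_neg_llr h10) (half_pos hδ)
  have h0 := eventually_integral_exp_le hint0.neg (integrable_exp_neg_llr h01) (half_pos hδ)
  filter_upwards [h1, h0] with l h1 h0
  simp only [Pi.neg_apply, mul_neg, integral_neg] at h1 h0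
  rw [llrMoment]
  simp only [neg_mul]
  refine (mul_le_mul' h1 h0).trans (le_of_eq ?_)
  rw [← ENNReal.ofReal_mul (Real.exp_pos _).le, ← Real.exp_add, symmKL]
  congr 2
  ring

lemma rnDeriv_rpow_ae_eq {μ ν : Measure ℝ} [IsProbabilityMeasure μ] [IsProbabilityMeasure ν]
    (h : μ ≪ ν) (l : ℝ) :
    ∀ᵐ x ∂μ, (ν.rnDeriv μ x).toReal ^ l = Real.exp (-l * llr μ ν x) := by
  filter_upwards [exp_neg_llr h] with x hx
  rw [← hx, ← Real.exp_mul]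
  congr 1
  ring

lemma llrMoment_eq_lintegral (h01 : Q₀ ≪ Q₁) (h10 : Q₁ ≪ Q₀) (l : ℝ) :
    llrMoment Q₀ Q₁ l = ∫⁻ p, ENNReal.ofReal (lrPow Q₀ Q₁ l p) ∂(Q₁.prod Q₀) := by
  have h1 : ∀ p : ℝ × ℝ, ENNReal.ofReal (lrPow Q₀ Q₁ l p) =
      ENNReal.ofReal ((Q₀.rnDeriv Q₁ p.1).toReal ^ l) *
        ENNReal.ofReal ((Q₁.rnDeriv Q₀ p.2).toReal ^ l) := fun p =>
    ENNReal.ofReal_mul (by positivity)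
  simp_rw [h1]
  rw [lintegral_prod_mul
    ((Measure.measurable_rnDeriv _ _).ennreal_toReal.pow_const l).ennreal_ofReal.aemeasurable
    ((Measure.measurable_rnDeriv _ _).ennreal_toReal.pow_const l).ennreal_ofReal.aemeasurable,
    llrMoment]
  congr 1
  · refine lintegral_congr_ae ?_
    filter_upwards [rnDeriv_rpow_ae_eq h10 l] with x hx
    rw [hx]
  · refine lintegral_congr_ae ?_
    filter_upwards [rnDeriv_rpow_ae_eq h01 l] with x hx
    rw [hx]

lemma llrMoment_eq_ofReal (h01 : Q₀ ≪ Q₁) (h10 : Q₁ ≪ Q₀) {l : ℝ}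
    (h : Integrable (lrPow Q₀ Q₁ l) (Q₁.prod Q₀)) :
    llrMoment Q₀ Q₁ l = ENNReal.ofReal (∫ p, lrPow Q₀ Q₁ l p ∂(Q₁.prod Q₀)) := by
  rw [llrMoment_eq_lintegral h01 h10,
    ofReal_integral_eq_lintegral_ofReal h (ae_of_all _ (lrPow_nonneg l))]

lemma integrable_lrPow (h01 : Q₀ ≪ Q₁) (h10 : Q₁ ≪ Q₀) {l : ℝ} (h : llrMoment Q₀ Q₁ l ≠ ⊤) :
    Integrable (lrPow Q₀ Q₁ l) (Q₁.prod Q₀) := by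
  refine ⟨(measurable_lrPow l).aestronglyMeasurable, ?_⟩
  rw [hasFiniteIntegral_iff_ofReal (ae_of_all _ (lrPow_nonneg l)),
    ← llrMoment_eq_lintegral h01 h10]
  exact h.lt_top

/-- Jensen's inequality, obtained by integrating the tangent line of `exp` at the mean exponent `c`.
-/
lemma exp_le_integral_lrPow (h01 : Q₀ ≪ Q₁) (h10 : Q₁ ≪ Q₀)
    (hint1 : Integrable (llr Q₁ Q₀) Q₁) (hint0 : Integrable (llr Q₀ Q₁) Q₀) {l : ℝ}
    (h : Integrable (lrPow Q₀ Q₁ l) (Q₁.prod Q₀)) :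
    Real.exp (-(l * symmKL Q₀ Q₁)) ≤ ∫ p, lrPow Q₀ Q₁ l p ∂(Q₁.prod Q₀) := by
  set c := -(l * symmKL Q₀ Q₁) with hc
  have hi1 : Integrable (fun p : ℝ × ℝ => llr Q₁ Q₀ p.1) (Q₁.prod Q₀) := hint1.comp_fst Q₀
  have hi2 : Integrable (fun p : ℝ × ℝ => llr Q₀ Q₁ p.2) (Q₁.prod Q₀) := hint0.comp_snd Q₁
  have hi12 : Integrable (fun p : ℝ × ℝ => llr Q₁ Q₀ p.1 + llr Q₀ Q₁ p.2) (Q₁.prod Q₀) :=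
    hi1.add hi2
  have hsum : ∫ p : ℝ × ℝ, (llr Q₁ Q₀ p.1 + llr Q₀ Q₁ p.2) ∂(Q₁.prod Q₀) = symmKL Q₀ Q₁ := by
    rw [integral_add hi1 hi2, integral_fun_fst (μ := Q₁) (ν := Q₀) (llr Q₁ Q₀),
      integral_fun_snd (μ := Q₁) (ν := Q₀) (llr Q₀ Q₁)]
    simp [symmKL]
  have hi : Integrable (fun p : ℝ × ℝ => Real.exp c * (1 - c) +
      (Real.exp c * -l) * (llr Q₁ Q₀ p.1 + llr Q₀ Q₁ p.2)) (Q₁.prod Q₀) :=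
    (integrable_const _).add (hi12.const_mul _)
  have hval : ∫ p : ℝ × ℝ, (Real.exp c * (1 - c) +
      (Real.exp c * -l) * (llr Q₁ Q₀ p.1 + llr Q₀ Q₁ p.2)) ∂(Q₁.prod Q₀) = Real.exp c := by
    rw [integral_add (integrable_const _) (hi12.const_mul _),
      integral_const_mul (Real.exp c * -l), hsum]
    simp only [integral_const, probReal_univ, smul_eq_mul, one_mul]
    rw [hc]; ring
  rw [← hval]
  refine integral_mono_ae hi h ?_
  filter_upwards [Measure.quasiMeasurePreserving_fst.ae (rnDeriv_rpow_ae_eq h10 l),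
    Measure.quasiMeasurePreserving_snd.ae (rnDeriv_rpow_ae_eq h01 l)] with p hp1 hp2
  rw [lrPow, hp1, hp2, ← Real.exp_add]
  set z := -l * llr Q₁ Q₀ p.1 + -l * llr Q₀ Q₁ p.2 with hz
  have h1 := Real.add_one_le_exp (z - c)
  have h2 : Real.exp z = Real.exp c * Real.exp (z - c) := by rw [← Real.exp_add]; ring_nf
  rw [h2]
  have h3 := Real.exp_pos c
  have : Real.exp c * (1 - c) + Real.exp c * -l * (llr Q₁ Q₀ p.1 + llr Q₀ Q₁ p.2) =
      Real.exp c * (z - c + 1) := by rw [hz]; ring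
  rw [this]
  exact mul_le_mul_of_nonneg_left h1 h3.le

/-- For `l = 1` the moment is exactly one; Bernoulli's inequality, the tangent line of the power at
one, extends the bound to larger `l`. -/
lemma one_le_integral_lrPow (h01 : Q₀ ≪ Q₁) (h10 : Q₁ ≪ Q₀) {l : ℝ} (hl : 1 ≤ l)
    (h : Integrable (lrPow Q₀ Q₁ l) (Q₁.prod Q₀)) :
    1 ≤ ∫ p, lrPow Q₀ Q₁ l p ∂(Q₁.prod Q₀) := by
  set f : ℝ × ℝ → ℝ := fun p => (Q₀.rnDeriv Q₁ p.1).toReal * (Q₁.rnDeriv Q₀ p.2).toReal with hf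
  have hfi : Integrable f (Q₁.prod Q₀) :=
    Measure.integrable_toReal_rnDeriv.mul_prod Measure.integrable_toReal_rnDeriv
  have hf1 : ∫ p, f p ∂(Q₁.prod Q₀) = 1 := by
    rw [hf, integral_prod_mul (fun x => (Q₀.rnDeriv Q₁ x).toReal)
      (fun x => (Q₁.rnDeriv Q₀ x).toReal), Measure.integral_toReal_rnDeriv h01,
      Measure.integral_toReal_rnDeriv h10]
    simp
  have hfi1 : Integrable (fun p => f p - 1) (Q₁.prod Q₀) := hfi.sub (integrable_const _)
  have hi : Integrable (fun p => 1 + l * (f p - 1)) (Q₁.prod Q₀) :=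
    (integrable_const _).add (hfi1.const_mul _)
  have hval : ∫ p, (1 + l * (f p - 1)) ∂(Q₁.prod Q₀) = 1 := by
    rw [integral_add (integrable_const _) (hfi1.const_mul _),
      integral_const_mul, integral_sub hfi (integrable_const _), hf1]
    simp
  rw [← hval]
  refine integral_mono hi h fun p => ?_
  have hfp : 0 ≤ f p := by simp only [hf]; positivity
  have := one_add_mul_self_le_rpow_one_add (s := f p - 1) (by linarith) hl
  rw [add_sub_cancel] at this
  refine this.trans (le_of_eq ?_)
  rw [hf, lrPow, Real.mul_rpow ENNReal.toReal_nonneg ENNReal.toReal_nonneg]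

lemma symmKL_pos (hne : Q₀ ≠ Q₁) (h01 : Q₀ ≪ Q₁) (h10 : Q₁ ≪ Q₀)
    (hint1 : Integrable (llr Q₁ Q₀) Q₁) :
    0 < symmKL Q₀ Q₁ := by
  have h1 := InformationTheory.toReal_klDiv_of_measure_eq h10 (by simp)
  have h0 := InformationTheory.toReal_klDiv_of_measure_eq h01 (by simp)
  rw [symmKL, ← h1, ← h0]
  refine add_pos_of_pos_of_nonneg (ENNReal.toReal_pos ?_
    (InformationTheory.klDiv_ne_top h10 hint1)) ENNReal.toReal_nonneg
  rw [Ne, InformationTheory.klDiv_eq_zero_iff]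
  exact hne.symm

/-- A real `sSup` carries information only for a bounded set. For `l ≥ 1` the moment is at least
one, so the value is at most zero; for `l ≤ 1` Jensen bounds it by `l * (symmKL - x)`. -/
lemma bddAbove_chernoffExp (h01 : Q₀ ≪ Q₁) (h10 : Q₁ ≪ Q₀)
    (hint1 : Integrable (llr Q₁ Q₀) Q₁) (hint0 : Integrable (llr Q₀ Q₁) Q₀) {x : ℝ}
    (hx : 0 ≤ x) (hxD : x ≤ symmKL Q₀ Q₁) :
    BddAbove {z : ℝ | ∃ l : ℝ, 0 ≤ l ∧ Integrable (lrPow Q₀ Q₁ l) (Q₁.prod Q₀) ∧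
      z = -(l * x) - Real.log (∫ p, lrPow Q₀ Q₁ l p ∂(Q₁.prod Q₀))} := by
  refine ⟨symmKL Q₀ Q₁ - x, ?_⟩
  rintro z ⟨l, hl, hi, rfl⟩
  rcases le_total 1 l with h | h
  · have h1 := Real.log_nonneg (one_le_integral_lrPow h01 h10 h hi)
    nlinarith
  · have h1 := exp_le_integral_lrPow h01 h10 hint1 hint0 hi
    rw [← Real.le_log_iff_exp_le ((Real.exp_pos _).trans_le h1)] at h1
    nlinarith

lemma chernoffExp_pos (h01 : Q₀ ≪ Q₁) (h10 : Q₁ ≪ Q₀)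
    (hint1 : Integrable (llr Q₁ Q₀) Q₁) (hint0 : Integrable (llr Q₀ Q₁) Q₀) {x : ℝ}
    (hx : 0 ≤ x) (hxD : x < symmKL Q₀ Q₁) : 0 < chernoffExp Q₀ Q₁ x := by
  -- With half of the gap given up, a small `l` still contributes at least `l * (symmKL - x) / 2` to
  -- the supremum.
  have hδ : 0 < (symmKL Q₀ Q₁ - x) / 2 := by linarith
  obtain ⟨l, hlm, hl⟩ := ((eventually_llrMoment_le h01 h10 hint1 hint0 hδ).and
    self_mem_nhdsWithin).exists
  replace hl : 0 < l := hl
  have hi := integrable_lrPow h01 h10 (hlm.trans_lt ENNReal.ofReal_lt_top).ne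
  rw [llrMoment_eq_ofReal h01 h10 hi, ENNReal.ofReal_le_ofReal_iff (Real.exp_pos _).le] at hlm
  have hpos := (Real.exp_pos _).trans_le (exp_le_integral_lrPow h01 h10 hint1 hint0 hi)
  rw [← Real.log_le_iff_le_exp hpos] at hlm
  refine lt_of_lt_of_le ?_ (le_csSup (bddAbove_chernoffExp h01 h10 hint1 hint0 hx hxD.le)
    ⟨l, hl.le, hi, rfl⟩)
  nlinarith

lemma exists_llrMoment_le (h01 : Q₀ ≪ Q₁) (h10 : Q₁ ≪ Q₀)
    (hint1 : Integrable (llr Q₁ Q₀) Q₁) (hint0 : Integrable (llr Q₀ Q₁) Q₀) {x c : ℝ}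
    (hc : 0 ≤ c) (hcx : c < chernoffExp Q₀ Q₁ x) :
    ∃ l : ℝ, 0 ≤ l ∧ llrMoment Q₀ Q₁ l ≤ ENNReal.ofReal (Real.exp (-(l * x) - c)) := by
  have hne : {z : ℝ | ∃ l : ℝ, 0 ≤ l ∧ Integrable (lrPow Q₀ Q₁ l) (Q₁.prod Q₀) ∧
      z = -(l * x) - Real.log (∫ p, lrPow Q₀ Q₁ l p ∂(Q₁.prod Q₀))}.Nonempty := by
    -- The supremum of the empty set is `0` by convention, which `0 ≤ c < chernoffExp` excludes.
    by_contra hemp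
    rw [Set.not_nonempty_iff_eq_empty] at hemp
    rw [chernoffExp, hemp, Real.sSup_empty] at hcx
    linarith
  obtain ⟨z, ⟨l, hl, hi, rfl⟩, hz⟩ := exists_lt_of_lt_csSup hne hcx
  refine ⟨l, hl, ?_⟩
  rw [llrMoment_eq_ofReal h01 h10 hi]
  refine ENNReal.ofReal_le_ofReal ?_
  have hpos := (Real.exp_pos _).trans_le (exp_le_integral_lrPow h01 h10 hint1 hint0 hi)
  rw [← Real.log_le_iff_le_exp hpos]
  linarith

lemma constC_pos (h01 : Q₀ ≪ Q₁) (h10 : Q₁ ≪ Q₀)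
    (hint1 : Integrable (llr Q₁ Q₀) Q₁) (hint0 : Integrable (llr Q₀ Q₁) Q₀) {ε : ℝ}
    (hε : 0 < ε) (hεD : ε < symmKL Q₀ Q₁) : 0 < constC Q₀ Q₁ ε :=
  lt_min (sub_pos.2 hεD)
    (chernoffExp_pos h01 h10 hint1 hint0 (sub_pos.2 hεD).le (sub_lt_self _ hε))

lemma constC_lt (Q₀ Q₁ : Measure ℝ) {ε : ℝ} (hε : 0 < ε) : constC Q₀ Q₁ ε < symmKL Q₀ Q₁ :=
  (min_le_left _ _).trans_lt (sub_lt_self _ hε)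

end Chernoff

/-! ### A one-sided weak law, uniform in the pair of sources -/

section WeakLaw

lemma exists_lintegral_sub_le {Ω : Type*} [MeasurableSpace Ω] {μ : Measure Ω}
    {g : Ω → ℝ} (hg : Integrable g μ) {η : ℝ} (hη : 0 < η) :
    ∃ M : ℝ, ∫⁻ x, ENNReal.ofReal (g x - M) ∂μ ≤ ENNReal.ofReal η := by
  have h : Tendsto (fun k : ℕ => ∫⁻ x, ENNReal.ofReal (g x - k) ∂μ) atTop
      (𝓝 (∫⁻ _, 0 ∂μ)) := by
    refine tendsto_lintegral_of_dominated_convergence' (fun x => ENNReal.ofReal |g x|)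
      (fun k => (hg.1.aemeasurable.sub_const _).ennreal_ofReal)
      (fun k => ae_of_all _ fun x => ENNReal.ofReal_le_ofReal ?_) ?_ (ae_of_all _ fun x => ?_)
    · have h1 := le_abs_self (g x)
      have h2 : (0 : ℝ) ≤ k := k.cast_nonneg
      linarith
    · have := hg.abs.2
      rw [hasFiniteIntegral_iff_ofReal (ae_of_all _ fun x => abs_nonneg _)] at this
      exact this.ne
    · refine tendsto_const_nhds.congr' ?_
      filter_upwards [eventually_ge_atTop ⌈g x⌉₊] with k hk
      rw [ENNReal.ofReal_of_nonpos]
      have : g x ≤ k := (Nat.le_ceil _).trans (by exact_mod_cast hk)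
      linarith
  rw [lintegral_zero] at h
  obtain ⟨k, hk⟩ := (h.eventually_le_const (ENNReal.ofReal_pos.2 hη)).exists
  exact ⟨k, hk⟩

variable {Q₀ Q₁ : Measure ℝ} [IsProbabilityMeasure Q₀] [IsProbabilityMeasure Q₁]

lemma integrable_min_const {μ : Measure ℝ} [IsProbabilityMeasure μ] {g : ℝ → ℝ}
    (hg : Integrable g μ) (M : ℝ) : Integrable (fun x => min (g x) M) μ :=
  hg.inf (integrable_const M)

lemma eventually_exp_min_le {μ : Measure ℝ} [IsProbabilityMeasure μ] {g : ℝ → ℝ}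
    (hg : Integrable g μ) (M : ℝ) {δ : ℝ} (hδ : 0 < δ) :
    ∀ᶠ θ in 𝓝[>] (0 : ℝ), ∫⁻ x, ENNReal.ofReal (Real.exp (θ * min (g x) M)) ∂μ ≤
      ENNReal.ofReal (Real.exp (θ * (∫ x, g x ∂μ + δ))) := by
  have hm := integrable_min_const hg M
  have hexp : Integrable (fun x => Real.exp (min (g x) M)) μ := by
    refine Integrable.mono' (integrable_const (Real.exp M))
      (Real.continuous_exp.comp_aestronglyMeasurable hm.1) (ae_of_all _ fun x => ?_)
    rw [Real.norm_of_nonneg (Real.exp_pos _).le]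
    exact Real.exp_le_exp.2 (min_le_right _ _)
  filter_upwards [eventually_integral_exp_le hm hexp hδ, self_mem_nhdsWithin] with θ h hθ
  refine h.trans (ENNReal.ofReal_le_ofReal (Real.exp_le_exp.2 ?_))
  have : ∫ x, min (g x) M ∂μ ≤ ∫ x, g x ∂μ := integral_mono hm hg fun x => min_le_left _ _
  exact mul_le_mul_of_nonneg_left (by linarith) (le_of_lt hθ)

/-- Upper tails have only a first moment available. The summands are cut at `M` and `N`: the
truncated part has exponential moments and obeys a Chernoff bound, while the excess has small mean
and obeys Markov's inequality. Both estimates depend on `v`, `u`, `t` only through the number of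
summands. -/
lemma pathSum_upper_tail (p q : ℝ → ℝ) (hpm : Measurable p) (hqm : Measurable q)
    (hp : Integrable p Q₁) (hq : Integrable q Q₀) {δ η : ℝ} (hδ : 0 < δ) (hη : 0 < η) :
    ∃ m₀ : ℕ, ∀ (v u : ℤ) (t : ℕ), m₀ ≤ diffCount (u - v).natAbs t →
      patternLaw Q₀ Q₁ (ball v) {y | (∫ x, p x ∂Q₁ + ∫ x, q x ∂Q₀ + δ) *
        diffCount (u - v).natAbs t < pathSum p q (ball v) (ball u) t y} ≤ ENNReal.ofReal η := by
  set D := ∫ x, p x ∂Q₁ + ∫ x, q x ∂Q₀ with hD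
  -- Two excess means of `η * δ / 8` per pair, against the level `δ / 2` per pair, give probability
  -- `η / 2`.
  have hη1 : 0 < η * δ / 8 := by positivity
  have hδ1 : 0 < δ / 8 := by positivity
  obtain ⟨M, hM⟩ := exists_lintegral_sub_le hp hη1
  obtain ⟨N, hN⟩ := exists_lintegral_sub_le hq hη1
  obtain ⟨θ, ⟨hθp, hθq⟩, hθ⟩ := (((eventually_exp_min_le hp M hδ1).and
    (eventually_exp_min_le hq N hδ1)).and self_mem_nhdsWithin).exists
  replace hθ : 0 < θ := hθ
  have hlim : Tendsto (fun m : ℕ => Real.exp (-(θ * δ / 4 * m))) atTop (𝓝 0) :=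
    Real.tendsto_exp_neg_atTop_nhds_zero.comp
      (tendsto_natCast_atTop_atTop.const_mul_atTop (by positivity))
  obtain ⟨m₀, hm₀⟩ := eventually_atTop.1 (hlim.eventually_le_const (half_pos hη))
  -- At least one summand is required so that the level in Markov's inequality is positive.
  refine ⟨max m₀ 1, fun v u t hm => ?_⟩
  set m := diffCount (u - v).natAbs t with hmdef
  have hm1 : (1 : ℝ) ≤ m := by exact_mod_cast (le_max_right _ _).trans hm
  have hm2 := hm₀ m ((le_max_left _ _).trans hm)
  set P := patternLaw Q₀ Q₁ (ball v)
  set p₁ : ℝ → ℝ := fun x => min (p x) M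
  set q₁ : ℝ → ℝ := fun x => min (q x) N
  set p₂ : ℝ → ℝ := fun x => max (p x - M) 0
  set q₂ : ℝ → ℝ := fun x => max (q x - N) 0
  have hp₁ : Measurable p₁ := hpm.min measurable_const
  have hq₁ : Measurable q₁ := hqm.min measurable_const
  have hp₂ : Measurable p₂ := (hpm.sub_const _).max measurable_const
  have hq₂ : Measurable q₂ := (hqm.sub_const _).max measurable_const
  have hsplit : ∀ y : Path ℤ, pathSum p q (ball v) (ball u) t y =
      pathSum p₁ q₁ (ball v) (ball u) t y + pathSum p₂ q₂ (ball v) (ball u) t y := by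
    intro y
    have h1 : ∀ x, p x = p₁ x + p₂ x := fun x => by
      simp only [p₁, p₂]
      rcases le_total (p x) M with h | h
      · rw [min_eq_left h, max_eq_right (by linarith)]; ring
      · rw [min_eq_right h, max_eq_left (by linarith)]; ring
    have h2 : ∀ x, q x = q₁ x + q₂ x := fun x => by
      simp only [q₁, q₂]
      rcases le_total (q x) N with h | h
      · rw [min_eq_left h, max_eq_right (by linarith)]; ring
      · rw [min_eq_right h, max_eq_left (by linarith)]; ring
    simp only [pathSum, blockSum, h1, h2, Finset.sum_add_distrib]
    ring
  have hsub : {y | (D + δ) * m < pathSum p q (ball v) (ball u) t y} ⊆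
      {y | 1 ≤ ENNReal.ofReal (Real.exp (pathSum (fun x => θ * p₁ x) (fun x => θ * q₁ x)
        (ball v) (ball u) t y)) * ENNReal.ofReal (Real.exp (-(θ * ((D + δ / 2) * m))))} ∪
      {y | ENNReal.ofReal (δ / 2 * m) ≤
        ENNReal.ofReal (pathSum p₂ q₂ (ball v) (ball u) t y)} := by
    intro y hy
    rw [Set.mem_ofPred_eq, hsplit] at hy
    rcases le_total (δ / 2 * m) (pathSum p₂ q₂ (ball v) (ball u) t y) with h | h
    · exact Or.inr (ENNReal.ofReal_le_ofReal h)
    · left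
      have hlin : pathSum (fun x => θ * p₁ x) (fun x => θ * q₁ x) (ball v) (ball u) t y =
          θ * pathSum p₁ q₁ (ball v) (ball u) t y := by
        simp only [pathSum, blockSum, Finset.mul_sum, mul_add]
      rw [Set.mem_ofPred_eq, ← ENNReal.ofReal_mul (Real.exp_pos _).le, ← Real.exp_add,
        ENNReal.one_le_ofReal, Real.one_le_exp_iff, hlin]
      have : (D + δ / 2) * m ≤ pathSum p₁ q₁ (ball v) (ball u) t y := by nlinarith
      nlinarith
  refine (measure_mono hsub).trans ((measure_union_le _ _).trans ?_)
  have hfirst : P {y | 1 ≤ ENNReal.ofReal (Real.exp (pathSum (fun x => θ * p₁ x)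
      (fun x => θ * q₁ x) (ball v) (ball u) t y)) *
        ENNReal.ofReal (Real.exp (-(θ * ((D + δ / 2) * m))))} ≤ ENNReal.ofReal (η / 2) := by
    have hmk := mul_meas_ge_le_lintegral₀ (μ := P)
      (f := fun y => ENNReal.ofReal (Real.exp (pathSum (fun x => θ * p₁ x)
      (fun x => θ * q₁ x) (ball v) (ball u) t y)) *
        ENNReal.ofReal (Real.exp (-(θ * ((D + δ / 2) * m)))))
      ((measurable_pathSum (hp₁.const_mul θ) (hq₁.const_mul θ) _ _ _).exp.ennreal_ofReal.mul_const
        _).aemeasurable 1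
    rw [one_mul] at hmk
    refine hmk.trans ?_
    rw [lintegral_mul_const _
      (measurable_pathSum (hp₁.const_mul θ) (hq₁.const_mul θ) _ _ _).exp.ennreal_ofReal,
      lintegral_exp_pathSum (hp₁.const_mul θ) (hq₁.const_mul θ), sum_card_ball_sdiff,
      sum_card_ball_sdiff']
    calc _ ≤ ENNReal.ofReal (Real.exp (θ * (∫ x, p x ∂Q₁ + δ / 8))) ^ m *
          ENNReal.ofReal (Real.exp (θ * (∫ x, q x ∂Q₀ + δ / 8))) ^ m *
          ENNReal.ofReal (Real.exp (-(θ * ((D + δ / 2) * m)))) := by gcongr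
      _ = ENNReal.ofReal (Real.exp (-(θ * δ / 4 * m))) := by
          rw [← ENNReal.ofReal_pow (Real.exp_pos _).le, ← ENNReal.ofReal_pow (Real.exp_pos _).le,
            ← ENNReal.ofReal_mul (by positivity), ← ENNReal.ofReal_mul (by positivity),
            ← Real.exp_nat_mul, ← Real.exp_nat_mul, ← Real.exp_add, ← Real.exp_add]
          congr 2
          rw [hD]; ring
      _ ≤ _ := ENNReal.ofReal_le_ofReal hm2
  have hsecond : P {y | ENNReal.ofReal (δ / 2 * m) ≤
      ENNReal.ofReal (pathSum p₂ q₂ (ball v) (ball u) t y)} ≤ ENNReal.ofReal (η / 2) := by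
    have hpos : 0 < δ / 2 * m := by positivity
    refine (meas_ge_le_lintegral_div (measurable_pathSum hp₂ hq₂ _ _ _).ennreal_ofReal.aemeasurable
      (ENNReal.ofReal_pos.2 hpos).ne' ENNReal.ofReal_ne_top).trans ?_
    refine ENNReal.div_le_of_le_mul ((lintegral_pathSum_le hp₂ hq₂ _ _ _).trans ?_)
    rw [sum_card_ball_sdiff, sum_card_ball_sdiff', ← hmdef]
    have h1 : ∀ x, ENNReal.ofReal (p₂ x) = ENNReal.ofReal (p x - M) := fun x => by
      simp [p₂, ENNReal.ofReal_max]
    have h2 : ∀ x, ENNReal.ofReal (q₂ x) = ENNReal.ofReal (q x - N) := fun x => by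
      simp [q₂, ENNReal.ofReal_max]
    simp_rw [h1, h2]
    calc _ ≤ (m : ℝ≥0∞) * ENNReal.ofReal (η * δ / 8) + m * ENNReal.ofReal (η * δ / 8) := by
          gcongr
      _ = ENNReal.ofReal (η / 2) * ENNReal.ofReal (δ / 2 * m) := by
          rw [← two_mul, ← ENNReal.ofReal_natCast, ← ENNReal.ofReal_mul (by positivity),
            ← ENNReal.ofReal_mul (by positivity), ← ENNReal.ofReal_ofNat,
            ← ENNReal.ofReal_mul (by positivity)]
          congr 1
          ring
  calc _ ≤ ENNReal.ofReal (η / 2) + ENNReal.ofReal (η / 2) := add_le_add hfirst hsecond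
    _ = ENNReal.ofReal η := by rw [← ENNReal.ofReal_add (by positivity) (by positivity)]; ring_nf

lemma logLR_upper_tail (h01 : Q₀ ≪ Q₁) (h10 : Q₁ ≪ Q₀)
    (hint1 : Integrable (llr Q₁ Q₀) Q₁) (hint0 : Integrable (llr Q₀ Q₁) Q₀)
    {δ η : ℝ} (hδ : 0 < δ) (hη : 0 < η) :
    ∃ m₀ : ℕ, ∀ (v u : ℤ) (t : ℕ), m₀ ≤ diffCount (u - v).natAbs t →
      patternLaw Q₀ Q₁ (ball v) {y | (symmKL Q₀ Q₁ + δ) * diffCount (u - v).natAbs t <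
        logLR Q₀ Q₁ (ball v) (ball u) t y} ≤ ENNReal.ofReal η := by
  obtain ⟨m₀, h⟩ := pathSum_upper_tail (llr Q₁ Q₀) (llr Q₀ Q₁) (measurable_llr _ _)
    (measurable_llr _ _) hint1 hint0 hδ hη
  refine ⟨m₀, fun v u t hm => le_trans (le_of_eq ?_) (h v u t hm)⟩
  refine measure_congr ?_
  filter_upwards [logLR_ae_eq h01 h10 (ball v) (ball u) (ball v) t] with y hy
  change (_ < _) = (_ < _)
  rw [hy, symmKL]

end WeakLaw

/-! ### Constraints on admissible estimators -/

section Estimators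

variable {Q₀ Q₁ : Measure ℝ} {W : Finset ℤ} {R : ℕ} {α : ℝ}

/-- The event that the estimator stops by time `t` with an estimate in `A`. -/
def SeqEstimator.stopsIn (S : SeqEstimator W) (A : Finset ℤ) (t : ℕ) : Set (Path ℤ) :=
  {y | ∃ s ≤ t, S.T y = (s : ℕ∞) ∧ S.D s y ∈ A}

lemma SeqEstimator.measurableSet_stopsIn (S : SeqEstimator W) (A : Finset ℤ) (t : ℕ) :
    MeasurableSet[obsFiltration ℤ t] (S.stopsIn A t) := by
  have : S.stopsIn A t = ⋃ s ∈ Finset.range (t + 1), ⋃ w ∈ A,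
      ({y | S.T y = (s : ℕ∞)} ∩ {y | S.D s y = w}) := by
    ext y
    simp only [SeqEstimator.stopsIn, Set.mem_ofPred_eq, Set.mem_iUnion, Finset.mem_range,
      Nat.lt_succ_iff, exists_prop, Set.mem_inter_iff]
    constructor
    · rintro ⟨s, hs, hT, hD⟩
      exact ⟨s, hs, _, hD, hT, rfl⟩
    · rintro ⟨s, hs, w, hw, hT, rfl⟩
      exact ⟨s, hs, hT, hw⟩
  rw [this]
  refine Finset.measurableSet_biUnion _ fun s hs => Finset.measurableSet_biUnion _ fun w _ => ?_
  exact (obsFiltration ℤ).mono (Nat.lt_succ_iff.1 (Finset.mem_range.1 hs)) _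
    ((S.isStoppingTime.measurableSet_eq s).inter (S.adapted s w))

lemma SeqEstimator.setOf_le_eq_stopsIn (S : SeqEstimator W) (t : ℕ) :
    {y | S.T y ≤ (t : ℕ∞)} = S.stopsIn W t := by
  ext y
  constructor
  · intro h
    obtain ⟨s, hs⟩ := ENat.ne_top_iff_exists.1 (ne_top_of_le_ne_top (ENat.natCast_ne_top t) h)
    refine ⟨s, ?_, hs.symm, S.mem _ _⟩
    rw [Set.mem_ofPred_eq, ← hs] at h
    exact_mod_cast h
  · rintro ⟨s, hs, hT, -⟩
    rw [Set.mem_ofPred_eq, hT]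
    exact_mod_cast hs

lemma SeqEstimator.stopsIn_mono (S : SeqEstimator W) {A A' : Finset ℤ}
    (h : ∀ w ∈ A, w ∈ W → w ∈ A') (t : ℕ) : S.stopsIn A t ⊆ S.stopsIn A' t := by
  rintro y ⟨s, hs, hT, hD⟩
  exact ⟨s, hs, hT, h _ hD (S.mem _ _)⟩

lemma measure_stopsIn_far_le {S : SeqEstimator W} (hS : S ∈ admissible line Q₀ Q₁ W R α)
    {A : Finset ℤ} {v : ℤ} (hv : v ∈ W) (hA : ∀ w ∈ A, R < (w - v).natAbs) (t : ℕ) :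
    patternLaw Q₀ Q₁ (ball v) (S.stopsIn A t) ≤ A.card * ENNReal.ofReal (α / W.card) := by
  have hsub : S.stopsIn A t ⊆ ⋃ w ∈ A.filter (· ∈ W), S.outputs w := by
    rintro y ⟨s, hs, hT, hD⟩
    simp only [Set.mem_iUnion, Finset.mem_filter]
    exact ⟨_, ⟨hD, S.mem _ _⟩, s, hT, rfl⟩
  refine (measure_mono hsub).trans ((measure_biUnion_finset_le _ _).trans ?_)
  calc ∑ w ∈ A.filter (· ∈ W), patternLaw Q₀ Q₁ (ball v) (S.outputs w)
      ≤ ∑ _w ∈ A.filter (· ∈ W), ENNReal.ofReal (α / W.card) := by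
        refine Finset.sum_le_sum fun w hw => ?_
        rw [Finset.mem_filter] at hw
        rw [← pathLaw_line]
        refine hS w hw.2 v hv ?_
        rw [edist_line, ← Int.natAbs_neg, neg_sub]
        exact_mod_cast hA w hw.1
    _ ≤ _ := by
        rw [Finset.sum_const, nsmul_eq_mul]
        gcongr
        exact Finset.filter_subset _ _

/-- At most `|W|` wrong answers are possible, each of probability at most `α / |W|`. -/
lemma measure_stopsIn_all_far_le {S : SeqEstimator W} (hS : S ∈ admissible line Q₀ Q₁ W R α)
    {v : ℤ} (hv : v ∈ W) {A : Finset ℤ} (hA : ∀ w ∈ A, R < (w - v).natAbs) (t : ℕ) :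
    patternLaw Q₀ Q₁ (ball v) (S.stopsIn A t) ≤ ENNReal.ofReal α := by
  have hn : (0 : ℝ) < W.card := by exact_mod_cast Finset.card_pos.2 ⟨v, hv⟩
  have h := measure_stopsIn_far_le (Q₀ := Q₀) (Q₁ := Q₁) hS (A := A.filter (· ∈ W)) hv
    (fun w hw => hA w (Finset.mem_filter.1 hw).1) t
  refine (measure_mono (S.stopsIn_mono (fun w hw hwW => Finset.mem_filter.2 ⟨hw, hwW⟩) t)).trans
    (h.trans ?_)
  calc ((A.filter (· ∈ W)).card : ℝ≥0∞) * ENNReal.ofReal (α / W.card)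
      ≤ W.card * ENNReal.ofReal (α / W.card) := by
        gcongr
        exact fun w hw => (Finset.mem_filter.1 hw).2
    _ = ENNReal.ofReal α := by
        rw [← ENNReal.ofReal_natCast, ← ENNReal.ofReal_mul hn.le, mul_div_cancel₀ _ hn.ne']

variable [IsProbabilityMeasure Q₀] [IsProbabilityMeasure Q₁]

/-- The event is split according to whether the likelihood ratio exceeds `exp x`; below that level
the change of measure costs at most `exp x`. -/
lemma measure_le_exp_mul_add (h01 : Q₀ ≪ Q₁) (h10 : Q₁ ≪ Q₀) (v u : ℤ) {t : ℕ}
    {A : Set (Path ℤ)} (hA : MeasurableSet[obsFiltration ℤ t] A) (x : ℝ) :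
    patternLaw Q₀ Q₁ (ball v) A ≤
      ENNReal.ofReal (Real.exp x) * patternLaw Q₀ Q₁ (ball u) A +
        patternLaw Q₀ Q₁ (ball v) {y | x < logLR Q₀ Q₁ (ball v) (ball u) t y} := by
  have hZ : Measurable[obsFiltration ℤ t] (logLR Q₀ Q₁ (ball v) (ball u) t) := by
    have h := measurable_Z line Q₀ Q₁ v u t
    convert h using 1
    ext y
    exact (Z_line Q₀ Q₁ v u t y).symm
  have hB : MeasurableSet[obsFiltration ℤ t]
      (A ∩ {y | logLR Q₀ Q₁ (ball v) (ball u) t y ≤ x}) :=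
    hA.inter (measurableSet_le hZ measurable_const)
  have hsub : A ⊆ (A ∩ {y | logLR Q₀ Q₁ (ball v) (ball u) t y ≤ x}) ∪
      {y | x < logLR Q₀ Q₁ (ball v) (ball u) t y} := by
    intro y hy
    rcases le_or_gt (logLR Q₀ Q₁ (ball v) (ball u) t y) x with h | h
    · exact Or.inl ⟨hy, h⟩
    · exact Or.inr h
  refine (measure_mono hsub).trans ((measure_union_le _ _).trans (add_le_add ?_ le_rfl))
  rw [patternLaw_change_of_measure h01 h10 (ball v) (ball u) hB]
  calc _ ≤ ∫⁻ _ in A ∩ {y | logLR Q₀ Q₁ (ball v) (ball u) t y ≤ x},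
        ENNReal.ofReal (Real.exp x) ∂(patternLaw Q₀ Q₁ (ball u)) :=
        setLIntegral_mono' ((obsFiltration ℤ).le _ _ hB) fun y hy =>
          ENNReal.ofReal_le_ofReal (Real.exp_le_exp.2 hy.2)
    _ = ENNReal.ofReal (Real.exp x) * patternLaw Q₀ Q₁ (ball u)
        (A ∩ {y | logLR Q₀ Q₁ (ball v) (ball u) t y ≤ x}) := setLIntegral_const _ _
    _ ≤ _ := by gcongr; exact Set.inter_subset_left

/-- An answer within `R` on the right of `v` is at distance more than `R` from `v - (R + 1)`, and
symmetrically on the left. Each such set has `R + 1` points, whence the factor `R + 1` rather than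
`|W|`. -/
lemma measure_stop_le (h01 : Q₀ ≪ Q₁) (h10 : Q₁ ≪ Q₀) {S : SeqEstimator W}
    (hS : S ∈ admissible line Q₀ Q₁ W R α) {v u u' : ℤ} (hv : v ∈ W)
    (hu : u ∈ W) (hu' : u' ∈ W) (huv : u = v - (R + 1)) (huv' : u' = v + (R + 1))
    (t : ℕ) (x : ℝ) :
    patternLaw Q₀ Q₁ (ball v) {y | S.T y ≤ (t : ℕ∞)} ≤ ENNReal.ofReal α +
      (ENNReal.ofReal (Real.exp x) * ((R + 1 : ℕ) * ENNReal.ofReal (α / W.card)) +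
        patternLaw Q₀ Q₁ (ball v) {y | x < logLR Q₀ Q₁ (ball v) (ball u) t y}) +
      (ENNReal.ofReal (Real.exp x) * ((R + 1 : ℕ) * ENNReal.ofReal (α / W.card)) +
        patternLaw Q₀ Q₁ (ball v) {y | x < logLR Q₀ Q₁ (ball v) (ball u') t y}) := by
  rw [S.setOf_le_eq_stopsIn]
  have hsub : S.stopsIn W t ⊆ S.stopsIn (W.filter fun w => R < (w - v).natAbs) t ∪
      S.stopsIn (Finset.Icc v (v + R)) t ∪ S.stopsIn (Finset.Icc (v - R) v) t := by
    rintro y ⟨s, hs, hT, hD⟩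
    by_cases h1 : R < (S.D s y - v).natAbs
    · exact Or.inl (Or.inl ⟨s, hs, hT, Finset.mem_filter.2 ⟨hD, h1⟩⟩)
    · rcases le_total v (S.D s y) with h | h
      · exact Or.inl (Or.inr ⟨s, hs, hT, Finset.mem_Icc.2 ⟨h, by omega⟩⟩)
      · exact Or.inr ⟨s, hs, hT, Finset.mem_Icc.2 ⟨by omega, h⟩⟩
  refine (measure_mono hsub).trans ((measure_union_le _ _).trans
    (add_le_add ((measure_union_le _ _).trans (add_le_add ?_ ?_)) ?_))
  · exact measure_stopsIn_all_far_le hS hv (fun w hw => (Finset.mem_filter.1 hw).2) t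
  · refine (measure_le_exp_mul_add h01 h10 v u (S.measurableSet_stopsIn _ t) x).trans ?_
    gcongr
    refine (measure_stopsIn_far_le hS hu (fun w hw => ?_) t).trans (le_of_eq ?_)
    · rw [Finset.mem_Icc] at hw; omega
    · rw [Int.card_Icc, show (v + R + 1 - v).toNat = R + 1 by omega]
  · refine (measure_le_exp_mul_add h01 h10 v u' (S.measurableSet_stopsIn _ t) x).trans ?_
    gcongr
    refine (measure_stopsIn_far_le hS hu' (fun w hw => ?_) t).trans (le_of_eq ?_)
    · rw [Finset.mem_Icc] at hw; omega
    · rw [Int.card_Icc, show (v + 1 - (v - R)).toNat = R + 1 by omega]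

lemma mul_le_worstRuntime (S : SeqEstimator W) {v : ℤ} (hv : v ∈ W) (t : ℕ) :
    ((t + 1 : ℕ) : ℝ≥0∞) * (1 - patternLaw Q₀ Q₁ (ball v) {y | S.T y ≤ (t : ℕ∞)}) ≤
      worstRuntime line Q₀ Q₁ W S.T := by
  refine le_trans ?_ (le_iSup₂_of_le v hv le_rfl)
  rw [pathLaw_line]
  have hm : MeasurableSet {y | S.T y ≤ (t : ℕ∞)} := (obsFiltration ℤ).le _ _ (S.isStoppingTime t)
  rw [← prob_compl_eq_one_sub hm, ← setLIntegral_const, ← lintegral_indicator hm.compl]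
  refine lintegral_mono fun y => ?_
  by_cases hy : S.T y ≤ (t : ℕ∞)
  · rw [Set.indicator_of_notMem (by simpa using hy)]
    exact zero_le
  · rw [Set.indicator_of_mem (by simpa using hy)]
    rw [not_le] at hy
    have h1 : ((t + 1 : ℕ) : ℕ∞) ≤ S.T y := by
      push_cast
      exact Order.add_one_le_of_lt hy
    have h2 : (((t + 1 : ℕ) : ℕ∞) : ℝ≥0∞) ≤ (S.T y : ℝ≥0∞) := ENat.toENNReal_le.2 h1
    simpa using h2

end Estimators

/-! ### Mixtures of well-separated sources are close to the law without a source -/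

section Mixtures

variable {Q₀ Q₁ : Measure ℝ}

/-- The pattern without a source. -/
def noSource : ℕ → Finset ℤ := fun _ => ∅

lemma pathSum_noSource (p q : ℝ → ℝ) (B : ℕ → Finset ℤ) (t : ℕ) (y : Path ℤ) :
    pathSum p q B noSource t y = ∑ s ∈ Finset.range (t + 1), ∑ w ∈ B s, p (y s w) := by
  simp [pathSum, blockSum, noSource]

lemma pathSum_noSource_left (p q : ℝ → ℝ) (B : ℕ → Finset ℤ) (t : ℕ) (y : Path ℤ) :
    pathSum p q noSource B t y = ∑ s ∈ Finset.range (t + 1), ∑ w ∈ B s, q (y s w) := by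
  simp [pathSum, blockSum, noSource]

/-- The likelihood ratio of `ℙ_v` to the law without a source, cut off at `exp c`. -/
noncomputable def cutoffLR (Q₀ Q₁ : Measure ℝ) (c : ℝ) (t : ℕ) (v : ℤ) : Path ℤ → ℝ :=
  {y | logLR Q₀ Q₁ (ball v) noSource t y ≤ c}.indicator
    fun y => Real.exp (logLR Q₀ Q₁ (ball v) noSource t y)

lemma measurableSet_logLR_le (Q₀ Q₁ : Measure ℝ) (c : ℝ) (t : ℕ) (v : ℤ) :
    MeasurableSet[obsFiltration ℤ t] {y | logLR Q₀ Q₁ (ball v) noSource t y ≤ c} :=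
  measurableSet_le (Finset.measurable_fun_sum _ fun _ hs => (measurable_llr _ _).comp
    (measurable_obsFiltration_eval (Nat.lt_succ_iff.1 (Finset.mem_range.1 hs)))) measurable_const

lemma measurable_cutoffLR (c : ℝ) (t : ℕ) (v : ℤ) : Measurable (cutoffLR Q₀ Q₁ c t v) :=
  (measurable_logLR _ _ _ _ _).exp.indicator
    ((obsFiltration ℤ).le _ _ (measurableSet_logLR_le Q₀ Q₁ c t v))

lemma cutoffLR_nonneg (c : ℝ) (t : ℕ) (v : ℤ) (y : Path ℤ) : 0 ≤ cutoffLR Q₀ Q₁ c t v y :=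
  Set.indicator_nonneg (fun _ _ => (Real.exp_pos _).le) y

lemma cutoffLR_le_exp (c : ℝ) (t : ℕ) (v : ℤ) (y : Path ℤ) :
    cutoffLR Q₀ Q₁ c t v y ≤ Real.exp c :=
  Set.indicator_le' (fun _ hy => Real.exp_le_exp.2 hy) (fun _ _ => (Real.exp_pos _).le) y

lemma cutoffLR_le (c : ℝ) (t : ℕ) (v : ℤ) (y : Path ℤ) :
    cutoffLR Q₀ Q₁ c t v y ≤ Real.exp (logLR Q₀ Q₁ (ball v) noSource t y) :=
  Set.indicator_le_self' (fun _ _ => (Real.exp_pos _).le) y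

lemma integrable_cutoffLR (c : ℝ) (t : ℕ) (v : ℤ) (P : Measure (Path ℤ)) [IsFiniteMeasure P] :
    Integrable (cutoffLR Q₀ Q₁ c t v) P :=
  Integrable.of_bound (measurable_cutoffLR c t v).aestronglyMeasurable (Real.exp c)
    (ae_of_all _ fun y => by
      rw [Real.norm_of_nonneg (cutoffLR_nonneg c t v y)]
      exact cutoffLR_le_exp c t v y)

lemma integrable_cutoffLR_mul (c : ℝ) (t : ℕ) (v v' : ℤ) (P : Measure (Path ℤ))
    [IsFiniteMeasure P] :
    Integrable (fun y => cutoffLR Q₀ Q₁ c t v y * cutoffLR Q₀ Q₁ c t v' y) P :=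
  (integrable_cutoffLR c t v' P).bdd_mul (measurable_cutoffLR c t v).aestronglyMeasurable
    (ae_of_all _ fun y => by
      rw [Real.norm_of_nonneg (cutoffLR_nonneg c t v y)]
      exact cutoffLR_le_exp c t v y)

variable [IsProbabilityMeasure Q₀] [IsProbabilityMeasure Q₁]

lemma logLR_noSource_tail (h01 : Q₀ ≪ Q₁) (h10 : Q₁ ≪ Q₀) (hint1 : Integrable (llr Q₁ Q₀) Q₁)
    (v : ℤ) (t : ℕ) {c : ℝ} (hc : 0 < c) :
    patternLaw Q₀ Q₁ (ball v) {y | c < logLR Q₀ Q₁ (ball v) noSource t y} ≤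
      ENNReal.ofReal ((t + 1) ^ 2 * (∫ x, |llr Q₁ Q₀ x| ∂Q₁) / c) := by
  have hm := measurable_llr Q₁ Q₀
  have hae := logLR_ae_eq h01 h10 (ball v) noSource (ball v) t
  have h1 : patternLaw Q₀ Q₁ (ball v) {y | c < logLR Q₀ Q₁ (ball v) noSource t y} ≤
      patternLaw Q₀ Q₁ (ball v) {y | ENNReal.ofReal c ≤
        ENNReal.ofReal (pathSum (llr Q₁ Q₀) 0 (ball v) noSource t y)} := by
    refine measure_mono_ae ?_
    filter_upwards [hae] with y hy hcy
    change c < _ at hcy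
    rw [hy, pathSum_noSource] at hcy
    change _ ≤ _
    rw [pathSum_noSource]
    exact ENNReal.ofReal_le_ofReal hcy.le
  refine h1.trans ((meas_ge_le_lintegral_div
    (measurable_pathSum hm measurable_zero _ _ _).ennreal_ofReal.aemeasurable
    (ENNReal.ofReal_pos.2 hc).ne' ENNReal.ofReal_ne_top).trans ?_)
  rw [ENNReal.ofReal_div_of_pos hc]
  gcongr
  refine (lintegral_pathSum_le hm measurable_zero _ _ _).trans ?_
  have hcard : ∑ s ∈ Finset.range (t + 1), (ball v s \ noSource s).card = (t + 1) ^ 2 := by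
    simp only [noSource, Finset.sdiff_empty, card_ball, sum_range_two_mul_add_one]
  have hle : ∫⁻ x, ENNReal.ofReal (llr Q₁ Q₀ x) ∂Q₁ ≤
      ENNReal.ofReal (∫ x, |llr Q₁ Q₀ x| ∂Q₁) := by
    rw [ofReal_integral_eq_lintegral_ofReal hint1.abs (ae_of_all _ fun x => abs_nonneg _)]
    exact lintegral_mono fun x => ENNReal.ofReal_le_ofReal (le_abs_self _)
  rw [hcard, ENNReal.ofReal_mul (by positivity)]
  simp only [Pi.zero_apply, ENNReal.ofReal_zero, lintegral_zero, mul_zero, add_zero]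
  gcongr
  rw [← ENNReal.ofReal_natCast]
  push_cast
  exact le_rfl

/-- Up to time `t` the two light cones are disjoint, so the product is itself the likelihood ratio
of the pattern formed by their union. -/
lemma lintegral_exp_logLR_mul (h01 : Q₀ ≪ Q₁) (h10 : Q₁ ≪ Q₀) {v v' : ℤ} {t : ℕ}
    (hvv' : 2 * t < (v - v').natAbs) :
    ∫⁻ y, ENNReal.ofReal (Real.exp (logLR Q₀ Q₁ (ball v) noSource t y)) *
      ENNReal.ofReal (Real.exp (logLR Q₀ Q₁ (ball v') noSource t y))
        ∂(patternLaw Q₀ Q₁ noSource) = 1 := by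
  have hone : ∫⁻ x, ENNReal.ofReal (Real.exp (llr Q₁ Q₀ x)) ∂Q₀ = 1 := by
    rw [← setLIntegral_univ, ← withDensity_apply _ MeasurableSet.univ,
      withDensity_exp_llr _ _ h10 h01, measure_univ]
  have h := lintegral_exp_pathSum (Q₀ := Q₀) (Q₁ := Q₁) measurable_zero (measurable_llr Q₁ Q₀)
    noSource (fun s => ball v s ∪ ball v' s) t
  rw [hone, one_pow, mul_one] at h
  simp only [noSource, Finset.empty_sdiff, Finset.card_empty, Finset.sum_const_zero,
    pow_zero] at h
  rw [← h]
  refine lintegral_congr_ae ?_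
  filter_upwards [logLR_ae_eq h01 h10 (ball v) noSource noSource t,
    logLR_ae_eq h01 h10 (ball v') noSource noSource t] with y hy hy'
  rw [hy, hy', pathSum_noSource, pathSum_noSource, ← ENNReal.ofReal_mul (Real.exp_pos _).le,
    ← Real.exp_add, ← Finset.sum_add_distrib]
  congr 2
  refine Eq.trans ?_ (pathSum_noSource_left _ _ _ _ _).symm
  refine Finset.sum_congr rfl fun s hs => ?_
  rw [Finset.sum_union]
  refine Finset.disjoint_left.2 fun w hw hw' => ?_
  rw [mem_ball] at hw hw'
  have := Finset.mem_range.1 hs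
  omega

lemma setIntegral_cutoffLR (h01 : Q₀ ≪ Q₁) (h10 : Q₁ ≪ Q₀) (c : ℝ) {t : ℕ} (v : ℤ)
    {E : Set (Path ℤ)} (hE : MeasurableSet[obsFiltration ℤ t] E) :
    ∫ y in E, cutoffLR Q₀ Q₁ c t v y ∂(patternLaw Q₀ Q₁ noSource) =
      (patternLaw Q₀ Q₁ (ball v)).real
        (E ∩ {y | logLR Q₀ Q₁ (ball v) noSource t y ≤ c}) := by
  have hK := measurableSet_logLR_le Q₀ Q₁ c t v
  rw [Measure.real, patternLaw_change_of_measure h01 h10 (ball v) noSource (hE.inter hK),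
    cutoffLR, setIntegral_indicator ((obsFiltration ℤ).le _ _ hK),
    integral_eq_lintegral_of_nonneg_ae (ae_of_all _ fun y => (Real.exp_pos _).le)
      (measurable_logLR _ _ _ _ _).exp.aestronglyMeasurable]

lemma integral_cutoffLR_mul_le (h01 : Q₀ ≪ Q₁) (h10 : Q₁ ≪ Q₀) (c : ℝ) {t : ℕ} {v v' : ℤ}
    (hvv' : 2 * t < (v - v').natAbs) :
    ∫ y, cutoffLR Q₀ Q₁ c t v y * cutoffLR Q₀ Q₁ c t v' y ∂(patternLaw Q₀ Q₁ noSource) ≤ 1 := by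
  rw [integral_eq_lintegral_of_nonneg_ae
    (ae_of_all _ fun y => mul_nonneg (cutoffLR_nonneg _ _ _ _) (cutoffLR_nonneg _ _ _ _))
    ((measurable_cutoffLR c t v).mul (measurable_cutoffLR c t v')).aestronglyMeasurable]
  refine ENNReal.toReal_le_of_le_ofReal zero_le_one ?_
  rw [ENNReal.ofReal_one, ← lintegral_exp_logLR_mul h01 h10 hvv']
  refine lintegral_mono fun y => ?_
  rw [← ENNReal.ofReal_mul (Real.exp_pos _).le]
  exact ENNReal.ofReal_le_ofReal (mul_le_mul (cutoffLR_le _ _ _ _) (cutoffLR_le _ _ _ _)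
    (cutoffLR_nonneg _ _ _ _) (Real.exp_pos _).le)

lemma integral_cutoffLR_le_one (h01 : Q₀ ≪ Q₁) (h10 : Q₁ ≪ Q₀) (c : ℝ) (t : ℕ) (v : ℤ) :
    ∫ y, cutoffLR Q₀ Q₁ c t v y ∂(patternLaw Q₀ Q₁ noSource) ≤ 1 := by
  rw [← setIntegral_univ, setIntegral_cutoffLR h01 h10 c v MeasurableSet.univ]
  exact measureReal_le_one

/-- Second moment method. Off-diagonal terms are at most one, diagonal terms at most `exp c`, and
each mean is at least `1 - η`, so the variance around `m = I.card` is at most `m ^ 2 * (exp c / m +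
2 * η)`. -/
lemma integral_abs_sum_cutoffLR_sub_le (h01 : Q₀ ≪ Q₁) (h10 : Q₁ ≪ Q₀) {c η κ : ℝ} {t : ℕ}
    (hκ : 0 < κ) {I : Finset ℤ} (hI : I.Nonempty)
    (hsep : ∀ v ∈ I, ∀ v' ∈ I, v ≠ v' → 2 * t < (v - v').natAbs)
    (htail : ∀ v ∈ I, (patternLaw Q₀ Q₁ (ball v)).real
      {y | c < logLR Q₀ Q₁ (ball v) noSource t y} ≤ η)
    (hcκ : Real.exp c / I.card + 2 * η ≤ κ ^ 2) :
    ∫ y, |∑ v ∈ I, cutoffLR Q₀ Q₁ c t v y - I.card| ∂(patternLaw Q₀ Q₁ noSource) ≤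
      I.card * κ := by
  set P := patternLaw Q₀ Q₁ noSource
  set m : ℝ := (I.card : ℝ) with hm
  have hmpos : 0 < m := by rw [hm]; exact_mod_cast hI.card_pos
  set F : Path ℤ → ℝ := fun y => ∑ v ∈ I, cutoffLR Q₀ Q₁ c t v y with hF
  have hFi : Integrable F P := integrable_finsetSum _ fun v _ => integrable_cutoffLR c t v P
  have hFsq : ∀ y, F y ^ 2 = ∑ v ∈ I, ∑ v' ∈ I, cutoffLR Q₀ Q₁ c t v y * cutoffLR Q₀ Q₁ c t v' y :=
    fun y => by rw [sq, hF, Finset.sum_mul_sum]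
  have hF2i : Integrable (fun y => F y ^ 2) P := by
    simp_rw [hFsq]
    exact integrable_finsetSum _ fun v _ => integrable_finsetSum _ fun v' _ =>
      integrable_cutoffLR_mul c t v v' P
  have hF2 : ∫ y, F y ^ 2 ∂P ≤ m ^ 2 + m * Real.exp c := by
    simp_rw [hFsq]
    rw [integral_finsetSum _ fun v _ => integrable_finsetSum _ fun v' _ =>
      integrable_cutoffLR_mul c t v v' P]
    have hrow : ∀ v ∈ I, ∫ y, ∑ v' ∈ I, cutoffLR Q₀ Q₁ c t v y * cutoffLR Q₀ Q₁ c t v' y ∂P ≤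
        m + Real.exp c := by
      intro v hv
      rw [integral_finsetSum _ fun v' _ => integrable_cutoffLR_mul c t v v' P]
      calc _ ≤ ∑ v' ∈ I, (1 + if v' = v then Real.exp c else 0) := by
            refine Finset.sum_le_sum fun v' hv' => ?_
            by_cases h : v' = v
            · subst h
              rw [if_pos rfl]
              calc _ ≤ ∫ y, Real.exp c * cutoffLR Q₀ Q₁ c t v' y ∂P := by
                    refine integral_mono (integrable_cutoffLR_mul c t v' v' P)
                      ((integrable_cutoffLR c t v' P).const_mul _) fun y => ?_
                    exact mul_le_mul_of_nonneg_right (cutoffLR_le_exp _ _ _ _)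
                      (cutoffLR_nonneg _ _ _ _)
                _ ≤ Real.exp c * 1 := by
                    rw [integral_const_mul]
                    exact mul_le_mul_of_nonneg_left (integral_cutoffLR_le_one h01 h10 c t v')
                      (Real.exp_pos _).le
                _ ≤ _ := by linarith
            · rw [if_neg h, add_zero]
              exact integral_cutoffLR_mul_le h01 h10 c (hsep v hv v' hv' (Ne.symm h))
        _ = m + Real.exp c := by
            rw [Finset.sum_add_distrib, Finset.sum_ite_eq' I v, if_pos hv]
            simp [hm]
    calc _ ≤ ∑ _v ∈ I, (m + Real.exp c) := Finset.sum_le_sum hrow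
      _ = _ := by rw [Finset.sum_const, nsmul_eq_mul, ← hm]; ring
  have hF1 : m * (1 - η) ≤ ∫ y, F y ∂P := by
    rw [hF, integral_finsetSum _ fun v _ => integrable_cutoffLR c t v P, hm, ← nsmul_eq_mul,
      ← Finset.sum_const]
    refine Finset.sum_le_sum fun v hv => ?_
    rw [← setIntegral_univ, setIntegral_cutoffLR h01 h10 c v MeasurableSet.univ, Set.univ_inter]
    have hK := (obsFiltration ℤ).le _ _ (measurableSet_logLR_le Q₀ Q₁ c t v)
    have h := probReal_compl_eq_one_sub (μ := patternLaw Q₀ Q₁ (ball v)) hK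
    have h2 : {y | logLR Q₀ Q₁ (ball v) noSource t y ≤ c}ᶜ =
        {y | c < logLR Q₀ Q₁ (ball v) noSource t y} := by
      ext y; simp
    rw [h2] at h
    have := htail v hv
    linarith
  have hsq : ∫ y, (F y - m) ^ 2 ∂P ≤ (m * κ) ^ 2 := by
    have he : ∀ y, (F y - m) ^ 2 = F y ^ 2 + ((-2 * m) * F y + m ^ 2) := fun y => by ring
    simp_rw [he]
    have hlin : Integrable (fun y => (-2 * m) * F y + m ^ 2) P :=
      (hFi.const_mul _).add (integrable_const _)
    rw [integral_add hF2i hlin, integral_add (hFi.const_mul _) (integrable_const _),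
      integral_const_mul, integral_const, probReal_univ, one_smul]
    have h1 : m ^ 2 * (Real.exp c / m + 2 * η) ≤ m ^ 2 * κ ^ 2 := by gcongr
    have h2 : m ^ 2 * (Real.exp c / m + 2 * η) = m * Real.exp c + 2 * m ^ 2 * η := by
      field_simp
    nlinarith
  have hdi : Integrable (fun y => (F y - m) ^ 2) P := by
    have he : ∀ y, (F y - m) ^ 2 = F y ^ 2 + ((-2 * m) * F y + m ^ 2) := fun y => by ring
    simp_rw [he]
    exact hF2i.add ((hFi.const_mul _).add (integrable_const _))
  have ha : 0 < m * κ := mul_pos hmpos hκ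
  -- In place of Cauchy–Schwarz: `|z| ≤ z ^ 2 / (2 * a) + a / 2` with `a = m * κ`.
  calc ∫ y, |F y - m| ∂P ≤ ∫ y, ((2 * (m * κ))⁻¹ * (F y - m) ^ 2 + m * κ / 2) ∂P := by
        refine integral_mono (hFi.sub (integrable_const _)).abs
          ((hdi.const_mul _).add (integrable_const _)) fun y => ?_
        have h := sq_nonneg (|F y - m| - m * κ)
        rw [sub_sq, sq_abs] at h
        change |F y - m| ≤ (2 * (m * κ))⁻¹ * (F y - m) ^ 2 + m * κ / 2
        rw [← mul_le_mul_iff_right₀ (show 0 < 2 * (m * κ) by linarith), mul_add,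
          mul_inv_cancel_left₀ (by linarith)]
        nlinarith
    _ ≤ (2 * (m * κ))⁻¹ * (m * κ) ^ 2 + m * κ / 2 := by
        rw [integral_add (hdi.const_mul _) (integrable_const _), integral_const_mul,
          integral_const, probReal_univ, one_smul]
        gcongr
    _ = m * κ := by field_simp; ring

lemma abs_sum_real_inter_sub_le (h01 : Q₀ ≪ Q₁) (h10 : Q₁ ≪ Q₀) {c κ : ℝ} {t : ℕ}
    {I : Finset ℤ}
    (h : ∫ y, |∑ v ∈ I, cutoffLR Q₀ Q₁ c t v y - I.card| ∂(patternLaw Q₀ Q₁ noSource) ≤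
      I.card * κ) {E : Set (Path ℤ)} (hE : MeasurableSet[obsFiltration ℤ t] E) :
    |∑ v ∈ I, (patternLaw Q₀ Q₁ (ball v)).real
        (E ∩ {y | logLR Q₀ Q₁ (ball v) noSource t y ≤ c}) -
      I.card * (patternLaw Q₀ Q₁ noSource).real E| ≤ I.card * κ := by
  set P := patternLaw Q₀ Q₁ noSource
  have hFi : Integrable (fun y => ∑ v ∈ I, cutoffLR Q₀ Q₁ c t v y) P :=
    integrable_finsetSum _ fun v _ => integrable_cutoffLR c t v P
  have hd : Integrable (fun y => ∑ v ∈ I, cutoffLR Q₀ Q₁ c t v y - (I.card : ℝ)) P :=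
    hFi.sub (integrable_const _)
  have heq : ∑ v ∈ I, (patternLaw Q₀ Q₁ (ball v)).real
        (E ∩ {y | logLR Q₀ Q₁ (ball v) noSource t y ≤ c}) - I.card * P.real E =
      ∫ y in E, (∑ v ∈ I, cutoffLR Q₀ Q₁ c t v y - (I.card : ℝ)) ∂P := by
    rw [integral_sub hFi.integrableOn (integrable_const _).integrableOn,
      integral_finsetSum _ fun v _ => (integrable_cutoffLR c t v P).integrableOn,
      setIntegral_const, smul_eq_mul, mul_comm]
    congr 1
    exact Finset.sum_congr rfl fun v _ => (setIntegral_cutoffLR h01 h10 c v hE).symm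
  rw [heq]
  refine (abs_integral_le_integral_abs).trans (le_trans ?_ h)
  exact setIntegral_le_integral hd.abs (ae_of_all _ fun y => abs_nonneg _)

/-- Let `E` be the event of stopping by `t` with an answer within `R` of `I`. From every source in
`J` it is an error, so it is rare under the `J`-mixture, hence under the law without a source, hence
under the `I`-mixture. Stopping from a source in `I` without `E` is also an error, so some source in
`I` rarely stops by `t`. -/
lemma exists_measure_stop_le (h01 : Q₀ ≪ Q₁) (h10 : Q₁ ≪ Q₀) {W : Finset ℤ} {R : ℕ} {α : ℝ}
    (hα : 0 ≤ α) {S : SeqEstimator W} (hS : S ∈ admissible line Q₀ Q₁ W R α)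
    {c η κ : ℝ} {t : ℕ} (hκ : 0 < κ) {I J : Finset ℤ} (hI : I.Nonempty) (hJ : J.Nonempty)
    (hIW : I ⊆ W) (hJW : J ⊆ W)
    (hsepI : ∀ v ∈ I, ∀ v' ∈ I, v ≠ v' → 2 * t < (v - v').natAbs)
    (hsepJ : ∀ v ∈ J, ∀ v' ∈ J, v ≠ v' → 2 * t < (v - v').natAbs)
    (hIJ : ∀ v ∈ I, ∀ v' ∈ J, 2 * R < (v - v').natAbs)
    (htail : ∀ v, (patternLaw Q₀ Q₁ (ball v)).real
      {y | c < logLR Q₀ Q₁ (ball v) noSource t y} ≤ η)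
    (hcI : Real.exp c / I.card + 2 * η ≤ κ ^ 2) (hcJ : Real.exp c / J.card + 2 * η ≤ κ ^ 2) :
    ∃ v ∈ I, (patternLaw Q₀ Q₁ (ball v)).real {y | S.T y ≤ (t : ℕ∞)} ≤
      2 * α + η + 2 * κ := by
  classical
  set A : Finset ℤ := W.filter fun w => ∃ v ∈ I, (w - v).natAbs ≤ R with hA
  set E := S.stopsIn A t with hE
  have hEm : MeasurableSet[obsFiltration ℤ t] E := S.measurableSet_stopsIn A t
  have h1 := abs_le.1 (abs_sum_real_inter_sub_le h01 h10
    (integral_abs_sum_cutoffLR_sub_le h01 h10 hκ hI hsepI (fun v _ => htail v) hcI) hEm)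
  have h2 := abs_le.1 (abs_sum_real_inter_sub_le h01 h10
    (integral_abs_sum_cutoffLR_sub_le h01 h10 hκ hJ hsepJ (fun v _ => htail v) hcJ) hEm)
  have hmI : (0 : ℝ) < I.card := by exact_mod_cast hI.card_pos
  have hmJ : (0 : ℝ) < J.card := by exact_mod_cast hJ.card_pos
  have hJE : ∑ v ∈ J, (patternLaw Q₀ Q₁ (ball v)).real
      (E ∩ {y | logLR Q₀ Q₁ (ball v) noSource t y ≤ c}) ≤ J.card * α := by
    rw [← nsmul_eq_mul, ← Finset.sum_const]
    refine Finset.sum_le_sum fun v hv => ?_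
    refine (measureReal_mono Set.inter_subset_left).trans ?_
    refine ENNReal.toReal_le_of_le_ofReal hα
      (measure_stopsIn_all_far_le hS (hJW hv) (fun w hw => ?_) t)
    obtain ⟨-, v', hv', hwv'⟩ := Finset.mem_filter.1 hw
    have := hIJ v' hv' v hv
    omega
  have hPE : (patternLaw Q₀ Q₁ noSource).real E ≤ α + κ := by
    have : (J.card : ℝ) * (patternLaw Q₀ Q₁ noSource).real E ≤ J.card * (α + κ) := by
      linarith [h2.1]
    exact le_of_mul_le_mul_left this hmJ
  have hstopped : ∀ v ∈ I, (patternLaw Q₀ Q₁ (ball v)).real {y | S.T y ≤ (t : ℕ∞)} ≤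
      (patternLaw Q₀ Q₁ (ball v)).real
        (E ∩ {y | logLR Q₀ Q₁ (ball v) noSource t y ≤ c}) + (η + α) := by
    intro v hv
    have hsub : {y | S.T y ≤ (t : ℕ∞)} ⊆
        (E ∩ {y | logLR Q₀ Q₁ (ball v) noSource t y ≤ c}) ∪
          ({y | c < logLR Q₀ Q₁ (ball v) noSource t y} ∪
            S.stopsIn (W.filter fun w => R < (w - v).natAbs) t) := by
      rw [S.setOf_le_eq_stopsIn]
      rintro y ⟨s, hs, hT, hD⟩
      by_cases hfar : R < (S.D s y - v).natAbs
      · exact Or.inr (Or.inr ⟨s, hs, hT, Finset.mem_filter.2 ⟨hD, hfar⟩⟩)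
      · rcases le_or_gt (logLR Q₀ Q₁ (ball v) noSource t y) c with h | h
        · exact Or.inl ⟨⟨s, hs, hT, Finset.mem_filter.2 ⟨hD, v, hv, not_lt.1 hfar⟩⟩, h⟩
        · exact Or.inr (Or.inl h)
    refine (measureReal_mono hsub).trans ((measureReal_union_le _ _).trans ?_)
    gcongr
    refine (measureReal_union_le _ _).trans (add_le_add (htail v) ?_)
    exact ENNReal.toReal_le_of_le_ofReal hα
      (measure_stopsIn_all_far_le hS (hIW hv) (fun w hw => (Finset.mem_filter.1 hw).2) t)
  refine Finset.exists_le_of_sum_le hI ?_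
  refine (Finset.sum_le_sum hstopped).trans ?_
  rw [Finset.sum_add_distrib, Finset.sum_const, Finset.sum_const, nsmul_eq_mul, nsmul_eq_mul]
  nlinarith [h1.2]

end Mixtures

/-! ### Asymptotic comparison and lower bounds for the optimal runtime -/

section

section AsymptoticComparison

lemma asympGE_of_eventually {g h : ℕ → ℝ → ℝ≥0∞}
    (hh : ∀ α, ∀ᶠ n in atTop, h n α ≠ 0 ∧ h n α ≠ ⊤)
    (H : ∀ θ : ℝ, 0 < θ → θ < 1 → ∀ᶠ α in 𝓝[>] (0 : ℝ), ∀ᶠ n in atTop,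
      ENNReal.ofReal θ * h n α ≤ g n α) : AsympGE g h := by
  refine le_of_forall_lt_imp_le_of_dense fun c hc => ?_
  obtain ⟨d, hcd, hd1⟩ := exists_between hc
  have hd : d ≠ ⊤ := (hd1.trans ENNReal.one_lt_top).ne
  have hd0 : 0 < d := (zero_le).trans_lt hcd
  refine hcd.le.trans (le_liminf_of_le (by isBoundedDefault) ?_)
  have hd1' : d.toReal < 1 := by
    rw [← ENNReal.toReal_one]
    exact (ENNReal.toReal_lt_toReal hd ENNReal.one_ne_top).2 hd1
  filter_upwards [H d.toReal (ENNReal.toReal_pos hd0.ne' hd) hd1'] with α hα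
  refine le_liminf_of_le (by isBoundedDefault) ?_
  filter_upwards [hα, hh α] with n hn hhn
  rw [ENNReal.ofReal_toReal hd] at hn
  exact (ENNReal.le_div_iff_mul_le (Or.inl hhn.1) (Or.inl hhn.2)).2 hn

lemma asympLE_of_eventually {g h : ℕ → ℝ → ℝ≥0∞}
    (H : ∀ θ : ℝ, 1 < θ → ∀ᶠ α in 𝓝[>] (0 : ℝ), ∀ᶠ n in atTop,
      g n α ≤ ENNReal.ofReal θ * h n α) : AsympLE g h := by
  refine le_of_forall_gt_imp_ge_of_dense fun c hc => ?_
  obtain ⟨d, hd1, hdc⟩ := exists_between hc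
  have hd : d ≠ ⊤ := (hdc.trans_le le_top).ne
  refine (limsup_le_of_le (by isBoundedDefault) ?_).trans hdc.le
  have hd1' : 1 < d.toReal := by
    rw [← ENNReal.toReal_one]
    exact (ENNReal.toReal_lt_toReal ENNReal.one_ne_top hd).2 hd1
  filter_upwards [H d.toReal hd1'] with α hα
  refine limsup_le_of_le (by isBoundedDefault) ?_
  filter_upwards [hα] with n hn
  rw [ENNReal.ofReal_toReal hd] at hn
  exact ENNReal.div_le_of_le_mul hn

end AsymptoticComparison

/-- A set of `n` vertices inside a ball of radius `r + 1` forces `n ≤ 2 * r + 3`, hence `k ≤ r`. -/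
lemma mem_of_isNbhdSeq {v₀ : ℤ} {W : ℕ → Finset ℤ} (hW : IsNbhdSeq line v₀ W) {n k : ℕ}
    (hk : 2 * k + 3 ≤ n) {w : ℤ} (hw : (w - v₀).natAbs ≤ k) : w ∈ W n := by
  obtain ⟨hcard, r, hr, hr'⟩ := hW n (by omega)
  have hsub : W n ⊆ ball v₀ (r + 1) := fun u hu => by
    rw [mem_ball, ← mem_nbhd_line]
    exact hr' hu
  have := Finset.card_le_card hsub
  rw [hcard, card_ball] at this
  exact hr (mem_nbhd_line.2 (by omega))

lemma tendsto_log_natCast : Tendsto (fun n : ℕ => Real.log n) atTop atTop :=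
  Real.tendsto_log_atTop.comp tendsto_natCast_atTop_atTop

lemma tendsto_exp_mul_log_mul_div {R : ℕ → ℕ} (hR : ∀ n, 0 < R n)
    (hlog : (fun n : ℕ => Real.log (R n)) =o[atTop] (fun n : ℕ => Real.log n)) {γ : ℝ}
    (hγ : γ < 1) :
    Tendsto (fun n : ℕ => Real.exp (γ * Real.log n) * ((R n + 1 : ℕ) / n : ℝ)) atTop (𝓝 0) := by
  have hc : 0 < (1 - γ) / 2 := by linarith
  have h1 : Tendsto (fun n : ℕ => 2 * Real.exp (-((1 - γ) / 2 * Real.log n))) atTop (𝓝 0) := by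
    have := (Real.tendsto_exp_neg_atTop_nhds_zero.comp
      (tendsto_log_natCast.const_mul_atTop hc)).const_mul 2
    simpa using this
  refine squeeze_zero' (Eventually.of_forall fun n => by positivity) ?_ h1
  filter_upwards [hlog.bound hc, eventually_ge_atTop 1] with n hn hn1
  have hnpos : (0 : ℝ) < n := by exact_mod_cast hn1
  have hRpos : (0 : ℝ) < R n := by exact_mod_cast hR n
  have hRle : ((R n + 1 : ℕ) : ℝ) ≤ 2 * R n := by
    have := hR n
    exact_mod_cast (by omega : R n + 1 ≤ 2 * R n)
  rw [Real.norm_of_nonneg (Real.log_natCast_nonneg _),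
    Real.norm_of_nonneg (Real.log_natCast_nonneg _)] at hn
  calc Real.exp (γ * Real.log n) * ((R n + 1 : ℕ) / n : ℝ)
      ≤ Real.exp (γ * Real.log n) * (2 * R n / n) := by gcongr
    _ = 2 * Real.exp (γ * Real.log n + Real.log (R n) - Real.log n) := by
        rw [Real.exp_sub, Real.exp_add, Real.exp_log hRpos, Real.exp_log hnpos]; ring
    _ ≤ _ := by
        gcongr
        linarith

variable {Q₀ Q₁ : Measure ℝ} [IsProbabilityMeasure Q₀] [IsProbabilityMeasure Q₁]

lemma mul_one_sub_le_optRuntime {W : Finset ℤ} {R : ℕ} {α p : ℝ} {t : ℕ} (hp : 0 ≤ p)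
    (h : ∀ S ∈ admissible line Q₀ Q₁ W R α, ∃ v ∈ W,
      patternLaw Q₀ Q₁ (ball v) {y | S.T y ≤ (t : ℕ∞)} ≤ ENNReal.ofReal p) :
    ENNReal.ofReal ((t + 1) * (1 - p)) ≤ optRuntime line Q₀ Q₁ W R α := by
  refine le_iInf₂ fun S hS => ?_
  obtain ⟨v, hv, hvp⟩ := h S hS
  refine le_trans ?_ (mul_le_worstRuntime (Q₀ := Q₀) (Q₁ := Q₁) S hv t)
  rw [ENNReal.ofReal_mul (by positivity), ENNReal.ofReal_sub _ hp, ENNReal.ofReal_one]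
  refine mul_le_mul' (le_of_eq ?_) (tsub_le_tsub_left hvp _)
  rw [← ENNReal.ofReal_natCast]
  push_cast
  rfl

lemma eventually_le_optRuntime_of_diffCount (h01 : Q₀ ≪ Q₁) (h10 : Q₁ ≪ Q₀)
    (hint1 : Integrable (llr Q₁ Q₀) Q₁) (hint0 : Integrable (llr Q₀ Q₁) Q₀)
    (hD : 0 < symmKL Q₀ Q₁) {v₀ : ℤ} {W : ℕ → Finset ℤ} {R : ℕ → ℕ}
    (hW : IsNbhdSeq line v₀ W) (hR : ∀ n, 0 < R n)
    (hlog : (fun n : ℕ => Real.log (R n)) =o[atTop] (fun n : ℕ => Real.log n))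
    {t : ℕ → ℕ} (ht : Tendsto t atTop atTop) {s : ℝ} (hs0 : 0 < s) (hs1 : s < 1)
    (hcount : ∀ᶠ n in atTop, symmKL Q₀ Q₁ * diffCount (R n + 1) (t n) ≤ s * Real.log n)
    {α η : ℝ} (hα0 : 0 < α) (hα1 : α < 1) (hη : 0 < η) :
    ∀ᶠ n in atTop, ENNReal.ofReal ((t n + 1) * (1 - (α + η))) ≤
      optRuntime line Q₀ Q₁ (W n) (R n) α := by
  set D := symmKL Q₀ Q₁ with hDdef
  -- Chosen so that `(D + δ) * s = γ * D` with `γ = (s + 1) / 2 < 1`: the change of measure then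
  -- costs at most `n ^ γ`, and `n ^ γ * (R n + 1) / n` still tends to zero.
  set δ := D * (1 - s) / (2 * s) with hδdef
  have hδ : 0 < δ := by
    have : 0 < 1 - s := by linarith
    positivity
  set γ := (s + 1) / 2 with hγdef
  have hγ1 : γ < 1 := by rw [hγdef]; linarith
  have hγ : (D + δ) * s = γ * D := by rw [hδdef, hγdef]; field_simp; ring
  have hη4 : 0 < η / 4 := by linarith
  obtain ⟨m₀, hm₀⟩ := logLR_upper_tail h01 h10 hint1 hint0 hδ hη4
  have h4 : (0 : ℝ) < 1 / 8 := by norm_num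
  filter_upwards [hcount, ht.eventually_ge_atTop m₀, eventually_ge_atTop 10,
    (tendsto_exp_mul_log_mul_div hR hlog hγ1).eventually_le_const hη4,
    (tendsto_exp_mul_log_mul_div hR hlog zero_lt_one).eventually_le_const h4]
    with n hn htn hn10 hexp hRn
  have hnpos : (0 : ℝ) < n := by positivity
  have hcard := (hW n (by omega)).1
  -- Exponent zero in the same limit says that `R n + 1` is a small fraction of `n`, so both
  -- alternatives `v₀ ± (R n + 1)` lie in `W n`.
  rw [zero_mul, Real.exp_zero, one_mul, div_le_iff₀ hnpos] at hRn
  have hRn' : 8 * (R n + 1) ≤ n := by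
    have : (8 : ℝ) * (R n + 1 : ℕ) ≤ n := by linarith
    exact_mod_cast this
  have hmem : ∀ w : ℤ, (w - v₀).natAbs ≤ R n + 1 → w ∈ W n := fun w hw =>
    mem_of_isNbhdSeq hW (by omega) hw
  set m := diffCount (R n + 1) (t n) with hm
  have hmge : m₀ ≤ m := htn.trans ((Nat.le_succ _).trans (le_diffCount (Nat.le_add_left 1 _) _))
  set x := (D + δ) * m with hx
  have hxle : x ≤ γ * Real.log n := by
    have h1 : D * x ≤ D * (γ * Real.log n) := by
      calc D * x = (D + δ) * (D * m) := by rw [hx]; ring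
        _ ≤ (D + δ) * (s * Real.log n) := by gcongr
        _ = D * (γ * Real.log n) := by rw [← mul_assoc, hγ]; ring
    exact le_of_mul_le_mul_left h1 hD
  refine mul_one_sub_le_optRuntime (by linarith) fun S hS => ⟨v₀, hmem v₀ (by simp), ?_⟩
  have key := measure_stop_le h01 h10 hS (v := v₀) (hmem v₀ (by simp))
    (hmem (v₀ - (R n + 1)) (by omega)) (hmem (v₀ + (R n + 1)) (by omega)) rfl rfl (t n) x
  have hfirst : ENNReal.ofReal (Real.exp x) *
      ((R n + 1 : ℕ) * ENNReal.ofReal (α / (W n).card)) ≤ ENNReal.ofReal (η / 4) := by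
    rw [← ENNReal.ofReal_natCast, ← ENNReal.ofReal_mul (Nat.cast_nonneg _),
      ← ENNReal.ofReal_mul (Real.exp_pos _).le, hcard]
    refine ENNReal.ofReal_le_ofReal (le_trans ?_ hexp)
    rw [← mul_div_assoc]
    gcongr
    exact mul_le_of_le_one_right (by positivity) hα1.le
  have htail : ∀ u : ℤ, (u - v₀).natAbs = R n + 1 → patternLaw Q₀ Q₁ (ball v₀)
      {y | x < logLR Q₀ Q₁ (ball v₀) (ball u) (t n) y} ≤ ENNReal.ofReal (η / 4) := by
    intro u hu
    have := hm₀ v₀ u (t n)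
    rw [hu] at this
    exact this hmge
  refine key.trans ?_
  calc _ ≤ ENNReal.ofReal α + (ENNReal.ofReal (η / 4) + ENNReal.ofReal (η / 4)) +
        (ENNReal.ofReal (η / 4) + ENNReal.ofReal (η / 4)) := by
        gcongr
        · exact htail _ (by omega)
        · exact htail _ (by omega)
    _ = ENNReal.ofReal (α + η) := by
        rw [← ENNReal.ofReal_add hη4.le hη4.le, ← ENNReal.ofReal_add hα0.le (by linarith),
          ← ENNReal.ofReal_add (by linarith) (by linarith)]
        congr 1; ring

lemma eventually_mul_le_optRuntime (h01 : Q₀ ≪ Q₁) (h10 : Q₁ ≪ Q₀)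
    (hint1 : Integrable (llr Q₁ Q₀) Q₁) (hint0 : Integrable (llr Q₀ Q₁) Q₀)
    (hD : 0 < symmKL Q₀ Q₁) {v₀ : ℤ} {W : ℕ → Finset ℤ} {R : ℕ → ℕ}
    (hW : IsNbhdSeq line v₀ W) (hR : ∀ n, 0 < R n)
    (hlog : (fun n : ℕ => Real.log (R n)) =o[atTop] (fun n : ℕ => Real.log n))
    {X : ℕ → ℝ} (hX : Tendsto X atTop atTop)
    (hcount : ∀ s : ℝ, 0 < s → s < 1 → ∀ᶠ n in atTop, ∀ t : ℕ, (t + 1 : ℝ) ≤ s * X n →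
      symmKL Q₀ Q₁ * diffCount (R n + 1) t ≤ s * Real.log n)
    {θ : ℝ} (hθ0 : 0 < θ) (hθ1 : θ < 1) :
    ∀ᶠ α in 𝓝[>] (0 : ℝ), ∀ᶠ n in atTop, ENNReal.ofReal (θ * X n) ≤
      optRuntime line Q₀ Q₁ (W n) (R n) α := by
  -- Three factors of `s` are lost: in the time horizon `s * X n`, in rounding it to an integer, and
  -- in the probability `1 - (α + η) ≥ s` of not having stopped.
  obtain ⟨s, hs0, hs1, hsθ⟩ : ∃ s : ℝ, 0 < s ∧ s < 1 ∧ θ < s ^ 3 := by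
    have : Tendsto (fun s : ℝ => s ^ 3) (𝓝[<] 1) (𝓝 (1 ^ 3)) :=
      ((continuous_pow 3).tendsto 1).mono_left nhdsWithin_le_nhds
    rw [one_pow] at this
    obtain ⟨s, ⟨hs, hs0⟩, hs1⟩ := (((this.eventually_const_lt hθ1).and
      (nhdsWithin_le_nhds (lt_mem_nhds zero_lt_one))).and self_mem_nhdsWithin).exists
    exact ⟨s, hs0, hs1, hs⟩
  have hη : 0 < (1 - s) / 2 := by linarith
  filter_upwards [Ioo_mem_nhdsGT hη] with α hα
  have hsX : Tendsto (fun n => s * X n) atTop atTop := hX.const_mul_atTop hs0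
  have ht : Tendsto (fun n => ⌊s * X n⌋₊ - 1) atTop atTop :=
    (tendsto_sub_atTop_nat 1).comp (tendsto_nat_floor_atTop.comp hsX)
  have hev : ∀ᶠ n in atTop, ((⌊s * X n⌋₊ - 1 : ℕ) : ℝ) + 1 ≤ s * X n ∧
      s * X n - 1 ≤ ((⌊s * X n⌋₊ - 1 : ℕ) : ℝ) + 1 := by
    filter_upwards [hsX.eventually_ge_atTop 1] with n hn
    have h1 : 1 ≤ ⌊s * X n⌋₊ := Nat.le_floor (by simpa using hn)
    rw [Nat.cast_sub h1, Nat.cast_one, sub_add_cancel]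
    exact ⟨Nat.floor_le (by linarith), (Nat.sub_one_lt_floor _).le⟩
  have hcount' : ∀ᶠ n in atTop, symmKL Q₀ Q₁ * diffCount (R n + 1) (⌊s * X n⌋₊ - 1) ≤
      s * Real.log n := by
    filter_upwards [hcount s hs0 hs1, hev] with n hn hn'
    exact hn _ hn'.1
  have hss : 0 < s * (1 - s) := mul_pos hs0 (by linarith)
  filter_upwards [eventually_le_optRuntime_of_diffCount h01 h10 hint1 hint0 hD hW hR hlog ht hs0
    hs1 hcount' hα.1 (by linarith [hα.2]) hη, hev,
    (hX.const_mul_atTop hss).eventually_ge_atTop 1, hX.eventually_ge_atTop 0] with n hn hn' hn1 hn0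
  refine le_trans (ENNReal.ofReal_le_ofReal ?_) hn
  calc θ * X n ≤ s ^ 3 * X n := by gcongr
    _ = (s ^ 2 * X n) * s := by ring
    _ ≤ _ := by
        refine mul_le_mul ?_ (by linarith [hα.2]) hs0.le (by positivity)
        nlinarith [hn'.2]

/-- The two-cluster argument, valid even when `R n` is nearly as large as `n`. The constant depends
only on the mean of `|llr Q₁ Q₀|`, and `α` only has to be small. -/
lemma eventually_sqrt_log_le_optRuntime (h01 : Q₀ ≪ Q₁) (h10 : Q₁ ≪ Q₀)
    (hint1 : Integrable (llr Q₁ Q₀) Q₁) :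
    ∃ c : ℝ, 0 < c ∧ ∀ (v₀ : ℤ) (W : ℕ → Finset ℤ) (R : ℕ → ℕ), IsNbhdSeq line v₀ W →
      (fun n : ℕ => (R n : ℝ)) =o[atTop] (fun n : ℕ => (n : ℝ)) →
      ∀ α : ℝ, 0 < α → α ≤ 1 / 16 → ∀ᶠ n : ℕ in atTop,
        ENNReal.ofReal (c * Real.sqrt (Real.log n)) ≤
          optRuntime line Q₀ Q₁ (W n) (R n) α := by
  set k₁ := ∫ x, |llr Q₁ Q₀ x| ∂Q₁ with hk₁
  have hk₁0 : 0 ≤ k₁ := integral_nonneg fun x => abs_nonneg _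
  -- Small enough that, at times of order `b * √(log n)`, Markov's inequality keeps the
  -- log-likelihood ratio against no source below `log n / 4` with probability at least `63 / 64`.
  set b : ℝ := (32 * (k₁ + 1))⁻¹ with hb
  have hb0 : 0 < b := by positivity
  have hb1 : b ≤ 1 := by
    rw [hb]; exact inv_le_one_of_one_le₀ (by linarith)
  have hbk : 32 * (b * k₁) ≤ 1 := by
    have : 32 * (k₁ + 1) * b = 1 := by rw [hb]; exact mul_inv_cancel₀ (by positivity)
    nlinarith
  refine ⟨b / 32, by positivity, fun v₀ W R hW hRn α hα0 hα1 => ?_⟩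
  have hL := tendsto_log_natCast
  have hsqL : Tendsto (fun n : ℕ => Real.sqrt (Real.log n)) atTop atTop :=
    Real.tendsto_sqrt_atTop.comp hL
  have hlim1 : Tendsto (fun n : ℕ => Real.exp (-(1 / 4 * Real.log n))) atTop (𝓝 0) :=
    Real.tendsto_exp_neg_atTop_nhds_zero.comp (hL.const_mul_atTop (by norm_num))
  have hlim2 : Tendsto (fun n : ℕ => 5 * (Real.log n ^ 1 * Real.exp (-(1 / 2) * Real.log n))) atTop
      (𝓝 0) := by
    have h := (tendsto_rpow_mul_exp_neg_mul_atTop_nhds_zero 1 (1 / 2) (by norm_num)).comp hL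
    have := h.const_mul 5
    simpa using this
  filter_upwards [hlim1.eventually_le_const (show (0 : ℝ) < 1 / 128 by norm_num),
    hlim2.eventually_le_const (show (0 : ℝ) < 1 / 16 by norm_num),
    hRn.bound (show (0 : ℝ) < 1 / 16 by norm_num), eventually_ge_atTop 100,
    (hsqL.const_mul_atTop hb0).eventually_ge_atTop 8, hL.eventually_ge_atTop 1]
    with n hn1 hn2 hn3 hn100 hn8 hL1
  set L := Real.log n with hLdef
  have hnpos : (0 : ℝ) < n := by positivity
  have hexpL : Real.exp L = n := Real.exp_log hnpos
  set t := ⌊b / 8 * Real.sqrt L⌋₊ with ht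
  -- About `√n` sources per cluster: more than the cutoff `exp (L / 4)`, so the diagonal terms are
  -- negligible, yet few enough that a cluster with spacing `2 * t + 1` occupies at most an eighth
  -- of `n`.
  set m := ⌈Real.exp (L / 2)⌉₊ with hm
  set k := (n - 3) / 2 with hk
  have hsq1 : 1 ≤ Real.sqrt L := Real.one_le_sqrt.2 hL1
  have hsqsq : Real.sqrt L ^ 2 = L := Real.sq_sqrt (by linarith)
  have ht_le : (t : ℝ) ≤ b / 8 * Real.sqrt L := Nat.floor_le (by positivity)
  have ht_ge : b / 8 * Real.sqrt L ≤ (t : ℝ) + 1 := (Nat.lt_floor_add_one _).le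
  have hm_ge : Real.exp (L / 2) ≤ m := Nat.le_ceil _
  have hexp1 : 1 ≤ Real.exp (L / 2) := Real.one_le_exp (by linarith)
  have hm_le : (m : ℝ) ≤ 2 * Real.exp (L / 2) := by
    have := Nat.ceil_lt_add_one (Real.exp_pos (L / 2)).le
    linarith
  have hm0 : 0 < m := Nat.ceil_pos.2 (Real.exp_pos _)
  have hmt : 8 * (m * (2 * t + 1)) ≤ n := by
    have h1 : (2 * t + 1 : ℝ) ≤ 5 / 4 * L := by
      have : Real.sqrt L ≤ L := by nlinarith
      nlinarith
    have h2 : (m : ℝ) * (2 * t + 1) ≤ 2 * Real.exp (L / 2) * (5 / 4 * L) := by gcongr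
    have h3 : Real.exp (-(1 / 2) * L) = Real.exp (L / 2) / n := by
      rw [← hexpL, ← Real.exp_sub]; ring_nf
    rw [h3, pow_one, ← mul_div_assoc, ← mul_div_assoc, div_le_iff₀ hnpos] at hn2
    have : (8 * (m * (2 * t + 1)) : ℝ) ≤ n := by nlinarith
    exact_mod_cast this
  have hR : 16 * R n ≤ n := by
    rw [Real.norm_natCast, Real.norm_natCast] at hn3
    have : (16 * R n : ℝ) ≤ n := by linarith
    exact_mod_cast this
  -- The clusters start at the two ends `v₀ ∓ k` and grow inwards, which leaves a gap larger than `2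
  -- * R n`.
  obtain ⟨ι, hι⟩ : ∃ f : ℕ ↪ ℤ, ∀ i : ℕ, f i = v₀ - k + i * (2 * t + 1) :=
    ⟨⟨fun i => v₀ - k + i * (2 * t + 1), fun i j h => by
    have h' : (i : ℤ) * (2 * t + 1) = j * (2 * t + 1) := by simpa using h
    have := mul_right_cancel₀ (by positivity : (2 * t + 1 : ℤ) ≠ 0) h'
    exact_mod_cast this⟩, fun _ => rfl⟩
  obtain ⟨ι', hι'⟩ : ∃ f : ℕ ↪ ℤ, ∀ i : ℕ, f i = v₀ + k - i * (2 * t + 1) :=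
    ⟨⟨fun i => v₀ + k - i * (2 * t + 1), fun i j h => by
    have h' : (i : ℤ) * (2 * t + 1) = j * (2 * t + 1) := by simpa using h
    have := mul_right_cancel₀ (by positivity : (2 * t + 1 : ℤ) ≠ 0) h'
    exact_mod_cast this⟩, fun _ => rfl⟩
  have hprod : ∀ i < m, (0 : ℤ) ≤ i * (2 * t + 1) ∧ 8 * (i * (2 * t + 1) : ℤ) ≤ n := by
    intro i hi
    refine ⟨by positivity, ?_⟩
    have : 8 * (i * (2 * t + 1)) ≤ 8 * (m * (2 * t + 1)) := by gcongr
    exact_mod_cast this.trans hmt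
  have hgap : ∀ i j : ℕ, i ≠ j →
      2 * t < ((i : ℤ) * (2 * t + 1) - j * (2 * t + 1)).natAbs := by
    intro i j hij
    rw [← sub_mul, Int.natAbs_mul]
    have h1 : 1 ≤ ((i : ℤ) - j).natAbs := by omega
    have h2 : (2 * (t : ℤ) + 1).natAbs = 2 * t + 1 := by omega
    rw [h2]
    nlinarith
  have hcardI : ((Finset.range m).map ι).card = m := by rw [Finset.card_map, Finset.card_range]
  have hcardJ : ((Finset.range m).map ι').card = m := by rw [Finset.card_map, Finset.card_range]
  have hcond : Real.exp (L / 4) / m + 2 * (1 / 64) ≤ (1 / 4 : ℝ) ^ 2 := by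
    have h1 : Real.exp (L / 4) / m ≤ Real.exp (L / 4) / Real.exp (L / 2) := by gcongr
    rw [← Real.exp_sub, show L / 4 - L / 2 = -(1 / 4 * L) by ring] at h1
    linarith
  have htail : ∀ v, (patternLaw Q₀ Q₁ (ball v)).real
      {y | L / 4 < logLR Q₀ Q₁ (ball v) noSource t y} ≤ 1 / 64 := by
    intro v
    refine ENNReal.toReal_le_of_le_ofReal (by norm_num)
      ((logLR_noSource_tail h01 h10 hint1 v t (by linarith)).trans (ENNReal.ofReal_le_ofReal ?_))
    rw [div_le_iff₀ (by linarith), ← hk₁]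
    have h1 : (t + 1 : ℝ) ≤ b / 4 * Real.sqrt L := by nlinarith
    calc (t + 1 : ℝ) ^ 2 * k₁ ≤ (b / 4 * Real.sqrt L) ^ 2 * k₁ := by gcongr
      _ = L / 16 * b * (b * k₁) := by rw [mul_pow, hsqsq]; ring
      _ ≤ L / 16 * 1 * (1 / 32) := by
          gcongr
          linarith
      _ ≤ 1 / 64 * (L / 4) := by nlinarith
  -- With `α ≤ 1 / 16`, the bound `2 * α + η + 2 * κ` is at most `1 / 8 + 1 / 64 + 1 / 2 < 3 / 4`.
  have hlow := mul_one_sub_le_optRuntime (Q₀ := Q₀) (Q₁ := Q₁) (W := W n) (R := R n) (α := α)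
    (p := 3 / 4) (t := t) (by norm_num) fun S hS => by
    obtain ⟨v, hv, hvp⟩ := exists_measure_stop_le h01 h10 hα0.le hS (c := L / 4) (η := 1 / 64)
      (κ := 1 / 4) (t := t) (by norm_num) (I := (Finset.range m).map ι)
      (J := (Finset.range m).map ι') (by simpa using hm0.ne') (by simpa using hm0.ne')
      (fun w hw => by
        obtain ⟨i, hi, rfl⟩ := Finset.mem_map.1 hw
        have := hprod i (Finset.mem_range.1 hi)
        refine mem_of_isNbhdSeq hW (k := k) (by omega) ?_
        simp only [hι]
        omega)
      (fun w hw => by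
        obtain ⟨i, hi, rfl⟩ := Finset.mem_map.1 hw
        have := hprod i (Finset.mem_range.1 hi)
        refine mem_of_isNbhdSeq hW (k := k) (by omega) ?_
        simp only [hι']
        omega)
      (fun v hv v' hv' hne => by
        obtain ⟨i, hi, rfl⟩ := Finset.mem_map.1 hv
        obtain ⟨j, hj, rfl⟩ := Finset.mem_map.1 hv'
        have := hgap i j (fun h => hne (by rw [h]))
        simp only [hι]
        omega)
      (fun v hv v' hv' hne => by
        obtain ⟨i, hi, rfl⟩ := Finset.mem_map.1 hv
        obtain ⟨j, hj, rfl⟩ := Finset.mem_map.1 hv'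
        have := hgap i j (fun h => hne (by rw [h]))
        simp only [hι']
        omega)
      (fun v hv v' hv' => by
        obtain ⟨i, hi, rfl⟩ := Finset.mem_map.1 hv
        obtain ⟨j, hj, rfl⟩ := Finset.mem_map.1 hv'
        have h1 := hprod i (Finset.mem_range.1 hi)
        have h2 := hprod j (Finset.mem_range.1 hj)
        rw [hι, hι']
        omega)
      htail (by rw [hcardI]; exact hcond) (by rw [hcardJ]; exact hcond)
    refine ⟨v, ?_, ?_⟩
    · obtain ⟨i, hi, rfl⟩ := Finset.mem_map.1 hv
      have := hprod i (Finset.mem_range.1 hi)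
      refine mem_of_isNbhdSeq hW (k := k) (by omega) ?_
      simp only [hι]
      omega
    · rw [← ofReal_measureReal]
      exact ENNReal.ofReal_le_ofReal (by linarith)
  refine le_trans (ENNReal.ofReal_le_ofReal ?_) hlow
  linarith

end

/-! ### Upper bounds, the two regimes and optimality up to a constant -/

section

variable {Q₀ Q₁ : Measure ℝ} [IsProbabilityMeasure Q₀] [IsProbabilityMeasure Q₁]

lemma optRuntime_le_worstRuntime_msprt (h01 : Q₀ ≪ Q₁) (h10 : Q₁ ≪ Q₀) {W : Finset ℤ}
    (hW : W.Nonempty) (R : ℕ) {α : ℝ} (hα : 0 < α) :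
    optRuntime line Q₀ Q₁ W R α ≤
      worstRuntime line Q₀ Q₁ W (msprtTime line Q₀ Q₁ W R α) := by
  obtain ⟨S, hS⟩ := exists_isMSPRT line Q₀ Q₁ hW R α
  refine (iInf₂_le S (isMSPRT_admissible h01 h10 hα hS)).trans (le_of_eq ?_)
  rw [hS.1]

lemma worstRuntime_msprt_lt_top (h01 : Q₀ ≪ Q₁) (h10 : Q₁ ≪ Q₀)
    (hint1 : Integrable (llr Q₁ Q₀) Q₁) (hint0 : Integrable (llr Q₀ Q₁) Q₀)
    (hD : 0 < symmKL Q₀ Q₁) (W : Finset ℤ) (R : ℕ) (α : ℝ) :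
    worstRuntime line Q₀ Q₁ W (msprtTime line Q₀ Q₁ W R α) < ⊤ := by
  obtain ⟨l, hlm, hl⟩ := ((eventually_llrMoment_le h01 h10 hint1 hint0 (half_pos hD)).and
    self_mem_nhdsWithin).exists
  replace hl : 0 < l := hl
  have hlt : llrMoment Q₀ Q₁ l < 1 := by
    refine hlm.trans_lt ?_
    rw [ENNReal.ofReal_lt_one, Real.exp_lt_one_iff]
    nlinarith
  refine (worstRuntime_msprt_le h01 h10 W R α hl.le hlt.le 0).trans_lt ?_
  refine ENNReal.add_lt_top.2 ⟨ENNReal.natCast_lt_top _, ENNReal.mul_lt_top (ENNReal.mul_lt_top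
    (ENNReal.mul_lt_top (ENNReal.natCast_lt_top _) ENNReal.ofReal_lt_top)
    (ENNReal.pow_lt_top (hlt.trans ENNReal.one_lt_top))) ?_⟩
  exact ENNReal.inv_lt_top.2 (tsub_pos_of_lt hlt)

/-- The parameter `l` is chosen once, with `llrMoment ≤ exp (-(l * x) - C / θ)`. The part `C / θ` of
the exponent beats the union-bound factor `n`; the part `l * x`, where `x ≥ C`, beats the threshold
factor. Since `α` is fixed while `n` grows, `log (1 / α)` is absorbed by `(θ - 1) * log n`. The
overshoot `b` does not depend on `α`. -/
lemma exists_worstRuntime_msprt_le (h01 : Q₀ ≪ Q₁) (h10 : Q₁ ≪ Q₀)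
    (hint1 : Integrable (llr Q₁ Q₀) Q₁) (hint0 : Integrable (llr Q₀ Q₁) Q₀)
    {ε : ℝ} (hε : 0 < ε) (hεD : ε < symmKL Q₀ Q₁) {θ : ℝ} (hθ : 1 < θ) :
    ∃ b : ℝ, 0 ≤ b ∧ ∀ α : ℝ, 0 < α → ∀ᶠ n : ℕ in atTop, ∀ (W : Finset ℤ) (R t : ℕ),
      W.card = n → θ * Real.log n ≤ constC Q₀ Q₁ ε * diffCount (R + 1) t →
      worstRuntime line Q₀ Q₁ W (msprtTime line Q₀ Q₁ W R α) ≤ ENNReal.ofReal (t + b) := by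
  set C := constC Q₀ Q₁ ε with hCdef
  have hC : 0 < C := constC_pos h01 h10 hint1 hint0 hε hεD
  have hCθ : C / θ < C := div_lt_self hC hθ
  have hc0 : 0 < C / θ := div_pos hC (by linarith)
  obtain ⟨l, hl, hlm⟩ := exists_llrMoment_le h01 h10 hint1 hint0 hc0.le
    (hCθ.trans_le (min_le_right _ _))
  have hCx : C ≤ symmKL Q₀ Q₁ - ε := min_le_left _ _
  set x := symmKL Q₀ Q₁ - ε with hx
  have hlx : 0 ≤ l * x := mul_nonneg hl (by linarith)
  have hρ1 : llrMoment Q₀ Q₁ l < 1 := by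
    refine hlm.trans_lt ?_
    rw [ENNReal.ofReal_lt_one, Real.exp_lt_one_iff]
    linarith
  have hinv : (1 - llrMoment Q₀ Q₁ l)⁻¹ ≠ ⊤ := ENNReal.inv_ne_top.2 (tsub_pos_of_lt hρ1).ne'
  refine ⟨((1 - llrMoment Q₀ Q₁ l)⁻¹).toReal, ENNReal.toReal_nonneg, fun α hα => ?_⟩
  filter_upwards [(tendsto_log_natCast.const_mul_atTop (sub_pos.2 hθ)).eventually_ge_atTop
    (-Real.log α), eventually_ge_atTop 1] with n hn hn1 W R t hW hcount
  have hnpos : (0 : ℝ) < n := by exact_mod_cast hn1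
  refine (worstRuntime_msprt_le h01 h10 W R α hl hρ1.le t).trans ?_
  rw [ENNReal.ofReal_add (Nat.cast_nonneg _) ENNReal.toReal_nonneg, ENNReal.ofReal_natCast,
    ENNReal.ofReal_toReal hinv, hW]
  refine add_le_add le_rfl (mul_le_of_le_one_left zero_le ?_)
  set f := diffCount (R + 1) t
  calc (n : ℝ≥0∞) * ENNReal.ofReal (Real.exp (l * Real.log (n / α))) * llrMoment Q₀ Q₁ l ^ f
      ≤ ENNReal.ofReal n * ENNReal.ofReal (Real.exp (l * Real.log (n / α))) *
        ENNReal.ofReal (Real.exp (-(l * x) - C / θ)) ^ f := by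
        rw [ENNReal.ofReal_natCast]
        gcongr
    _ = ENNReal.ofReal (Real.exp (Real.log n + l * (Real.log n - Real.log α) +
          f * (-(l * x) - C / θ))) := by
        rw [← ENNReal.ofReal_pow (Real.exp_pos _).le, ← Real.exp_nat_mul,
          ← ENNReal.ofReal_mul hnpos.le, ← ENNReal.ofReal_mul (by positivity), Real.exp_add,
          Real.exp_add, Real.exp_log hnpos, Real.log_div hnpos.ne' hα.ne']
    _ ≤ 1 := by
        rw [ENNReal.ofReal_le_one, Real.exp_le_one_iff]
        have h1 : Real.log n ≤ f * (C / θ) := by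
          rw [← mul_div_assoc, le_div_iff₀ (by linarith)]
          linarith
        have h2 : θ * Real.log n ≤ f * x := hcount.trans (by
          rw [mul_comm]; gcongr)
        have h3 : l * (θ * Real.log n) ≤ l * (f * x) := by gcongr
        have h4 : l * (-Real.log α) ≤ l * ((θ - 1) * Real.log n) := by gcongr
        nlinarith

lemma sqrt_log_isLittleO_log :
    (fun n : ℕ => Real.log (Real.sqrt (Real.log n))) =o[atTop] (fun n : ℕ => Real.log n) :=
  (Real.isLittleO_log_id_atTop.comp_tendsto
    (Real.tendsto_sqrt_atTop.comp tendsto_log_natCast)).trans_isBigO (by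
      refine IsBigO.of_bound 1 ?_
      filter_upwards [tendsto_log_natCast.eventually_ge_atTop 1] with n hn
      simp only [Function.comp_apply, id]
      rw [Real.norm_of_nonneg (Real.sqrt_nonneg _), Real.norm_of_nonneg (by linarith), one_mul,
        Real.sqrt_le_left (by linarith)]
      nlinarith)

lemma log_isLittleO_log_of_le_sqrt {R : ℕ → ℕ} (hR : ∀ n, 0 < R n)
    (h : ∀ᶠ n : ℕ in atTop, (R n : ℝ) ≤ Real.sqrt (Real.log n)) :
    (fun n : ℕ => Real.log (R n)) =o[atTop] (fun n : ℕ => Real.log n) := by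
  refine IsBigO.trans_isLittleO (IsBigO.of_bound 1 ?_) sqrt_log_isLittleO_log
  filter_upwards [h] with n hn
  have h1 : (1 : ℝ) ≤ R n := by exact_mod_cast hR n
  rw [one_mul, Real.norm_of_nonneg (Real.log_nonneg h1),
    Real.norm_of_nonneg (Real.log_nonneg (h1.trans hn))]
  exact Real.log_le_log (by linarith) hn

lemma tendsto_log_div_succ {R : ℕ → ℕ}
    (h : ∀ᶠ n : ℕ in atTop, (R n : ℝ) ≤ Real.sqrt (Real.log n)) :
    Tendsto (fun n : ℕ => Real.log n / (R n + 1)) atTop atTop := by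
  have h1 : Tendsto (fun n : ℕ => Real.sqrt (Real.log n) / 2) atTop atTop :=
    (Real.tendsto_sqrt_atTop.comp tendsto_log_natCast).atTop_div_const two_pos
  refine tendsto_atTop_mono' _ ?_ h1
  filter_upwards [h, tendsto_log_natCast.eventually_ge_atTop 1] with n hn hL
  have hsq1 : 1 ≤ Real.sqrt (Real.log n) := Real.one_le_sqrt.2 hL
  have hsq := Real.sq_sqrt (show 0 ≤ Real.log n by linarith)
  rw [div_le_div_iff₀ two_pos (by positivity)]
  nlinarith

lemma mul_diffCount_le_of_le_div {D s L : ℝ} (hD : 0 < D) {R t : ℕ}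
    (h : (t + 1 : ℝ) ≤ s * (L / ((R + 1) * D))) : D * diffCount (R + 1) t ≤ s * L := by
  have hpos : (0 : ℝ) < (R + 1) * D := by positivity
  have h1 : (diffCount (R + 1) t : ℝ) ≤ (R + 1) * (t + 1) := by
    exact_mod_cast diffCount_le_mul (R + 1) t
  rw [← mul_div_assoc, le_div_iff₀ hpos] at h
  nlinarith

lemma mul_diffCount_le_of_le_sqrt {D s L : ℝ} (hD : 0 < D) (hL : 0 ≤ L) (hs0 : 0 < s)
    (hs1 : s < 1) {R t : ℕ} (h : (t + 1 : ℝ) ≤ s * Real.sqrt (L / D)) :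
    D * diffCount (R + 1) t ≤ s * L := by
  have h1 : (diffCount (R + 1) t : ℝ) ≤ (t + 1) ^ 2 := by
    exact_mod_cast diffCount_le_sq (R + 1) t
  have h2 : (t + 1 : ℝ) ^ 2 ≤ (s * Real.sqrt (L / D)) ^ 2 := by gcongr
  rw [mul_pow, Real.sq_sqrt (by positivity)] at h2
  calc D * diffCount (R + 1) t ≤ D * (s ^ 2 * (L / D)) := by
        gcongr
        exact h1.trans h2
    _ = s * (s * L) := by field_simp
    _ ≤ s * L := by
        gcongr
        exact mul_le_of_le_one_left hL hs1.le

lemma card_pos_of_isNbhdSeq {v₀ : ℤ} {W : ℕ → Finset ℤ} (hW : IsNbhdSeq line v₀ W) {n : ℕ}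
    (hn : 1 ≤ n) : (W n).Nonempty := by
  rw [← Finset.card_pos, (hW n hn).1]
  exact hn

lemma asympLE_optRuntime (h01 : Q₀ ≪ Q₁) (h10 : Q₁ ≪ Q₀)
    (hint1 : Integrable (llr Q₁ Q₀) Q₁) (hint0 : Integrable (llr Q₀ Q₁) Q₀)
    {ε : ℝ} (hε : 0 < ε) (hεD : ε < symmKL Q₀ Q₁) {v₀ : ℤ} {W : ℕ → Finset ℤ} {R : ℕ → ℕ}
    (hW : IsNbhdSeq line v₀ W) {Y : ℕ → ℝ}
    (hY : ∀ θ : ℝ, 1 < θ → ∃ θ' > 1, ∀ b : ℝ, 0 ≤ b → ∀ᶠ n : ℕ in atTop, ∃ t : ℕ,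
      θ' * Real.log n ≤ constC Q₀ Q₁ ε * diffCount (R n + 1) t ∧ t + b ≤ θ * Y n) :
    AsympLE (fun n α => optRuntime line Q₀ Q₁ (W n) (R n) α) (fun n _ => ENNReal.ofReal (Y n)) := by
  refine asympLE_of_eventually fun θ hθ => ?_
  obtain ⟨θ', hθ', hb⟩ := hY θ hθ
  obtain ⟨b, hb0, hub⟩ := exists_worstRuntime_msprt_le h01 h10 hint1 hint0 hε hεD hθ'
  filter_upwards [self_mem_nhdsWithin] with α hα
  filter_upwards [hb b hb0, hub α hα, eventually_ge_atTop 1] with n hn hn' hn1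
  obtain ⟨t, ht, htb⟩ := hn
  refine (optRuntime_le_worstRuntime_msprt h01 h10 (card_pos_of_isNbhdSeq hW hn1) _ hα).trans
    ((hn' (W n) (R n) t (hW n hn1).1 ht).trans ?_)
  rw [← ENNReal.ofReal_mul (by linarith)]
  exact ENNReal.ofReal_le_ofReal htb

lemma asympLE_optRuntime_of_isLittleO_sqrt_log (h01 : Q₀ ≪ Q₁) (h10 : Q₁ ≪ Q₀)
    (hint1 : Integrable (llr Q₁ Q₀) Q₁) (hint0 : Integrable (llr Q₀ Q₁) Q₀)
    {ε : ℝ} (hε : 0 < ε) (hεD : ε < symmKL Q₀ Q₁) {v₀ : ℤ} {W : ℕ → Finset ℤ} {R : ℕ → ℕ}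
    (hW : IsNbhdSeq line v₀ W) (hR : ∀ n, 0 < R n)
    (hRo : (fun n : ℕ => (R n : ℝ)) =o[atTop] (fun n : ℕ => Real.sqrt (Real.log n))) :
    AsympLE (fun n α => optRuntime line Q₀ Q₁ (W n) (R n) α)
      (fun n _ => ENNReal.ofReal (Real.log n / (R n * constC Q₀ Q₁ ε))) := by
  have hC := constC_pos h01 h10 hint1 hint0 hε hεD
  set C := constC Q₀ Q₁ ε
  refine asympLE_optRuntime h01 h10 hint1 hint0 hε hεD hW fun θ hθ =>
    ⟨(1 + θ) / 2, by linarith, fun b hb => ?_⟩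
  -- Since `R n ^ 2 ≪ log n`, the start-up time `R n + 1`, the rounding and `b` fit into half of the
  -- slack `θ - 1`, measured against `log n / (R n * C)`.
  have hd : 0 < (θ - 1) / 2 / ((3 + b) * C) := by
    have : 0 < θ - 1 := by linarith
    positivity
  filter_upwards [hRo.bound (Real.sqrt_pos.2 hd), tendsto_log_natCast.eventually_ge_atTop 0]
    with n hn hL
  have hR1 : (1 : ℝ) ≤ R n := by exact_mod_cast hR n
  have hRC : 0 < (R n : ℝ) * C := by positivity
  rw [Real.norm_natCast, Real.norm_of_nonneg (Real.sqrt_nonneg _), ← Real.sqrt_mul hd.le] at hn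
  have hsq : (R n : ℝ) ^ 2 ≤ (θ - 1) / 2 / ((3 + b) * C) * Real.log n := by
    have := Real.sq_sqrt (mul_nonneg hd.le hL)
    rw [← this]
    gcongr
  rw [div_mul_eq_mul_div, le_div_iff₀ (by positivity)] at hsq
  set q := ⌈(1 + θ) / 2 * Real.log n / (C * (R n + 1))⌉₊ with hq
  have hq1 : (1 + θ) / 2 * Real.log n / (C * (R n + 1)) ≤ q := Nat.le_ceil _
  have hnum : 0 ≤ (1 + θ) / 2 * Real.log n := mul_nonneg (by linarith) hL
  have hq2 : (q : ℝ) ≤ (1 + θ) / 2 * Real.log n / (R n * C) + 1 := by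
    refine (Nat.ceil_lt_add_one (by positivity)).le.trans ?_
    gcongr ?_ + 1
    refine div_le_div_of_nonneg_left hnum hRC ?_
    nlinarith
  refine ⟨q + (R n + 1), ?_, ?_⟩
  · have h1 : ((R n + 1 : ℕ) * q : ℝ) ≤ diffCount (R n + 1) (q + (R n + 1)) := by
      exact_mod_cast mul_le_diffCount (R n + 1) q
    rw [div_le_iff₀ (by positivity)] at hq1
    push_cast at h1
    nlinarith
  · have h2 : (R n : ℝ) + 2 + b ≤ (θ - 1) / 2 * Real.log n / (R n * C) := by
      rw [le_div_iff₀ hRC]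
      calc ((R n : ℝ) + 2 + b) * (R n * C) ≤ ((3 + b) * R n) * (R n * C) := by
            gcongr
            nlinarith
        _ = (R n : ℝ) ^ 2 * ((3 + b) * C) := by ring
        _ ≤ _ := hsq
    push_cast
    have h3 : θ * (Real.log n / (R n * C)) = (1 + θ) / 2 * Real.log n / (R n * C) +
        (θ - 1) / 2 * Real.log n / (R n * C) := by ring
    rw [h3]
    linarith

lemma asympLE_optRuntime_of_sqrt_log_isLittleO (h01 : Q₀ ≪ Q₁) (h10 : Q₁ ≪ Q₀)
    (hint1 : Integrable (llr Q₁ Q₀) Q₁) (hint0 : Integrable (llr Q₀ Q₁) Q₀)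
    {ε : ℝ} (hε : 0 < ε) (hεD : ε < symmKL Q₀ Q₁) {v₀ : ℤ} {W : ℕ → Finset ℤ} {R : ℕ → ℕ}
    (hW : IsNbhdSeq line v₀ W)
    (hRo : (fun n : ℕ => Real.sqrt (Real.log n)) =o[atTop] (fun n : ℕ => (R n : ℝ))) :
    AsympLE (fun n α => optRuntime line Q₀ Q₁ (W n) (R n) α)
      (fun n _ => ENNReal.ofReal (Real.sqrt (Real.log n / constC Q₀ Q₁ ε))) := by
  have hC := constC_pos h01 h10 hint1 hint0 hε hεD
  set C := constC Q₀ Q₁ ε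
  refine asympLE_optRuntime h01 h10 hint1 hint0 hε hεD hW fun θ hθ => ⟨θ, hθ, fun b hb => ?_⟩
  have hθ0 : 0 < θ := by linarith
  -- The horizon is `√θ` times the target, so the gap between `√θ` and `θ` absorbs rounding and `b`.
  have hθs : Real.sqrt θ < θ := by
    rw [Real.sqrt_lt' hθ0]
    nlinarith
  set a := Real.sqrt (θ / C) with ha
  have ha0 : 0 ≤ a := Real.sqrt_nonneg _
  have hc : 0 < (4 * (a + 1))⁻¹ := by positivity
  have hsqL : Tendsto (fun n : ℕ => Real.sqrt (Real.log n)) atTop atTop :=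
    Real.tendsto_sqrt_atTop.comp tendsto_log_natCast
  have hsqC : Tendsto (fun n : ℕ => Real.sqrt (Real.log n / C)) atTop atTop :=
    Real.tendsto_sqrt_atTop.comp (tendsto_log_natCast.atTop_div_const hC)
  filter_upwards [hRo.bound hc, tendsto_log_natCast.eventually_ge_atTop 0,
    hsqL.eventually_ge_atTop 4, (hsqC.const_mul_atTop (sub_pos.2 hθs)).eventually_ge_atTop (1 + b)]
    with n hn hL hL4 hY
  rw [Real.norm_natCast, Real.norm_of_nonneg (Real.sqrt_nonneg _), inv_mul_eq_div,
    le_div_iff₀ (by positivity)] at hn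
  have hsplit : Real.sqrt (θ * Real.log n / C) = a * Real.sqrt (Real.log n) := by
    rw [ha, ← Real.sqrt_mul (by positivity)]
    congr 1
    ring
  have hsplit' : Real.sqrt (θ * Real.log n / C) = Real.sqrt θ * Real.sqrt (Real.log n / C) := by
    rw [← Real.sqrt_mul hθ0.le]
    congr 1
    ring
  set q := ⌈Real.sqrt (θ * Real.log n / C)⌉₊ with hq
  have hq1 : Real.sqrt (θ * Real.log n / C) ≤ q := Nat.le_ceil _
  have hq2 : (q : ℝ) ≤ Real.sqrt (θ * Real.log n / C) + 1 :=
    (Nat.ceil_lt_add_one (Real.sqrt_nonneg _)).le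
  have hqR : 2 * q + 1 ≤ R n + 1 := by
    have : (2 * q + 1 : ℝ) ≤ R n + 1 := by
      rw [hsplit] at hq2
      nlinarith [mul_nonneg ha0 (Real.sqrt_nonneg (Real.log n))]
    exact_mod_cast this
  refine ⟨q, ?_, ?_⟩
  · rw [diffCount_eq_sq hqR]
    have h1 := Real.sq_sqrt (show 0 ≤ θ * Real.log n / C by positivity)
    have h2 : θ * Real.log n / C ≤ (q + 1 : ℝ) ^ 2 := by
      rw [← h1]
      gcongr
      linarith
    rw [div_le_iff₀ hC] at h2
    push_cast
    linarith
  · rw [hsplit'] at hq2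
    nlinarith

lemma asympGE_optRuntime (h01 : Q₀ ≪ Q₁) (h10 : Q₁ ≪ Q₀)
    (hint1 : Integrable (llr Q₁ Q₀) Q₁) (hint0 : Integrable (llr Q₀ Q₁) Q₀)
    (hD : 0 < symmKL Q₀ Q₁) {v₀ : ℤ} {W : ℕ → Finset ℤ} {R : ℕ → ℕ}
    (hW : IsNbhdSeq line v₀ W) (hR : ∀ n, 0 < R n)
    (hlog : (fun n : ℕ => Real.log (R n)) =o[atTop] (fun n : ℕ => Real.log n))
    {X Y : ℕ → ℝ} (hX : Tendsto X atTop atTop)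
    (hcount : ∀ s : ℝ, 0 < s → s < 1 → ∀ᶠ n in atTop, ∀ t : ℕ, (t + 1 : ℝ) ≤ s * X n →
      symmKL Q₀ Q₁ * diffCount (R n + 1) t ≤ s * Real.log n)
    (hY : ∀ᶠ n in atTop, 0 < Y n ∧ Y n ≤ X n) :
    AsympGE (fun n α => optRuntime line Q₀ Q₁ (W n) (R n) α) (fun n _ => ENNReal.ofReal (Y n)) := by
  refine asympGE_of_eventually (fun _ => ?_) fun θ hθ0 hθ1 => ?_
  · filter_upwards [hY] with n hn
    exact ⟨(ENNReal.ofReal_pos.2 hn.1).ne', ENNReal.ofReal_ne_top⟩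
  · filter_upwards [eventually_mul_le_optRuntime h01 h10 hint1 hint0 hD hW hR hlog hX hcount
      hθ0 hθ1] with α hα
    filter_upwards [hα, hY] with n hn hYn
    refine le_trans ?_ hn
    rw [← ENNReal.ofReal_mul hθ0.le]
    exact ENNReal.ofReal_le_ofReal (mul_le_mul_of_nonneg_left hYn.2 hθ0.le)

lemma asympGE_optRuntime_of_isLittleO_sqrt_log (h01 : Q₀ ≪ Q₁) (h10 : Q₁ ≪ Q₀)
    (hint1 : Integrable (llr Q₁ Q₀) Q₁) (hint0 : Integrable (llr Q₀ Q₁) Q₀)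
    (hD : 0 < symmKL Q₀ Q₁) {v₀ : ℤ} {W : ℕ → Finset ℤ} {R : ℕ → ℕ}
    (hW : IsNbhdSeq line v₀ W) (hR : ∀ n, 0 < R n)
    (hRo : (fun n : ℕ => (R n : ℝ)) =o[atTop] (fun n : ℕ => Real.sqrt (Real.log n))) :
    AsympGE (fun n α => optRuntime line Q₀ Q₁ (W n) (R n) α)
      (fun n _ => ENNReal.ofReal (Real.log n / (2 * R n * symmKL Q₀ Q₁))) := by
  have hle : ∀ᶠ n : ℕ in atTop, (R n : ℝ) ≤ Real.sqrt (Real.log n) := by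
    filter_upwards [hRo.bound one_pos] with n hn
    rwa [Real.norm_natCast, Real.norm_of_nonneg (Real.sqrt_nonneg _), one_mul] at hn
  have hX : Tendsto (fun n : ℕ => Real.log n / ((R n + 1) * symmKL Q₀ Q₁)) atTop atTop := by
    simp_rw [← div_div]
    exact (tendsto_log_div_succ hle).atTop_div_const hD
  refine asympGE_optRuntime h01 h10 hint1 hint0 hD hW hR (log_isLittleO_log_of_le_sqrt hR hle) hX
    (fun s _ _ => Eventually.of_forall fun n t h => mul_diffCount_le_of_le_div hD h) ?_
  filter_upwards [tendsto_log_natCast.eventually_gt_atTop 0] with n hn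
  -- The factor `2` of the stated bound is only used for `R n + 1 ≤ 2 * R n`.
  have hR1 : (1 : ℝ) ≤ R n := by exact_mod_cast hR n
  refine ⟨by positivity, ?_⟩
  gcongr
  linarith

lemma asympGE_optRuntime_of_sqrt_log_isLittleO (h01 : Q₀ ≪ Q₁) (h10 : Q₁ ≪ Q₀)
    (hint1 : Integrable (llr Q₁ Q₀) Q₁) (hint0 : Integrable (llr Q₀ Q₁) Q₀)
    (hD : 0 < symmKL Q₀ Q₁) {v₀ : ℤ} {W : ℕ → Finset ℤ} {R : ℕ → ℕ}
    (hW : IsNbhdSeq line v₀ W) (hR : ∀ n, 0 < R n)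
    (hlog : (fun n : ℕ => Real.log (R n)) =o[atTop] (fun n : ℕ => Real.log n)) :
    AsympGE (fun n α => optRuntime line Q₀ Q₁ (W n) (R n) α)
      (fun n _ => ENNReal.ofReal (Real.sqrt (Real.log n / symmKL Q₀ Q₁))) := by
  refine asympGE_optRuntime h01 h10 hint1 hint0 hD hW hR hlog
    (Real.tendsto_sqrt_atTop.comp (tendsto_log_natCast.atTop_div_const hD))
    (fun s hs0 hs1 => ?_) ?_
  · filter_upwards [tendsto_log_natCast.eventually_ge_atTop 0] with n hn t h
    exact mul_diffCount_le_of_le_sqrt hD hn hs0 hs1 h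
  · filter_upwards [tendsto_log_natCast.eventually_gt_atTop 0] with n hn
    exact ⟨Real.sqrt_pos.2 (div_pos hn hD), le_rfl⟩

/-- With `R'` the radius capped near `√(log n)`, both runtimes are compared with `X = log n / (R' +
1)`. If the cap is inactive, the change-of-measure bound gives the lower estimate; otherwise `X ≤
√(log n)` and the two-cluster bound applies. The upper estimate uses monotonicity of `diffCount` in
the distance. -/
lemma exists_asympLE_msprt (h01 : Q₀ ≪ Q₁) (h10 : Q₁ ≪ Q₀)
    (hint1 : Integrable (llr Q₁ Q₀) Q₁) (hint0 : Integrable (llr Q₀ Q₁) Q₀)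
    (hD : 0 < symmKL Q₀ Q₁) :
    ∃ K : ℝ, 0 < K ∧ ∀ (v₀ : ℤ) (W : ℕ → Finset ℤ) (R : ℕ → ℕ), IsNbhdSeq line v₀ W →
      (∀ n, 0 < R n) → (fun n : ℕ => (R n : ℝ)) =o[atTop] (fun n : ℕ => (n : ℝ)) →
      AsympLE (fun n α => worstRuntime line Q₀ Q₁ (W n) (msprtTime line Q₀ Q₁ (W n) (R n) α))
        (fun n α => ENNReal.ofReal K * optRuntime line Q₀ Q₁ (W n) (R n) α) := by
  have hε : 0 < symmKL Q₀ Q₁ / 2 := half_pos hD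
  have hεD : symmKL Q₀ Q₁ / 2 < symmKL Q₀ Q₁ := half_lt_self hD
  have hC := constC_pos h01 h10 hint1 hint0 hε hεD
  obtain ⟨b, hb0, hub⟩ := exists_worstRuntime_msprt_le h01 h10 hint1 hint0 hε hεD one_lt_two
  obtain ⟨c, hc0, hlow⟩ := eventually_sqrt_log_le_optRuntime h01 h10 hint1
  set D := symmKL Q₀ Q₁
  set C := constC Q₀ Q₁ (D / 2)
  set k := min (1 / (2 * D)) c with hk
  have hk0 : 0 < k := lt_min (by positivity) hc0
  -- The horizon is `2 / C * X` rounded up, plus the start-up time `R' + 1 ≤ 4 * X`; the rounding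
  -- and `b` together cost at most one more `X`.
  refine ⟨(5 + 2 / C) / k, by positivity, fun v₀ W R hW hR hRo => ?_⟩
  set R' : ℕ → ℕ := fun n => min (R n) (max 1 ⌊Real.sqrt (Real.log n)⌋₊) with hR'
  have hR'0 : ∀ n, 0 < R' n := fun n => lt_min (hR n) (by positivity)
  have hR'le : ∀ᶠ n : ℕ in atTop, (R' n : ℝ) ≤ Real.sqrt (Real.log n) := by
    filter_upwards [tendsto_log_natCast.eventually_ge_atTop 1] with n hn
    have h1 : R' n ≤ max 1 ⌊Real.sqrt (Real.log n)⌋₊ := min_le_right _ _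
    have h2 : 1 ≤ ⌊Real.sqrt (Real.log n)⌋₊ := Nat.le_floor (by simpa using hn)
    rw [max_eq_right h2] at h1
    exact (Nat.cast_le.2 h1).trans (Nat.floor_le (Real.sqrt_nonneg _))
  have hXlim := tendsto_log_div_succ hR'le
  have hX : Tendsto (fun n : ℕ => Real.log n / ((R' n + 1) * D)) atTop atTop := by
    simp_rw [← div_div]
    exact hXlim.atTop_div_const hD
  have hsmall := eventually_mul_le_optRuntime h01 h10 hint1 hint0 hD hW hR'0
    (log_isLittleO_log_of_le_sqrt hR'0 hR'le) hX
    (fun s _ _ => Eventually.of_forall fun n t h => mul_diffCount_le_of_le_div hD h)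
    (θ := 1 / 2) (by norm_num) (by norm_num)
  refine asympLE_of_eventually fun θ hθ => ?_
  filter_upwards [hsmall, Ioc_mem_nhdsGT (show (0 : ℝ) < 1 / 16 by norm_num)] with α hα hα16
  filter_upwards [hα, hlow v₀ W R hW hRo α hα16.1 hα16.2, hub α hα16.1, hR'le,
    hXlim.eventually_ge_atTop (1 + b), tendsto_log_natCast.eventually_ge_atTop 1,
    eventually_ge_atTop 1] with n hn1 hn2 hn3 hn4 hn5 hL hn
  set L := Real.log n
  set X := L / (R' n + 1 : ℝ) with hXdef
  have hX0 : 0 ≤ X := by linarith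
  have hRpos : (0 : ℝ) < R' n + 1 := by positivity
  have hXmul : X * (R' n + 1) = L := div_mul_cancel₀ _ hRpos.ne'
  have hsq1 : 1 ≤ Real.sqrt L := Real.one_le_sqrt.2 hL
  have hsqsq : Real.sqrt L ^ 2 = L := Real.sq_sqrt (by linarith)
  have hlower : ENNReal.ofReal (k * X) ≤ optRuntime line Q₀ Q₁ (W n) (R n) α := by
    rcases le_or_gt (R n) (max 1 ⌊Real.sqrt L⌋₊) with h | h
    · have hRR : R' n = R n := min_eq_left h
      rw [← hRR]
      refine (ENNReal.ofReal_le_ofReal ?_).trans hn1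
      calc k * X ≤ 1 / (2 * D) * X := by
            gcongr
            exact min_le_left _ _
        _ = 1 / 2 * (L / ((R' n + 1) * D)) := by rw [hXdef]; field_simp
    · have hRR : R' n = max 1 ⌊Real.sqrt L⌋₊ := min_eq_right h.le
      refine (ENNReal.ofReal_le_ofReal ?_).trans hn2
      have h1 : Real.sqrt L ≤ R' n + 1 := by
        refine (Nat.lt_floor_add_one _).le.trans ?_
        gcongr
        rw [hRR]
        exact le_max_right _ _
      have h2 : X ≤ Real.sqrt L := by
        rw [hXdef, div_le_iff₀ hRpos]
        nlinarith
      exact mul_le_mul (min_le_right _ _) h2 hX0 hc0.le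
  have hR'X : (R' n + 1 : ℝ) ≤ 4 * X := by
    have h1 : (R' n + 1 : ℝ) ≤ 2 * Real.sqrt L := by linarith
    have h2 : (R' n + 1 : ℝ) * (R' n + 1) ≤ 4 * X * (R' n + 1) := by
      rw [mul_assoc, hXmul]
      nlinarith
    exact le_of_mul_le_mul_right h2 hRpos
  set q := ⌈2 / C * X⌉₊ with hq
  have hq1 : 2 / C * X ≤ q := Nat.le_ceil _
  have hq2 : (q : ℝ) ≤ 2 / C * X + 1 := (Nat.ceil_lt_add_one (by positivity)).le
  have hupper := hn3 (W n) (R n) (q + (R' n + 1)) (hW n hn).1 (by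
    have h1 : ((R' n + 1 : ℕ) * q : ℝ) ≤ diffCount (R n + 1) (q + (R' n + 1)) := by
      exact_mod_cast (mul_le_diffCount (R' n + 1) q).trans
        (diffCount_mono_left (Nat.succ_le_succ (min_le_left _ _)) _)
    calc 2 * L = C * ((R' n + 1 : ℕ) * (2 / C * X)) := by
          push_cast
          rw [← hXmul]
          field_simp
      _ ≤ C * ((R' n + 1 : ℕ) * q) := by gcongr
      _ ≤ _ := by gcongr)
  calc worstRuntime line Q₀ Q₁ (W n) (msprtTime line Q₀ Q₁ (W n) (R n) α)
      ≤ ENNReal.ofReal ((q + (R' n + 1) : ℕ) + b) := hupper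
    _ ≤ ENNReal.ofReal ((5 + 2 / C) / k * (k * X)) := by
        refine ENNReal.ofReal_le_ofReal ?_
        rw [← mul_assoc, div_mul_cancel₀ _ hk0.ne']
        push_cast
        linarith
    _ = ENNReal.ofReal ((5 + 2 / C) / k) * ENNReal.ofReal (k * X) :=
        ENNReal.ofReal_mul (by positivity)
    _ ≤ ENNReal.ofReal ((5 + 2 / C) / k) * optRuntime line Q₀ Q₁ (W n) (R n) α := by gcongr
    _ ≤ ENNReal.ofReal θ * (ENNReal.ofReal ((5 + 2 / C) / k) *
          optRuntime line Q₀ Q₁ (W n) (R n) α) :=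
        le_mul_of_one_le_left zero_le (ENNReal.one_le_ofReal.2 hθ.le)

end

end Cascade

theorem corollary2 (Q₀ Q₁ : Measure ℝ) [IsProbabilityMeasure Q₀] [IsProbabilityMeasure Q₁]
    (hne : Q₀ ≠ Q₁) (h01 : Q₀ ≪ Q₁) (h10 : Q₁ ≪ Q₀)
    (hint1 : Integrable (llr Q₁ Q₀) Q₁) (hint0 : Integrable (llr Q₀ Q₁) Q₀) :
    -- for `R_n ≪ n`, the MSPRT is optimal up to a constant factor `K(Q₀, Q₁)`
    (∃ K : ℝ, 0 < K ∧
      ∀ (v₀ : ℤ) (W : ℕ → Finset ℤ) (R : ℕ → ℕ),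
        Cascade.IsNbhdSeq Cascade.line v₀ W → (∀ n, 0 < R n) →
        (fun n : ℕ => (R n : ℝ)) =o[atTop] (fun n : ℕ => (n : ℝ)) →
        (∀ n, 1 ≤ n → ∀ α : ℝ, 0 < α → α < 1 →
          (∃ S, Cascade.IsMSPRT Cascade.line Q₀ Q₁ (W n) (R n) α S) ∧
          (∀ S, Cascade.IsMSPRT Cascade.line Q₀ Q₁ (W n) (R n) α S →
            S ∈ Cascade.admissible Cascade.line Q₀ Q₁ (W n) (R n) α) ∧
          Cascade.worstRuntime Cascade.line Q₀ Q₁ (W n)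
            (Cascade.msprtTime Cascade.line Q₀ Q₁ (W n) (R n) α) < ⊤) ∧
        Cascade.AsympLE
          (fun n α => Cascade.worstRuntime Cascade.line Q₀ Q₁ (W n)
            (Cascade.msprtTime Cascade.line Q₀ Q₁ (W n) (R n) α))
          (fun n α => ENNReal.ofReal K *
            Cascade.optRuntime Cascade.line Q₀ Q₁ (W n) (R n) α)) ∧
    -- the two-sided bounds on the optimal runtime in the two regimes
    (∀ ε : ℝ, 0 < ε → ε < Cascade.symmKL Q₀ Q₁ →
      0 < Cascade.constC Q₀ Q₁ ε ∧ Cascade.constC Q₀ Q₁ ε < Cascade.symmKL Q₀ Q₁ ∧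
      ∀ (v₀ : ℤ) (W : ℕ → Finset ℤ) (R : ℕ → ℕ),
        Cascade.IsNbhdSeq Cascade.line v₀ W → (∀ n, 0 < R n) →
        ((fun n : ℕ => (R n : ℝ)) =o[atTop] (fun n : ℕ => Real.sqrt (Real.log n)) →
          Cascade.AsympGE
            (fun n α => Cascade.optRuntime Cascade.line Q₀ Q₁ (W n) (R n) α)
            (fun n _ => ENNReal.ofReal
              (Real.log n / (2 * R n * Cascade.symmKL Q₀ Q₁))) ∧
          Cascade.AsympLE
            (fun n α => Cascade.optRuntime Cascade.line Q₀ Q₁ (W n) (R n) α)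
            (fun n _ => ENNReal.ofReal
              (Real.log n / (R n * Cascade.constC Q₀ Q₁ ε)))) ∧
        ((fun n : ℕ => Real.sqrt (Real.log n)) =o[atTop] (fun n : ℕ => (R n : ℝ)) →
          (fun n : ℕ => Real.log (R n)) =o[atTop] (fun n : ℕ => Real.log n) →
          Cascade.AsympGE
            (fun n α => Cascade.optRuntime Cascade.line Q₀ Q₁ (W n) (R n) α)
            (fun n _ => ENNReal.ofReal
              (Real.sqrt (Real.log n / Cascade.symmKL Q₀ Q₁))) ∧
          Cascade.AsympLE
            (fun n α => Cascade.optRuntime Cascade.line Q₀ Q₁ (W n) (R n) α)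
            (fun n _ => ENNReal.ofReal
              (Real.sqrt (Real.log n / Cascade.constC Q₀ Q₁ ε))))) := by
  have hD := Cascade.symmKL_pos hne h01 h10 hint1
  refine ⟨?_, fun ε hε hεD => ⟨Cascade.constC_pos h01 h10 hint1 hint0 hε hεD,
    Cascade.constC_lt Q₀ Q₁ hε, fun v₀ W R hW hR => ⟨fun hRo => ⟨?_, ?_⟩, fun hRo hlog => ⟨?_, ?_⟩⟩⟩⟩
  · obtain ⟨K, hK, h⟩ := Cascade.exists_asympLE_msprt h01 h10 hint1 hint0 hD
    refine ⟨K, hK, fun v₀ W R hW hR hRo => ⟨fun n hn α hα _ => ⟨?_, ?_, ?_⟩, h v₀ W R hW hR hRo⟩⟩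
    · exact Cascade.exists_isMSPRT _ Q₀ Q₁ (Cascade.card_pos_of_isNbhdSeq hW hn) _ _
    · exact fun S hS => Cascade.isMSPRT_admissible h01 h10 hα hS
    · exact Cascade.worstRuntime_msprt_lt_top h01 h10 hint1 hint0 hD _ _ _
  · exact Cascade.asympGE_optRuntime_of_isLittleO_sqrt_log h01 h10 hint1 hint0 hD hW hR hRo
  · exact Cascade.asympLE_optRuntime_of_isLittleO_sqrt_log h01 h10 hint1 hint0 hε hεD hW hR hRo
  · exact Cascade.asympGE_optRuntime_of_sqrt_log_isLittleO h01 h10 hint1 hint0 hD hW hR hlog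
  · exact Cascade.asympLE_optRuntime_of_sqrt_log_isLittleO h01 h10 hint1 hint0 hε hεD hW hRo
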